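/- An instance of \textsc{CC-MaxSAT} consists of a CNF formula $\Phi$ with $n$ variables and $m$ clauses and a positive integer $k\le n$; the feasible solutions are the assignments of weight $k$ (exactly $k$ variables are assigned $1$), and the goal is to maximize the number of satisfied clauses. The variable-clause incidence graph of $\Phi$ is the bipartite graph in which a variable is adjacent to the clauses in which it occurs, positively or negatively; it is $K_{d,d}$-free if it has no subgraph isomorphic to $K_{d,d}$. Theorem. There is a single randomized algorithm and an absolute constant $C$ such that the following holds for every instance $(\Phi,k)$ of \textsc{CC-MaxSAT}, every integer $d\ge 1$ such that the variable-clause incidence graph of $\Phi$ is $K_{d,d}$-free, and every rational $\varepsilon$ with $0<\varepsilon\le 1$. On input $(\Phi,k,d,\varepsilon)$ the algorithm halts, for every outcome of its coin tosses, after at most $$C\cdot\Big(\frac{dk}{\varepsilon}\Big)^{C\,dk}\,(n+m)^{C}$$ steps, that is, in time $\big(\frac{dk}{\varepsilon}\big)^{\mathcal{O}(dk)}(n+m)^{\mathcal{O}(1)}$; and with probability at least $1-\frac1e$ it returns an assignment of weight $k$ that satisfies at least $(1-\varepsilon)\,\mathsf{OPT}$ clauses, where $\mathsf{OPT}$ is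 the maximum number of clauses satisfied by an assignment of weight $k$. (Running times are measured on a random access machine with unit-cost addition and subtraction, without multiplication, and with fair coin tosses; $\varepsilon$ is given by its numerator and denominator.) -/

import Mathlib

/-! ### CNF formulas and cardinality-constrained MaxSAT -/

/-- A CNF formula with variables `Fin n` and clauses indexed by `Fin m` (so the same clause may
occur several times). A clause is a finite set of literals; the literal `(i, true)` is the variable
`i` and `(i, false)` is its negation. -/
abbrev CNFFormula (n m : ℕ) : Type := Fin m → Finset (Fin n × Bool)

namespace CNFFormula

variable {n m : ℕ}

/-- The weight of an assignment is the number of variables assigned `1`. -/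
def weight (β : Fin n → Bool) : ℕ := (Finset.univ.filter fun i => β i = true).card

/-- The number of clauses of `Φ` that contain a literal made true by `β`. -/
def numSat (Φ : CNFFormula n m) (β : Fin n → Bool) : ℕ :=
  (Finset.univ.filter fun j : Fin m => ∃ l ∈ Φ j, β l.1 = l.2).card

/-- `σ` has weight `k`, and it satisfies at least `(1 - ε)` times as many clauses as any other
assignment of weight `k`. -/
def IsApproxSolution (Φ : CNFFormula n m) (k : ℕ) (ε : ℚ) (σ : Fin n → Bool) : Prop :=
  weight σ = k ∧
    ∀ β : Fin n → Bool, weight β = k → (1 - ε) * (Φ.numSat β : ℚ) ≤ (Φ.numSat σ : ℚ)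

/-- The bipartite variable-clause incidence graph: the variable `i` is adjacent to the clause `j`
if `i` occurs in `j`, positively or negatively. -/
def incidenceGraph (Φ : CNFFormula n m) : SimpleGraph (Fin n ⊕ Fin m) :=
  SimpleGraph.fromRel fun a b =>
    ∃ (i : Fin n) (j : Fin m) (s : Bool), a = Sum.inl i ∧ b = Sum.inr j ∧ (i, s) ∈ Φ j

/-- The formula is `K_{d,d}`-free. (For `d ≥ 1` a copy of `K_{d,d}` in a bipartite graph is
automatically an induced subgraph.) -/
def BicliqueFree (Φ : CNFFormula n m) (d : ℕ) : Prop :=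
  (completeBipartiteGraph (Fin d) (Fin d)).Free Φ.incidenceGraph

end CNFFormula

/-! ### Randomized random access machines -/

namespace RAM

/-- A memory state: registers and arrays of natural numbers, and the number of coins tossed
so far. -/
structure State where
  reg : ℕ → ℕ
  arr : ℕ → ℕ → ℕ
  coins : ℕ

namespace State

/-- Write `v` to the register `r`. -/
def setReg (s : State) (r v : ℕ) : State := { s with reg := Function.update s.reg r v }

/-- Write `v` to the cell `i` of the array `a`. -/
def setArr (s : State) (a i v : ℕ) : State :=
  { s with arr := Function.update s.arr a (Function.update (s.arr a) i v) }

end State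

/-- Programs of the machine. The arguments of the instructions are fixed names of registers and
arrays, so a program uses only finitely many of these; array cells are addressed indirectly,
through the content of a register. There is no multiplication: with unit-cost addition and
(truncated) subtraction, running times agree with those of multitape Turing machines up to a
polynomial. -/
inductive Prog : Type
  /-- `r := c` -/
  | const (r c : ℕ)
  /-- `r := x + y` -/
  | add (r x y : ℕ)
  /-- `r := max (x - y) 0` -/
  | sub (r x y : ℕ)
  /-- `r := a[x]` -/
  | load (r a x : ℕ)
  /-- `a[x] := y` -/
  | store (a x y : ℕ)
  /-- `r :=` a fresh fair random bit -/
  | flip (r : ℕ)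
  /-- `p; q` -/
  | seq (p q : Prog)
  /-- if `x ≠ 0` then `p` else `q` -/
  | ite (x : ℕ) (p q : Prog)
  /-- while `x ≠ 0` do `p` -/
  | loop (x : ℕ) (p : Prog)

/-- `Exec ω P s s' t`: with the sequence `ω` of coin tosses, the program `P` started in the state
`s` halts in the state `s'` after exactly `t` steps. Each elementary instruction and each test of a
condition is one step. -/
inductive Exec (ω : ℕ → Bool) : Prog → State → State → ℕ → Prop
  | const (r c : ℕ) (s : State) : Exec ω (.const r c) s (s.setReg r c) 1
  | add (r x y : ℕ) (s : State) : Exec ω (.add r x y) s (s.setReg r (s.reg x + s.reg y)) 1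
  | sub (r x y : ℕ) (s : State) : Exec ω (.sub r x y) s (s.setReg r (s.reg x - s.reg y)) 1
  | load (r a x : ℕ) (s : State) : Exec ω (.load r a x) s (s.setReg r (s.arr a (s.reg x))) 1
  | store (a x y : ℕ) (s : State) : Exec ω (.store a x y) s (s.setArr a (s.reg x) (s.reg y)) 1
  | flip (r : ℕ) (s : State) :
      Exec ω (.flip r) s { s.setReg r (ω s.coins).toNat with coins := s.coins + 1 } 1
  | seq {p q : Prog} {s s₁ s₂ : State} {t₁ t₂ : ℕ} :
      Exec ω p s s₁ t₁ → Exec ω q s₁ s₂ t₂ → Exec ω (.seq p q) s s₂ (t₁ + t₂)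
  | ite_true {x : ℕ} {p q : Prog} {s s' : State} {t : ℕ} :
      s.reg x ≠ 0 → Exec ω p s s' t → Exec ω (.ite x p q) s s' (t + 1)
  | ite_false {x : ℕ} {p q : Prog} {s s' : State} {t : ℕ} :
      s.reg x = 0 → Exec ω q s s' t → Exec ω (.ite x p q) s s' (t + 1)
  | loop_true {x : ℕ} {p : Prog} {s s₁ s₂ : State} {t₁ t₂ : ℕ} :
      s.reg x ≠ 0 → Exec ω p s s₁ t₁ → Exec ω (.loop x p) s₁ s₂ t₂ →
        Exec ω (.loop x p) s s₂ (t₁ + t₂ + 1)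
  | loop_false {x : ℕ} {p : Prog} {s : State} :
      s.reg x = 0 → Exec ω (.loop x p) s s 1

/-- The law of an infinite sequence of independent fair coin tosses. -/
noncomputable def coinMeasure : MeasureTheory.Measure (ℕ → Bool) :=
  MeasureTheory.Measure.infinitePi fun _ => (PMF.uniformOfFintype Bool).toMeasure

/-- The initial state for the instance `(Φ, k)`, the parameter `d` and the accuracy `ε > 0`:
registers `0, …, 5` hold `n`, `m`, `k`, `d` and the numerator and the denominator of `ε`; cell
`j * n + i` of array `0` (of array `1`) says whether the positive (the negative) literal of the
variable `i` is in the clause `j`; everything else is `0`. -/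
def input {n m : ℕ} (Φ : CNFFormula n m) (k d : ℕ) (ε : ℚ) : State where
  reg r := [n, m, k, d, ε.num.toNat, ε.den].getD r 0
  arr a c :=
    if ∃ (i : Fin n) (j : Fin m), c = j * n + i ∧
      ((a = 0 ∧ (i, true) ∈ Φ j) ∨ (a = 1 ∧ (i, false) ∈ Φ j)) then 1 else 0
  coins := 0

/-- The assignment that a final state holds in the first `n` cells of array `2`. -/
def output (n : ℕ) (s : State) : Fin n → Bool := fun i => decide (s.arr 2 i = 1)

end RAM

/-!
The algorithm needs no coins: it branches deterministically, and the event in question is certain.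

*Branching.* Let `q = ⌈1 / ε⌉`. There are `k` slots, one for each chosen variable, and a state
`V i v` records which variables `v` are still candidates for the slot `i`. A variable is *heavy* if
its negative literal occurs in more than a `1 / (4 k q)` fraction of the clauses that have at least
one and at most `k` negative literals; there are few of these, and it is guessed how many of the
slots belong to heavy variables. (If `n` is bounded in terms of `k` and `q`, all variables are
treated as heavy.) Light variables occur negatively in so few relevant clauses that these occurrences
can be ignored throughout at a loss of a `1 / (2 q)` fraction of the optimum
(`Inst.Q_mul_lightLoss_le`, `Inst.exists_mixed_le`). A clause counts as satisfied (`Inst.Cov`) if it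
has a negative literal outside the chosen heavy variables, or if all candidates of some slot occur in
it positively.

Let `y` be the candidate of largest residual degree in an open slot. Either replacing the optimal
choice for this slot by `y` costs at most a `1 / (2 k q)` fraction of the optimum, or `y` shares many
residual clauses with the optimal choice `x` for some open slot (`Inst.Inv.progress`). In the second
case, if the degree of `y` is large, then by the counting argument of Kővári, Sós and Turán only
boundedly many variables share so many clauses with `y` (`Inst.card_sharing_le`), and the algorithm
branches over them. If the degree is small, it branches over the clauses of `y` to find one that
contains `x`, and restricts the slot of `x` to the variables of this clause. After `d` restrictions
of a slot, its candidates have `d` clauses in common, so fewer than `d` candidates are left, and they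
can be tried one by one. Hence `k (d + 1)` steps suffice, all decisions are encoded in one number
`z < Z = (d k q) ^ O(d k)`, and some `z` leads to a good solution (`Inst.exists_advice`,
`Inst.exists_good_advice`).

*Machine.* The search over all `z < Z` is written in a small language of bounded loops (`Tm`, `Cmd`),
in which every loop and every sum is bounded by a parameter register. The compiler into programs of
the random access machine is verified once and for all (`Cmd.exec_compile`), and as the nesting depth
of a fixed command is constant, its running time is polynomial in the largest parameter
(`Cmd.exists_cost_le`), which is at most `n + m + Z`. What remains is to evaluate the command
(`Cmd.run_main`) and to bound `Z` in terms of `d k / ε` (`Inst.Z_le`).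
-/

open RAM

/-! ### A language of bounded loops and its compiler -/

/-- Terms: arithmetic over registers and array cells, closed under bounded summation. The term
`sum x p e` stands for the sum of `e` over all values of the register `x` below the content of the
register `p`. A term is used as a condition by asking whether its value is nonzero. -/
inductive Tm : Type
  | const (c : ℕ)
  | reg (x : ℕ)
  | arr (a : ℕ) (e : Tm)
  | add (e f : Tm)
  | sub (e f : Tm)
  | ite (c e f : Tm)
  | sum (x p : ℕ) (e : Tm)

namespace Tm

/-- The value of a term in a state. -/
def val : Tm → State → ℕ
  | const c, _ => c
  | reg x, s => s.reg x
  | arr a e, s => s.arr a (e.val s)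
  | add e f, s => e.val s + f.val s
  | sub e f, s => e.val s - f.val s
  | ite c e f, s => if c.val s ≠ 0 then e.val s else f.val s
  | sum x p e, s => ∑ i ∈ Finset.range (s.reg p), e.val (s.setReg x i)

/-- A term is well formed for `b ≤ r₀` if it names only registers below `r₀`, takes the bounds of
its sums from the parameter registers, those below `b`, and binds none of these. -/
def WF (b r₀ : ℕ) : Tm → Bool
  | const _ => true
  | reg x => decide (x < r₀)
  | arr _ e => e.WF b r₀
  | add e f => e.WF b r₀ && f.WF b r₀
  | sub e f => e.WF b r₀ && f.WF b r₀
  | ite c e f => c.WF b r₀ && e.WF b r₀ && f.WF b r₀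
  | sum x p e => decide (b ≤ x) && decide (x < r₀) && decide (p < b) && e.WF b r₀

/-- A program that leaves the value of the term in the register `r` and changes no register below
`r`. The bound register of a sum is saved and restored. -/
def compile : Tm → ℕ → Prog
  | const c, r => .const r c
  | reg x, r => .seq (.const r 0) (.add r r x)
  | arr a e, r => .seq (e.compile r) (.load r a r)
  | add e f, r => .seq (e.compile r) (.seq (f.compile (r + 1)) (.add r r (r + 1)))
  | sub e f, r => .seq (e.compile r) (.seq (f.compile (r + 1)) (.sub r r (r + 1)))
  | ite c e f, r => .seq (c.compile r) (.ite r (e.compile r) (f.compile r))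
  | sum x p e, r =>
      .seq (.const r 0) <| .seq (.add (r + 1) x r) <| .seq (.add (r + 2) p r) <|
      .seq (.const x 0) <|
      .seq (.loop (r + 2) <|
        .seq (e.compile (r + 3)) <| .seq (.add r r (r + 3)) <| .seq (.const (r + 3) 1) <|
        .seq (.add x x (r + 3)) (.sub (r + 2) (r + 2) (r + 3))) <|
      .seq (.const (r + 2) 0) (.add x (r + 1) (r + 2))

/-- A bound for the running time of the compiled term when the parameters are at most `B`. -/
def cost (B : ℕ) : Tm → ℕ
  | const _ => 1
  | reg _ => 2
  | arr _ e => e.cost B + 1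
  | add e f => e.cost B + f.cost B + 1
  | sub e f => e.cost B + f.cost B + 1
  | ite c e f => c.cost B + e.cost B + f.cost B + 1
  | sum _ _ e => B * (e.cost B + 5) + 7

theorem val_congr {b r₀ : ℕ} {e : Tm} (he : e.WF b r₀) {s s' : State}
    (hr : ∀ y < r₀, s.reg y = s'.reg y) (ha : s.arr = s'.arr) : e.val s = e.val s' := by
  induction e generalizing s s' with
  | const c => rfl
  | reg x => exact hr x (by simpa [WF] using he)
  | arr a e ih => simp only [val, ih (by simpa [WF] using he) hr ha, ha]
  | add e f ihe ihf =>
    simp only [WF, Bool.and_eq_true] at he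
    simp only [val, ihe he.1 hr ha, ihf he.2 hr ha]
  | sub e f ihe ihf =>
    simp only [WF, Bool.and_eq_true] at he
    simp only [val, ihe he.1 hr ha, ihf he.2 hr ha]
  | ite c e f ihc ihe ihf =>
    simp only [WF, Bool.and_eq_true] at he
    simp only [val, ihc he.1.1 hr ha, ihe he.1.2 hr ha, ihf he.2 hr ha]
  | sum x p e ih =>
    simp only [WF, Bool.and_eq_true, decide_eq_true_eq] at he
    obtain ⟨⟨⟨hbx, hx⟩, hp⟩, he⟩ := he
    simp only [val, hr p (by omega)]
    refine Finset.sum_congr rfl fun i _ => ih he (fun y hy => ?_) ha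
    simp only [State.setReg, Function.update_apply]
    split_ifs
    · rfl
    · exact hr y hy

/-- The loop of a compiled sum, started with `cnt` rounds to go. -/
theorem exec_sum_loop {ω : ℕ → Bool} {b r₀ B x : ℕ} {e : Tm} {r : ℕ}
    (he : e.WF b r₀) (hbx : b ≤ x) (hx : x < r₀) (hr : r₀ ≤ r)
    (ih : ∀ r ≥ r₀, ∀ s : State, (∀ p < b, s.reg p ≤ B) → ∃ s' t,
      Exec ω (e.compile r) s s' t ∧ s'.reg r = e.val s ∧ (∀ y < r, s'.reg y = s.reg y) ∧
        s'.arr = s.arr ∧ s'.coins = s.coins ∧ t ≤ e.cost B)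
    (s : State) (hB : ∀ p < b, s.reg p ≤ B) (cnt : ℕ) :
    ∀ (i : ℕ) (σ : State), σ.reg x = i → σ.reg (r + 2) = cnt → σ.reg (r + 1) = s.reg x →
      (∀ y < r, y ≠ x → σ.reg y = s.reg y) → σ.arr = s.arr → σ.coins = s.coins →
      ∃ s' t, Exec ω (.loop (r + 2) <|
          .seq (e.compile (r + 3)) <| .seq (.add r r (r + 3)) <| .seq (.const (r + 3) 1) <|
          .seq (.add x x (r + 3)) (.sub (r + 2) (r + 2) (r + 3))) σ s' t ∧
        s'.reg r = σ.reg r + ∑ l ∈ Finset.range cnt, e.val (s.setReg x (i + l)) ∧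
        s'.reg (r + 1) = s.reg x ∧
        (∀ y < r, y ≠ x → s'.reg y = s.reg y) ∧ s'.arr = s.arr ∧ s'.coins = s.coins ∧
        t ≤ cnt * (e.cost B + 5) + 1 := by
  induction cnt with
  | zero =>
    intro i σ _ h2 h3 h4 h5 h6
    exact ⟨σ, 1, .loop_false h2, by simp, h3, h4, h5, h6, by simp⟩
  | succ cnt ihc =>
    intro i σ h1 h2 h3 h4 h5 h6
    obtain ⟨τ, t, hex, hv, hlow, harr, hcoins, ht⟩ := ih (r + 3) (by omega) σ (fun q hq => by
      rw [h4 q (by omega) (by omega)]; exact hB q hq)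
    have hval : e.val σ = e.val (s.setReg x i) := by
      refine val_congr he (fun y hy => ?_) h5
      simp only [State.setReg, Function.update_apply]
      split_ifs with hyx
      · rw [hyx, h1]
      · exact h4 y (by omega) hyx
    have hxr : x ≠ r := by omega
    have hxr1 : x ≠ r + 1 := by omega
    have hxr2 : x ≠ r + 2 := by omega
    have hxr3 : x ≠ r + 3 := by omega
    obtain ⟨s', t', hex', g1, g2, g3, g4, g5, g6⟩ := ihc (i + 1)
      ((((τ.setReg r (τ.reg r + τ.reg (r + 3))).setReg (r + 3) 1).setReg x
        (τ.reg x + 1)).setReg (r + 2) (τ.reg (r + 2) - 1))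
      (by simp [State.setReg, hxr2, hlow x (by omega), h1])
      (by simp [State.setReg, hlow (r + 2) (by omega), h2])
      (by simp [State.setReg, hxr1.symm, hlow (r + 1) (by omega), h3])
      (fun y hy hyx => by
        have h1 : y ≠ r := by omega
        have h2 : y ≠ r + 2 := by omega
        have h3 : y ≠ r + 3 := by omega
        simp [State.setReg, h1, h2, h3, hyx, hlow y (by omega), h4 y hy hyx])
      (by simp [State.setReg, harr, h5]) (by simp [State.setReg, hcoins, h6])
    refine ⟨s', t + (1 + (1 + (1 + 1))) + t' + 1,
      .loop_true (by omega) (.seq hex (.seq (.add ..) (.seq (.const ..)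
      (.seq (.add ..) (.sub ..))))) ?_, ?_, g2, g3, g4, g5, ?_⟩
    · convert hex' using 2
      all_goals simp [State.setReg, hxr, hxr2.symm, hxr3, hxr3.symm]
    · rw [g1, Finset.sum_range_succ' (fun l => e.val (s.setReg x (i + l)))]
      simp [State.setReg, hxr.symm, hlow r (by omega), hv, hval]
      simp only [add_assoc, add_comm 1]
      ring
    · rw [Nat.succ_mul]
      omega

theorem exec_compile (ω : ℕ → Bool) {b r₀ : ℕ} (B : ℕ) (hbr : b ≤ r₀) (e : Tm) (he : e.WF b r₀) :
    ∀ r ≥ r₀, ∀ s : State, (∀ p < b, s.reg p ≤ B) → ∃ s' t,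
      Exec ω (e.compile r) s s' t ∧ s'.reg r = e.val s ∧ (∀ y < r, s'.reg y = s.reg y) ∧
        s'.arr = s.arr ∧ s'.coins = s.coins ∧ t ≤ e.cost B := by
  have upd : ∀ (s : State) (r v : ℕ), ∀ y < r, (s.setReg r v).reg y = s.reg y := by
    intro s r v y hy
    simp [State.setReg, hy.ne]
  induction e with
  | const c =>
    intro r _ s _
    exact ⟨_, _, .const .., by simp [State.setReg, val], upd s r c, rfl, rfl, by simp [cost]⟩
  | reg x =>
    intro r hr s _
    simp only [WF, decide_eq_true_eq] at he
    refine ⟨_, _, .seq (.const ..) (.add ..), ?_, ?_, rfl, rfl, by simp [cost]⟩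
    · have : x ≠ r := by omega
      simp [State.setReg, val, this]
    · intro y hy
      rw [upd _ _ _ y hy, upd _ _ _ y hy]
  | arr a e ih =>
    intro r hr s hB
    obtain ⟨s', t, h1, h2, h3, h4, h5, h6⟩ := ih (by simpa [WF] using he) r hr s hB
    refine ⟨_, _, .seq h1 (.load ..), ?_, ?_, h4, h5, by simp only [cost]; omega⟩
    · simp [State.setReg, val, h2, h4]
    · intro y hy
      rw [upd _ _ _ y hy, h3 y hy]
  | add e f ihe ihf =>
    intro r hr s hB
    simp only [WF, Bool.and_eq_true] at he
    obtain ⟨s₁, t₁, h1, h2, h3, h4, h5, h6⟩ := ihe he.1 r hr s hB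
    obtain ⟨s₂, t₂, g1, g2, g3, g4, g5, g6⟩ := ihf he.2 (r + 1) (by omega) s₁ (fun p hp => by
      rw [h3 p (by omega)]; exact hB p hp)
    refine ⟨_, _, .seq h1 (.seq g1 (.add ..)), ?_, ?_, g4.trans h4, g5.trans h5,
      by simp only [cost]; omega⟩
    · simp [State.setReg, val, g2, g3 r (by omega), h2,
        val_congr he.2 (s := s₁) (s' := s) (fun y hy => h3 y (by omega)) h4]
    · intro y hy
      rw [upd _ _ _ y hy, g3 y (by omega), h3 y hy]
  | sub e f ihe ihf =>
    intro r hr s hB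
    simp only [WF, Bool.and_eq_true] at he
    obtain ⟨s₁, t₁, h1, h2, h3, h4, h5, h6⟩ := ihe he.1 r hr s hB
    obtain ⟨s₂, t₂, g1, g2, g3, g4, g5, g6⟩ := ihf he.2 (r + 1) (by omega) s₁ (fun p hp => by
      rw [h3 p (by omega)]; exact hB p hp)
    refine ⟨_, _, .seq h1 (.seq g1 (.sub ..)), ?_, ?_, g4.trans h4, g5.trans h5,
      by simp only [cost]; omega⟩
    · simp [State.setReg, val, g2, g3 r (by omega), h2,
        val_congr he.2 (s := s₁) (s' := s) (fun y hy => h3 y (by omega)) h4]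
    · intro y hy
      rw [upd _ _ _ y hy, g3 y (by omega), h3 y hy]
  | ite c e f ihc ihe ihf =>
    intro r hr s hB
    simp only [WF, Bool.and_eq_true] at he
    obtain ⟨s₁, t₁, h1, h2, h3, h4, h5, h6⟩ := ihc he.1.1 r hr s hB
    have hB₁ : ∀ p < b, s₁.reg p ≤ B := fun p hp => by rw [h3 p (by omega)]; exact hB p hp
    by_cases hc : c.val s = 0
    · obtain ⟨s₂, t₂, g1, g2, g3, g4, g5, g6⟩ := ihf he.2 r hr s₁ hB₁
      refine ⟨s₂, _, .seq h1 (.ite_false (h2.trans hc) g1), ?_,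
        fun y hy => (g3 y hy).trans (h3 y hy),
        g4.trans h4, g5.trans h5, by simp only [cost]; omega⟩
      simp [val, hc, g2, val_congr he.2 (s := s₁) (s' := s) (fun y hy => h3 y (by omega)) h4]
    · obtain ⟨s₂, t₂, g1, g2, g3, g4, g5, g6⟩ := ihe he.1.2 r hr s₁ hB₁
      refine ⟨s₂, _, .seq h1 (.ite_true (by rwa [h2]) g1), ?_,
        fun y hy => (g3 y hy).trans (h3 y hy), g4.trans h4, g5.trans h5,
        by simp only [cost]; omega⟩
      simp [val, hc, g2, val_congr he.1.2 (s := s₁) (s' := s) (fun y hy => h3 y (by omega)) h4]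
  | sum x p e ih =>
    intro r hr s hB
    simp only [WF, Bool.and_eq_true, decide_eq_true_eq] at he
    obtain ⟨⟨⟨hbx, hx⟩, hp⟩, he⟩ := he
    have hxr : x ≠ r := by omega
    have hxr1 : x ≠ r + 1 := by omega
    have hxr2 : x ≠ r + 2 := by omega
    have hpr : p ≠ r := by omega
    have hpr1 : p ≠ r + 1 := by omega
    obtain ⟨s', t, hex, g1, g2, g3, g4, g5, g6⟩ :=
      exec_sum_loop he hbx hx hr (ih he) s hB (s.reg p) 0
      ((((s.setReg r 0).setReg (r + 1) (s.reg x)).setReg (r + 2) (s.reg p)).setReg x 0)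
      (by simp [State.setReg]) (by simp [State.setReg, hxr2.symm])
      (by simp [State.setReg, hxr1.symm])
      (fun y hy hyx => by
        have h1 : y ≠ r := by omega
        have h2 : y ≠ r + 1 := by omega
        have h3 : y ≠ r + 2 := by omega
        simp [State.setReg, h1, h2, h3, hyx]) rfl rfl
    refine ⟨(s'.setReg (r + 2) 0).setReg x (s'.reg (r + 1)), 1 + (1 + (1 + (1 + (t + (1 + 1))))),
      .seq (.const ..) (.seq (.add ..) (.seq (.add ..) (.seq (.const ..) (.seq ?_
        (.seq (.const _ _ s') ?_))))), ?_, ?_, g4, g5, ?_⟩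
    rotate_left 1
    · convert Exec.add x (r + 1) (r + 2) (s'.setReg (r + 2) 0) using 2
      simp [State.setReg]
    · simp [State.setReg, val, hxr.symm, g1]
    · intro y hy
      by_cases hyx : y = x
      · simp [State.setReg, hyx, g2]
      · have h3 : y ≠ r + 2 := by omega
        simp [State.setReg, hyx, h3, g3 y hy hyx]
    · have : s.reg p * (e.cost B + 5) ≤ B * (e.cost B + 5) := Nat.mul_le_mul_right _ (hB p hp)
      simp only [cost]
      omega
    · convert hex using 2
      simp [State.setReg, hxr, hpr, hpr1]

/-- The running time of a compiled term is polynomial in the parameters. -/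
theorem exists_cost_le (e : Tm) : ∃ C, ∀ B, e.cost B ≤ C * (B + 1) ^ C := by
  have key : ∀ (C C' B : ℕ), C ≤ C' → C * (B + 1) ^ C ≤ C' * (B + 1) ^ C' := fun C C' B h =>
    Nat.mul_le_mul h (Nat.pow_le_pow_right (by omega) h)
  have one : ∀ (C B : ℕ), 1 ≤ (B + 1) ^ C := fun C B => Nat.one_le_pow _ _ (by omega)
  have key2 : ∀ (C D B : ℕ), C * (B + 1) ^ C + D * (B + 1) ^ D + 1 ≤
      (C + D + 1) * (B + 1) ^ (C + D + 1) := by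
    intro C D B
    have h1 := Nat.mul_le_mul_left C
      (Nat.pow_le_pow_right (Nat.succ_pos B) (show C ≤ C + D + 1 by omega))
    have h2 := Nat.mul_le_mul_left D
      (Nat.pow_le_pow_right (Nat.succ_pos B) (show D ≤ C + D + 1 by omega))
    have h3 := one (C + D + 1) B
    simp only [Nat.succ_eq_add_one] at h1 h2
    nlinarith
  induction e with
  | const c => exact ⟨1, fun B => by simp [cost]⟩
  | reg x => exact ⟨2, fun B => by simpa [cost] using Nat.one_le_pow 2 (B + 1) (by omega)⟩
  | arr a e ih =>
    obtain ⟨C, hC⟩ := ih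
    exact ⟨C + 0 + 1, fun B => le_trans (by simp only [cost]; have := hC B; omega) (key2 C 0 B)⟩
  | add e f ihe ihf =>
    obtain ⟨C, hC⟩ := ihe
    obtain ⟨D, hD⟩ := ihf
    exact ⟨_, fun B => le_trans
      (by simp only [cost]; have := hC B; have := hD B; omega) (key2 C D B)⟩
  | sub e f ihe ihf =>
    obtain ⟨C, hC⟩ := ihe
    obtain ⟨D, hD⟩ := ihf
    exact ⟨_, fun B => le_trans
      (by simp only [cost]; have := hC B; have := hD B; omega) (key2 C D B)⟩
  | ite c e f ihc ihe ihf =>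
    obtain ⟨C, hC⟩ := ihe
    obtain ⟨D, hD⟩ := ihf
    obtain ⟨E, hE⟩ := ihc
    refine ⟨_, fun B => le_trans ?_ (key2 (C + D + 1) E B)⟩
    have := hC B
    have := hD B
    have := hE B
    have := key2 C D B
    simp only [cost]
    omega
  | sum x p e ih =>
    obtain ⟨C, hC⟩ := ih
    refine ⟨C + 12, fun B => ?_⟩
    have h1 := hC B
    have h2 := Nat.mul_le_mul_left C
      (Nat.pow_le_pow_right (Nat.succ_pos B) (show C ≤ C + 11 by omega))
    have h3 := one (C + 11) B
    simp only [cost, Nat.succ_eq_add_one] at *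
    rw [show C + 12 = (C + 11) + 1 by omega, pow_succ]
    calc B * (e.cost B + 5) + 7 ≤ (B + 1) * (e.cost B + 12) := by nlinarith
      _ ≤ (B + 1) * ((C + 12) * (B + 1) ^ (C + 11)) := Nat.mul_le_mul_left _ (by nlinarith)
      _ = _ := by ring

end Tm

/-- `iterate f n s` applies `f 0`, then `f 1`, and so on up to `f (n - 1)` to `s`. -/
def iterate {α : Type} (f : ℕ → α → α) : ℕ → α → α
  | 0, s => s
  | n + 1, s => f n (iterate f n s)

theorem iterate_induction {α : Type} {f : ℕ → α → α} {n : ℕ} {s : α} (p : ℕ → α → Prop)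
    (h0 : p 0 s) (hs : ∀ i < n, ∀ σ, p i σ → p (i + 1) (f i σ)) : p n (iterate f n s) := by
  induction n with
  | zero => exact h0
  | succ n ih => exact hs n (by omega) _ (ih fun i hi => hs i (by omega))

/-- Commands: assignments of terms to registers and to array cells, composition, and the loop
`loop x p c`, which runs `c` for all values of the register `x` below the content of `p`. -/
inductive Cmd : Type
  | assign (x : ℕ) (e : Tm)
  | store (a : ℕ) (e f : Tm)
  | seq (c d : Cmd)
  | loop (x p : ℕ) (c : Cmd)

namespace Cmd

/-- The final state of a command. -/
def run : Cmd → State → State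
  | assign x e, s => s.setReg x (e.val s)
  | store a e f, s => s.setArr a (e.val s) (f.val s)
  | seq c d, s => d.run (c.run s)
  | loop x p c, s => iterate (fun i σ => c.run (σ.setReg x i)) (s.reg p) s

/-- A command is well formed for `b ≤ r₀` if it names only registers below `r₀`, takes the bounds
of its sums and loops from the parameter registers, those below `b`, and assigns to none of
these. -/
def WF (b r₀ : ℕ) : Cmd → Bool
  | assign x e => decide (b ≤ x) && decide (x < r₀) && e.WF b r₀
  | store _ e f => e.WF b r₀ && f.WF b r₀
  | seq c d => c.WF b r₀ && d.WF b r₀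
  | loop x p c => decide (b ≤ x) && decide (x < r₀) && decide (p < b) && c.WF b r₀

/-- Whether a command may change the register `y`. -/
def sets (y : ℕ) : Cmd → Bool
  | assign x _ => x == y
  | store _ _ _ => false
  | seq c d => c.sets y || d.sets y
  | loop x _ c => x == y || c.sets y

/-- Whether a command may change the array `a`. -/
def stores (a : ℕ) : Cmd → Bool
  | assign _ _ => false
  | store a' _ _ => a' == a
  | seq c d => c.stores a || d.stores a
  | loop _ _ c => c.stores a

/-- The program of a command; it keeps its own data in the registers from `r` on. A loop counts
in registers of its own, so that it runs the right number of times even if its body assigns to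
the loop variable. -/
def compile : Cmd → ℕ → Prog
  | assign x e, r => .seq (e.compile r) <| .seq (.const (r + 1) 0) (.add x r (r + 1))
  | store a e f, r => .seq (e.compile r) <| .seq (f.compile (r + 1)) (.store a r (r + 1))
  | seq c d, r => .seq (c.compile r) (d.compile r)
  | loop x p c, r =>
      .seq (.const r 0) <| .seq (.add (r + 1) p r) <|
      .loop (r + 1) <|
        .seq (.const (r + 2) 0) <| .seq (.add x r (r + 2)) <| .seq (c.compile (r + 2)) <|
        .seq (.const (r + 2) 1) <| .seq (.add r r (r + 2)) (.sub (r + 1) (r + 1) (r + 2))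

/-- A bound for the running time of the compiled command when the parameters are at most `B`. -/
def cost (B : ℕ) : Cmd → ℕ
  | assign _ e => e.cost B + 2
  | store _ e f => e.cost B + f.cost B + 1
  | seq c d => c.cost B + d.cost B
  | loop _ _ c => B * (c.cost B + 6) + 3

theorem run_reg {c : Cmd} {y : ℕ} (h : c.sets y = false) (s : State) :
    (c.run s).reg y = s.reg y := by
  induction c generalizing s with
  | assign x e =>
    have : y ≠ x := by rintro rfl; simp [sets] at h
    simp [run, State.setReg, this]
  | store a e f => rfl
  | seq c d ihc ihd =>
    simp only [sets, Bool.or_eq_false_iff] at h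
    rw [run, ihd h.2, ihc h.1]
  | loop x p c ih =>
    simp only [sets, Bool.or_eq_false_iff] at h
    have : y ≠ x := by rintro rfl; simp at h
    refine iterate_induction (fun _ (σ : State) => σ.reg y = s.reg y) rfl fun i _ σ hσ => ?_
    rw [ih h.2, ← hσ]
    simp [State.setReg, this]

theorem run_arr {c : Cmd} {a : ℕ} (h : c.stores a = false) (s : State) :
    (c.run s).arr a = s.arr a := by
  induction c generalizing s with
  | assign x e => rfl
  | store a' e f =>
    have : a ≠ a' := by rintro rfl; simp [stores] at h
    simp [run, State.setArr, this]
  | seq c d ihc ihd =>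
    simp only [stores, Bool.or_eq_false_iff] at h
    rw [run, ihd h.2, ihc h.1]
  | loop x p c ih =>
    refine iterate_induction (fun _ (σ : State) => σ.arr a = s.arr a) rfl fun i _ σ hσ => ?_
    rw [ih h, ← hσ]
    rfl

theorem sets_eq_false_of_lt {b r₀ : ℕ} {c : Cmd} (hc : c.WF b r₀) {y : ℕ} (hy : y < b) :
    c.sets y = false := by
  induction c with
  | assign x e =>
    simp only [WF, Bool.and_eq_true, decide_eq_true_eq] at hc
    simp only [sets, beq_eq_false_iff_ne]
    omega
  | store a e f => rfl
  | seq c d ihc ihd =>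
    simp only [WF, Bool.and_eq_true] at hc
    simp [sets, ihc hc.1, ihd hc.2]
  | loop x p c ih =>
    simp only [WF, Bool.and_eq_true, decide_eq_true_eq] at hc
    simp only [sets, ih hc.2, Bool.or_false, beq_eq_false_iff_ne]
    omega

/-- Two states with the same arrays, the same number of coins tossed, and the same registers
below `r₀`. -/
structure Agree (r₀ : ℕ) (s s' : State) : Prop where
  reg : ∀ y < r₀, s.reg y = s'.reg y
  arr : s.arr = s'.arr
  coins : s.coins = s'.coins

theorem Agree.setReg {r₀ : ℕ} {s s' : State} (h : Agree r₀ s s') (x v : ℕ) :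
    Agree r₀ (s.setReg x v) (s'.setReg x v) := by
  refine ⟨fun y hy => ?_, h.arr, h.coins⟩
  simp only [State.setReg, Function.update_apply, h.reg y hy]

theorem Agree.setReg_left {r₀ : ℕ} {s s' : State} (h : Agree r₀ s s') {x : ℕ} (hx : r₀ ≤ x)
    (v : ℕ) : Agree r₀ (s.setReg x v) s' := by
  refine ⟨fun y hy => ?_, h.arr, h.coins⟩
  have : y ≠ x := by omega
  simp [State.setReg, this, h.reg y hy]

/-- The compiler is correct: on a state that agrees with `σ` the compiled command ends, within the
stated time, in a state that agrees with the final state of the command on `σ`. -/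
theorem exec_compile (ω : ℕ → Bool) {b r₀ : ℕ} (B : ℕ) (hbr : b ≤ r₀) (c : Cmd)
    (hc : c.WF b r₀) :
    ∀ r ≥ r₀, ∀ s σ : State, Agree r₀ s σ → (∀ p < b, s.reg p ≤ B) → ∃ s' t,
      Exec ω (c.compile r) s s' t ∧ Agree r₀ s' (c.run σ) ∧
        (∀ y, r₀ ≤ y → y < r → s'.reg y = s.reg y) ∧ t ≤ c.cost B := by
  induction c with
  | assign x e =>
    intro r hr s σ hs hB
    simp only [WF, Bool.and_eq_true, decide_eq_true_eq] at hc
    obtain ⟨s', t, h1, h2, h3, h4, h5, h6⟩ := e.exec_compile ω B hbr hc.2 r hr s hB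
    refine ⟨_, _, .seq h1 (.seq (.const ..) (.add ..)), ?_, ?_, by simp only [cost]; omega⟩
    · have : e.val s = e.val σ := Tm.val_congr hc.2 hs.reg hs.arr
      refine ⟨fun y hy => ?_, h4.trans hs.arr, h5.trans hs.coins⟩
      have hy1 : y ≠ r + 1 := by omega
      by_cases hyx : y = x
      · simp [State.setReg, run, h2, hyx, this]
      · simp [State.setReg, run, hyx, hy1, h3 y (by omega), hs.reg y hy]
    · intro y hy hyr
      have hy1 : y ≠ r + 1 := by omega
      have hyx : y ≠ x := by omega
      simp [State.setReg, hy1, hyx, h3 y hyr]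
  | store a e f =>
    intro r hr s σ hs hB
    simp only [WF, Bool.and_eq_true] at hc
    obtain ⟨s₁, t₁, h1, h2, h3, h4, h5, h6⟩ := e.exec_compile ω B hbr hc.1 r hr s hB
    obtain ⟨s₂, t₂, g1, g2, g3, g4, g5, g6⟩ := f.exec_compile ω B hbr hc.2 (r + 1) (by omega) s₁
      (fun p hp => by rw [h3 p (by omega)]; exact hB p hp)
    refine ⟨_, _, .seq h1 (.seq g1 (.store ..)), ⟨fun y hy => ?_, ?_, g5.trans (h5.trans hs.coins)⟩,
      fun y _ hy => ?_, by simp only [cost]; omega⟩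
    · exact (g3 y (by omega)).trans ((h3 y (by omega)).trans (hs.reg y hy))
    · have he : e.val s = e.val σ := Tm.val_congr hc.1 hs.reg hs.arr
      have hf : f.val s₁ = f.val σ := Tm.val_congr hc.2
        (fun y hy => (h3 y (by omega)).trans (hs.reg y hy)) (h4.trans hs.arr)
      simp [State.setArr, run, g2, g3 r (by omega), h2, he, hf, g4, h4, hs.arr]
    · exact (g3 y (by omega)).trans (h3 y hy)
  | seq c d ihc ihd =>
    intro r hr s σ hs hB
    simp only [WF, Bool.and_eq_true] at hc
    obtain ⟨s₁, t₁, h1, h2, h3, h4⟩ := ihc hc.1 r hr s σ hs hB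
    obtain ⟨s₂, t₂, g1, g2, g3, g4⟩ := ihd hc.2 r hr s₁ _ h2 (fun p hp => by
      rw [h2.reg p (by omega), run_reg (sets_eq_false_of_lt hc.1 hp), ← hs.reg p (by omega)]
      exact hB p hp)
    exact ⟨s₂, _, .seq h1 g1, g2, fun y hy hyr => (g3 y hy hyr).trans (h3 y hy hyr),
      by simp only [cost]; omega⟩
  | loop x p c ih =>
    intro r hr s σ hs hB
    simp only [WF, Bool.and_eq_true, decide_eq_true_eq] at hc
    obtain ⟨⟨⟨hbx, hx⟩, hp⟩, hc⟩ := hc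
    have hxr : x ≠ r := by omega
    have hxr1 : x ≠ r + 1 := by omega
    have hpr : p ≠ r := by omega
    -- the loop of the compiled program, with `cnt` rounds to go after the first `i` ones
    have key : ∀ (cnt i : ℕ) (τ : State), i + cnt = σ.reg p →
        Agree r₀ τ (iterate (fun i σ => c.run (σ.setReg x i)) i σ) → τ.reg r = i →
        τ.reg (r + 1) = cnt → (∀ y, r₀ ≤ y → y < r → τ.reg y = s.reg y) → ∃ s' t,
        Exec ω (.loop (r + 1) <|
          .seq (.const (r + 2) 0) <| .seq (.add x r (r + 2)) <| .seq (c.compile (r + 2)) <|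
          .seq (.const (r + 2) 1) <| .seq (.add r r (r + 2)) (.sub (r + 1) (r + 1) (r + 2)))
          τ s' t ∧ Agree r₀ s' ((loop x p c).run σ) ∧
        (∀ y, r₀ ≤ y → y < r → s'.reg y = s.reg y) ∧ t ≤ cnt * (c.cost B + 6) + 1 := by
      intro cnt
      induction cnt with
      | zero =>
        intro i τ hi h1 h2 h3 h4
        refine ⟨τ, 1, .loop_false h3, ?_, h4, by simp⟩
        rw [run, ← hi]
        exact h1
      | succ cnt ihc =>
        intro i τ hi h1 h2 h3 h4
        obtain ⟨ρ, t, hex, hag, hlow, ht⟩ := ih hc (r + 2) (by omega)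
          ((τ.setReg (r + 2) 0).setReg x i) _
          ((h1.setReg_left (x := r + 2) (by omega) 0).setReg x i) (fun q hq => by
            have h1' : q ≠ x := by omega
            have h2' : q ≠ r + 2 := by omega
            have h3' := h1.reg q (by omega)
            have h5' : (iterate (fun i σ => c.run (σ.setReg x i)) i σ).reg q = σ.reg q := by
              refine iterate_induction (fun _ (ξ : State) => ξ.reg q = σ.reg q) rfl
                fun j _ ξ hξ => ?_
              rw [run_reg (sets_eq_false_of_lt hc hq), ← hξ]
              simp [State.setReg, h1']
            simp only [State.setReg, ne_eq, h1', not_false_eq_true, Function.update_of_ne, h2']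
            rw [h3', h5', ← hs.reg q (by omega)]
            exact hB q hq)
        have e1 : ρ.reg r = i := by
          rw [hlow r hr (by omega)]
          simp [State.setReg, hxr.symm, h2]
        have e2 : ρ.reg (r + 1) = cnt + 1 := by
          rw [hlow (r + 1) (by omega) (by omega)]
          simp [State.setReg, hxr1.symm, h3]
        obtain ⟨s', t', hex', g1, g2, g3⟩ := ihc (i + 1)
          (((ρ.setReg (r + 2) 1).setReg r (i + 1)).setReg (r + 1) cnt) (by omega)
          (((hag.setReg_left (by omega) _).setReg_left (by omega) _).setReg_left (by omega) _)
          (by simp [State.setReg]) (by simp [State.setReg]) (fun y hy hyr => by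
            have h1' : y ≠ x := by omega
            have h2' : y ≠ r + 2 := by omega
            have h3' : y ≠ r := by omega
            have h4' : y ≠ r + 1 := by omega
            simp only [State.setReg, ne_eq, h2', h3', h4', not_false_eq_true, Function.update_of_ne]
            rw [hlow y hy (by omega), ← h4 y hy hyr]
            simp [State.setReg, h1', h2'])
        refine ⟨s', 1 + (1 + (t + (1 + (1 + 1)))) + t' + 1, .loop_true (by omega) (.seq (.const ..)
          (.seq (.add ..) (.seq ?_ (.seq (.const _ _ ρ) (.seq (.add ..) (.sub ..)))))) ?_,
            g1, g2, ?_⟩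
        · convert hex using 2
          simp [State.setReg, h2]
        · convert hex' using 2
          all_goals simp [State.setReg, e1, e2]
        · rw [Nat.succ_mul]
          omega
    obtain ⟨s', t, hex, g1, g2, g3⟩ := key (σ.reg p) 0
      ((s.setReg r 0).setReg (r + 1) (σ.reg p)) (by omega)
      ((hs.setReg_left (by omega) _).setReg_left (by omega) _) (by simp [State.setReg])
      (by simp [State.setReg]) (fun y hy hyr => by
        have h3' : y ≠ r := by omega
        have h4' : y ≠ r + 1 := by omega
        simp [State.setReg, h3', h4'])
    refine ⟨s', 1 + (1 + t), .seq (.const ..) (.seq (.add ..) ?_), g1, g2, ?_⟩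
    · convert hex using 2
      simp [State.setReg, hpr, hs.reg p (by omega)]
    · have : σ.reg p * (c.cost B + 6) ≤ B * (c.cost B + 6) :=
        Nat.mul_le_mul_right _ ((hs.reg p (by omega)) ▸ hB p hp)
      simp only [cost]
      omega

/-- The running time of a compiled command is polynomial in the parameters. -/
theorem exists_cost_le (c : Cmd) : ∃ C, ∀ B, c.cost B ≤ C * (B + 1) ^ C := by
  have one : ∀ (C B : ℕ), 1 ≤ (B + 1) ^ C := fun C B => Nat.one_le_pow _ _ (by omega)
  have key2 : ∀ (C D B : ℕ), C * (B + 1) ^ C + D * (B + 1) ^ D + 2 ≤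
      (C + D + 2) * (B + 1) ^ (C + D + 2) := by
    intro C D B
    have h1 := Nat.mul_le_mul_left C
      (Nat.pow_le_pow_right (Nat.succ_pos B) (show C ≤ C + D + 2 by omega))
    have h2 := Nat.mul_le_mul_left D
      (Nat.pow_le_pow_right (Nat.succ_pos B) (show D ≤ C + D + 2 by omega))
    have h3 := one (C + D + 2) B
    simp only [Nat.succ_eq_add_one] at h1 h2
    nlinarith
  induction c with
  | assign x e =>
    obtain ⟨C, hC⟩ := e.exists_cost_le
    exact ⟨_, fun B => le_trans (by simp only [cost]; have := hC B; omega) (key2 C 0 B)⟩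
  | store a e f =>
    obtain ⟨C, hC⟩ := e.exists_cost_le
    obtain ⟨D, hD⟩ := f.exists_cost_le
    exact ⟨_, fun B => le_trans
      (by simp only [cost]; have := hC B; have := hD B; omega) (key2 C D B)⟩
  | seq c d ihc ihd =>
    obtain ⟨C, hC⟩ := ihc
    obtain ⟨D, hD⟩ := ihd
    exact ⟨_, fun B => le_trans
      (by simp only [cost]; have := hC B; have := hD B; omega) (key2 C D B)⟩
  | loop x p c ih =>
    obtain ⟨C, hC⟩ := ih
    refine ⟨C + 9, fun B => ?_⟩
    have h1 := hC B
    have h2 := Nat.mul_le_mul_left C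
      (Nat.pow_le_pow_right (Nat.succ_pos B) (show C ≤ C + 8 by omega))
    have h3 := one (C + 8) B
    simp only [cost, Nat.succ_eq_add_one] at *
    rw [show C + 9 = (C + 8) + 1 by omega, pow_succ]
    calc B * (c.cost B + 6) + 3 ≤ (B + 1) * (c.cost B + 9) := by nlinarith
      _ ≤ (B + 1) * ((C + 9) * (B + 1) ^ (C + 8)) := Nat.mul_le_mul_left _ (by nlinarith)
      _ = _ := by ring

end Cmd

/-! ### The combinatorics of the branching -/

open Finset Function

open scoped Classical in
/-- The number of `i < N` with the property `A`. -/
noncomputable def cnt (N : ℕ) (A : ℕ → Prop) : ℕ := ((range N).filter A).card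

open scoped Classical in
/-- The `c`-th number below `N` with the property `A`, counted from `0`, and `0` if there is
none. -/
noncomputable def nthBelow (N : ℕ) (A : ℕ → Prop) (c : ℕ) : ℕ :=
  ∑ i ∈ range N, if A i ∧ cnt N (fun l => l < i ∧ A l) = c then i else 0

theorem cnt_congr {N : ℕ} {A B : ℕ → Prop} (h : ∀ i < N, (A i ↔ B i)) : cnt N A = cnt N B := by
  classical
  unfold cnt
  congr 1
  ext i
  simp only [mem_filter, mem_range, and_congr_right_iff]
  exact h i

theorem cnt_mono {N : ℕ} {A B : ℕ → Prop} (h : ∀ i < N, A i → B i) : cnt N A ≤ cnt N B := by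
  classical
  refine card_le_card fun i hi => ?_
  simp only [mem_filter, mem_range] at hi ⊢
  exact ⟨hi.1, h i hi.1 hi.2⟩

theorem cnt_le (N : ℕ) (A : ℕ → Prop) : cnt N A ≤ N := by
  classical
  exact (card_filter_le _ _).trans (card_range N).le

theorem cnt_eq_card (N : ℕ) (A : ℕ → Prop) [DecidablePred A] :
    cnt N A = ((range N).filter A).card := by
  unfold cnt
  congr

theorem cnt_eq_zero {N : ℕ} {A : ℕ → Prop} : cnt N A = 0 ↔ ∀ i < N, ¬ A i := by
  classical
  rw [cnt_eq_card, card_eq_zero, filter_eq_empty_iff]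
  simp only [mem_range]

/-- Every element with the property is found by `nthBelow`. -/
theorem exists_nthBelow_eq {N : ℕ} {A : ℕ → Prop} {x : ℕ} (hx : x < N) (hA : A x) :
    ∃ c < cnt N A, nthBelow N A c = x := by
  classical
  refine ⟨cnt N (fun l => l < x ∧ A l), ?_, ?_⟩
  · refine card_lt_card ((ssubset_iff_of_subset fun i hi => ?_).2 ⟨x, ?_, ?_⟩)
    · simp only [mem_filter, mem_range] at hi ⊢
      exact ⟨hi.1, hi.2.2⟩
    · simp [hx, hA]
    · simp
  · unfold nthBelow
    rw [sum_eq_single_of_mem x (by simpa using hx)]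
    · simp [hA]
    · intro y hy hyx
      rw [if_neg]
      rintro ⟨hAy, h⟩
      rcases lt_or_gt_of_ne hyx with hlt | hlt
      · refine (card_lt_card ((ssubset_iff_of_subset fun i hi => ?_).2 ⟨y, ?_, ?_⟩)).ne h
        · simp only [mem_filter, mem_range] at hi ⊢
          exact ⟨hi.1, by omega, hi.2.2⟩
        · simp only [mem_filter]
          exact ⟨hy, hlt, hAy⟩
        · simp
      · refine (card_lt_card ((ssubset_iff_of_subset fun i hi => ?_).2 ⟨x, ?_, ?_⟩)).ne h.symm
        · simp only [mem_filter, mem_range] at hi ⊢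
          exact ⟨hi.1, by omega, hi.2.2⟩
        · simp only [mem_filter, mem_range]
          exact ⟨hx, hlt, hA⟩
        · simp

/-- If some number below `N` has the property, then so has `nthBelow N A 0`. -/
theorem nthBelow_zero_spec {N : ℕ} {A : ℕ → Prop} (h : ∃ x < N, A x) :
    nthBelow N A 0 < N ∧ A (nthBelow N A 0) := by
  classical
  have h0 : nthBelow N A 0 = Nat.find h := by
    obtain ⟨hx, hA⟩ := Nat.find_spec h
    unfold nthBelow
    have hz : cnt N (fun l => l < Nat.find h ∧ A l) = 0 :=
      cnt_eq_zero.2 fun l hl ⟨h1, h2⟩ => Nat.find_min h h1 ⟨hl, h2⟩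
    rw [sum_eq_single_of_mem (Nat.find h) (by simpa using hx)]
    · rw [if_pos ⟨hA, hz⟩]
    · intro y hy hyx
      rw [if_neg]
      rintro ⟨hAy, h'⟩
      have hlt : Nat.find h < y := lt_of_le_of_ne
        (Nat.find_min' h ⟨by simpa using hy, hAy⟩) hyx.symm
      exact cnt_eq_zero.1 h' _ hx ⟨hlt, hA⟩
  rw [h0]
  exact Nat.find_spec h

/-- An instance on natural numbers: `pos j v` (`neg j v`) says that the clause `j < m` contains the
positive (negative) literal of the variable `v < n`; `k` is the weight, `d` the biclique bound, and
`q` an integer with `1 / q ≤ ε`. -/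
structure Inst where
  n : ℕ
  m : ℕ
  k : ℕ
  d : ℕ
  q : ℕ
  pos : ℕ → ℕ → Prop
  neg : ℕ → ℕ → Prop

namespace Inst

variable (I : Inst)

/-- A variable of residual degree `r` shares more than `r / κ` clauses with a slot of the optimum
in every branch in which it is not a good choice itself. -/
def κ : ℕ := 2 * I.k * I.k * I.q

/-- The branching factor for clauses; larger degrees are treated as large. -/
def G : ℕ := 4 * I.d * I.κ

/-- The branching factor for variables. -/
def Bc : ℕ := I.G ^ I.d

/-- A variable is heavy if its negative literal occurs in more than a `1 / Q` fraction of the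
clauses that can be violated through their negative literals. -/
def Q : ℕ := 4 * I.k * I.q

/-- The number of negative literals of a clause. -/
noncomputable def negCard (j : ℕ) : ℕ := cnt I.n (I.neg j)

/-- The number of clauses with at least one and at most `k` negative literals. A clause with more
negative literals is satisfied by every assignment of weight `k`. -/
noncomputable def mixed : ℕ := cnt I.m fun j => (∃ v < I.n, I.neg j v) ∧ I.negCard j < I.k + 1

/-- The number of clauses counted by `mixed` that contain the negative literal of `v`. -/
noncomputable def negDeg (v : ℕ) : ℕ := cnt I.m fun j => I.neg j v ∧ I.negCard j < I.k + 1

/-- The heavy variables. If there are so few variables that there might be less than `k` light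
ones, all variables count as heavy. -/
def Heavy (v : ℕ) : Prop := I.n < I.k + 2 * I.κ ∨ I.mixed < I.Q * I.negDeg v

/-- The number of clauses satisfied by an assignment. -/
noncomputable def numSat (S : ℕ → Prop) : ℕ :=
  cnt I.m fun j => ∃ v < I.n, (I.pos j v ∧ S v) ∨ (I.neg j v ∧ ¬ S v)

/-- No `d` variables and `d` clauses form a biclique of positive literals. -/
def Free : Prop := ∀ X Y : Finset ℕ, (∀ v ∈ X, v < I.n) → (∀ j ∈ Y, j < I.m) →
  X.card = I.d → Y.card = I.d → ¬ ∀ v ∈ X, ∀ j ∈ Y, I.pos j v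

variable {I} in
/-- The number of heavy variables is bounded, by double counting the negative literals. -/
theorem cnt_heavy_le_of_not (hn : ¬ I.n < I.k + 2 * I.κ) : cnt I.n I.Heavy ≤ 2 * I.κ := by
  classical
  have hsum : ∑ v ∈ range I.n, I.negDeg v ≤ I.k * I.mixed := by
    have h1 : ∑ v ∈ range I.n, I.negDeg v =
        ∑ j ∈ range I.m, if I.negCard j < I.k + 1 then I.negCard j else 0 := by
      simp only [negDeg, cnt, card_filter]
      rw [sum_comm]
      refine sum_congr rfl fun j _ => ?_
      by_cases h : I.negCard j < I.k + 1
      · rw [if_pos h]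
        simp only [h, and_true]
        rw [negCard, cnt, card_filter]
      · simp [h]
    rw [h1, mixed, cnt, card_filter, mul_sum]
    refine sum_le_sum fun j _ => ?_
    by_cases h : I.negCard j < I.k + 1
    · by_cases h' : ∃ v < I.n, I.neg j v
      · simp [h, h']
        omega
      · have h0 : I.negCard j = 0 :=
          cnt_eq_zero.2 fun v hv hv' => h' ⟨v, hv, hv'⟩
        simp [h0]
    · simp [h]
  have hheavy : cnt I.n I.Heavy * (I.mixed + 1) ≤ I.Q * ∑ v ∈ range I.n, I.negDeg v := by
    rw [mul_sum, cnt, card_eq_sum_ones, sum_mul, sum_filter]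
    refine sum_le_sum fun v _ => ?_
    split_ifs with hv
    · rcases hv with hv | hv <;> omega
    · exact Nat.zero_le _
  have h3 : cnt I.n I.Heavy * (I.mixed + 1) ≤ I.Q * I.k * (I.mixed + 1) := by
    nlinarith [Nat.mul_le_mul_left I.Q hsum]
  have h4 := Nat.le_of_mul_le_mul_right h3 (by omega)
  have h5 : I.Q * I.k = 2 * I.κ := by simp only [Q, κ]; ring
  omega

theorem cnt_heavy_le : cnt I.n I.Heavy ≤ I.k + 2 * I.κ := by
  by_cases hn : I.n < I.k + 2 * I.κ
  · exact (cnt_le _ _).trans hn.le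
  · exact (cnt_heavy_le_of_not hn).trans (by omega)

/-- The Kővári–Sós–Turán argument: if `Y` is a large set of clauses, then only few variables
occur positively in more than a `1 / κ` fraction of it. -/
theorem card_sharing_le (hI : I.Free) (hd : 1 ≤ I.d) (hκ : 1 ≤ I.κ) (X Y : Finset ℕ)
    (hX : ∀ v ∈ X, v < I.n) (hY : ∀ j ∈ Y, j < I.m) (hr : I.G ≤ Y.card)
    (hs : ∀ v ∈ X, Y.card < I.κ * cnt I.m fun j => j ∈ Y ∧ I.pos j v) : X.card ≤ I.Bc := by
  classical
  set r := Y.card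
  have hN : ∀ v, (cnt I.m fun j => j ∈ Y ∧ I.pos j v) = (Y.filter fun j => I.pos j v).card := by
    intro v
    unfold cnt
    congr 1
    ext j
    simp only [mem_filter, mem_range]
    exact ⟨fun h => h.2, fun h => ⟨hY j h.1, h⟩⟩
  simp only [hN] at hs
  -- double counting of the pairs of a variable and a `d`-subset of its clauses in `Y`
  have hdc : ∑ v ∈ X, ((Y.filter fun j => I.pos j v).card).choose I.d =
      ∑ Z ∈ Y.powersetCard I.d, (X.filter fun v => ∀ j ∈ Z, I.pos j v).card := by
    simp only [card_filter]
    rw [sum_comm]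
    refine sum_congr rfl fun v _ => ?_
    rw [← card_filter, ← card_filter, ← card_powersetCard]
    congr 1
    ext Z
    simp only [mem_filter, mem_powersetCard, subset_iff]
    constructor
    · exact fun h => ⟨⟨fun j hj => (h.1 hj).1, h.2⟩, fun j hj => (h.1 hj).2⟩
    · exact fun h => ⟨fun j hj => ⟨h.1.1 hj, h.2 j hj⟩, h.1.2⟩
  have hup : ∑ Z ∈ Y.powersetCard I.d, (X.filter fun v => ∀ j ∈ Z, I.pos j v).card ≤
      r.choose I.d * I.d := by
    rw [← card_powersetCard, ← smul_eq_mul]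
    refine sum_le_card_nsmul _ _ _ fun Z hZ => ?_
    by_contra! hlt
    obtain ⟨X', hX', hcard⟩ := exists_subset_card_eq hlt.le
    rw [mem_powersetCard] at hZ
    refine hI X' Z (fun v hv => hX v (mem_filter.1 (hX' hv)).1) (fun j hj => hY j (hZ.1 hj)) hcard
      hZ.2 fun v hv j hj => (mem_filter.1 (hX' hv)).2 j hj
  -- every variable of `X` contributes at least a `1 / (2 κ) ^ d` fraction of all `d`-subsets
  have hlow : ∀ v ∈ X, r ^ I.d ≤
      (2 * I.κ) ^ I.d * (I.d.factorial * ((Y.filter fun j => I.pos j v).card).choose I.d) := by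
    intro v hv
    have h1 := hs v hv
    set s := (Y.filter fun j => I.pos j v).card
    have h2 : 4 * I.d < s := by
      by_contra! h
      have := Nat.mul_le_mul_left I.κ h
      have h3 : I.κ * (4 * I.d) = I.G := by simp only [G]; ring
      omega
    rw [← Nat.descFactorial_eq_factorial_mul_choose]
    calc r ^ I.d ≤ (2 * I.κ * (s + 1 - I.d)) ^ I.d := by
          refine Nat.pow_le_pow_left (h1.le.trans ?_) _
          rw [mul_right_comm, mul_comm _ I.κ]
          exact Nat.mul_le_mul_left _ (by omega)
      _ = (2 * I.κ) ^ I.d * (s + 1 - I.d) ^ I.d := mul_pow ..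
      _ ≤ _ := Nat.mul_le_mul_left _ (Nat.pow_sub_le_descFactorial _ _)
  have hr0 : 0 < r := lt_of_lt_of_le (by unfold G; positivity) hr
  have hmain : X.card * r ^ I.d ≤ ((2 * I.κ) ^ I.d * I.d) * r ^ I.d := by
    calc X.card * r ^ I.d = ∑ v ∈ X, r ^ I.d := by rw [sum_const, smul_eq_mul]
      _ ≤ ∑ v ∈ X, (2 * I.κ) ^ I.d *
            (I.d.factorial * ((Y.filter fun j => I.pos j v).card).choose I.d) := sum_le_sum hlow
      _ = (2 * I.κ) ^ I.d * (I.d.factorial *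
            ∑ v ∈ X, ((Y.filter fun j => I.pos j v).card).choose I.d) := by
          rw [mul_sum, mul_sum]
      _ ≤ (2 * I.κ) ^ I.d * (I.d.factorial * (r.choose I.d * I.d)) :=
          Nat.mul_le_mul_left _ (Nat.mul_le_mul_left _ (hdc ▸ hup))
      _ = (2 * I.κ) ^ I.d * (r.descFactorial I.d * I.d) := by
          rw [Nat.descFactorial_eq_factorial_mul_choose, mul_assoc]
      _ ≤ (2 * I.κ) ^ I.d * (r ^ I.d * I.d) := Nat.mul_le_mul_left _
          (Nat.mul_le_mul_right _ (Nat.descFactorial_le_pow _ _))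
      _ = _ := by ring
  refine (Nat.le_of_mul_le_mul_right hmain (by positivity)).trans ?_
  calc (2 * I.κ) ^ I.d * I.d ≤ (2 * I.κ) ^ I.d * I.d ^ I.d :=
        Nat.mul_le_mul_left _ (Nat.le_self_pow (by omega) _)
    _ = (2 * I.κ * I.d) ^ I.d := (mul_pow ..).symm
    _ ≤ I.Bc := Nat.pow_le_pow_left (by unfold G; nlinarith) _

end Inst

namespace Inst
variable (I : Inst)

/-! ### One step of the branching -/

/-- The clauses that count as satisfied in the state `V`, in which `V i` is the set of candidates
for the `i`-th chosen variable: those with a negative literal outside the chosen heavy variables,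
and those that contain every candidate of some slot positively. -/
def Cov (V : ℕ → ℕ → Prop) (j : ℕ) : Prop :=
  (∃ v < I.n, I.neg j v ∧ ¬ (I.Heavy v ∧ ∃ i < I.k, V i v)) ∨
    ∃ i < I.k, ∀ v < I.n, V i v → I.pos j v

/-- The residual degree of a variable. -/
noncomputable def deg (V : ℕ → ℕ → Prop) (v : ℕ) : ℕ :=
  cnt I.m fun j => ¬ I.Cov V j ∧ I.pos j v

/-- The number of residual clauses that contain both variables positively. -/
noncomputable def share (V : ℕ → ℕ → Prop) (y v : ℕ) : ℕ :=
  cnt I.m fun j => ¬ I.Cov V j ∧ I.pos j y ∧ I.pos j v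

/-- The first candidate of the slot `i` of maximal residual degree. -/
noncomputable def best (V : ℕ → ℕ → Prop) (i : ℕ) : ℕ :=
  nthBelow I.n (fun v => V i v ∧ ∀ u < I.n, V i u → ¬ I.deg V v < I.deg V u) 0

/-- The `w`-th residual clause of `y`. -/
noncomputable def clauseOf (V : ℕ → ℕ → Prop) (y w : ℕ) : ℕ :=
  nthBelow I.m (fun j => ¬ I.Cov V j ∧ I.pos j y) w

/-- The variable to which a slot is set: `y` itself, or the `c`-th candidate, or (if `op` is not
`3`) the `c`-th one among the candidates that share many clauses with `y`. -/
noncomputable def choice (V : ℕ → ℕ → Prop) (op t y c : ℕ) : ℕ :=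
  if op = 0 then y else
    nthBelow I.n (fun v => V t v ∧ (op = 3 ∨ I.deg V y < I.κ * I.share V y v)) c

/-- One step of the branching. With `y` the best candidate of the slot `i`, the slot `t` is
restricted to the variables of a residual clause of `y` (for `op = 1`), or set to a single
variable. -/
noncomputable def stepV (V : ℕ → ℕ → Prop) (i op t w c : ℕ) : ℕ → ℕ → Prop := fun i' v =>
  if i' = t then v < I.n ∧
    (if op = 1 then V t v ∧ I.pos (I.clauseOf V (I.best V i) w) v
      else v = I.choice V op t (I.best V i) c)
  else V i' v

/-- One step of the branching, with its decisions read off the advice `z`; the rest of the advice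
is passed on. -/
noncomputable def step (p : (ℕ → ℕ → Prop) × ℕ) : (ℕ → ℕ → Prop) × ℕ :=
  let i := p.2 % I.k
  let z₁ := p.2 / I.k
  let op := z₁ % 4
  let z₂ := z₁ / 4
  let t := z₂ % I.k
  let z₃ := z₂ / I.k
  let w := z₃ % I.G
  let z₄ := z₃ / I.G
  let c := z₄ % I.Bc
  (I.stepV p.1 i op t w c, if op = 1 then z₄ else z₄ / I.Bc)

/-- The number of decisions that are taken in every step, not counting the choice of a variable. -/
def Rs : ℕ := I.k * (4 * (I.k * I.G))

/-- All decisions of a step can be prescribed by the advice. -/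
theorem step_encode (V : ℕ → ℕ → Prop) {i op t w z X : ℕ} (hi : i < I.k) (hop : op < 4)
    (ht : t < I.k) (hw : w < I.G) (hz : z < X) :
    ∃ z' < I.Rs * X, I.step (V, z') =
      (I.stepV V i op t w (z % I.Bc), if op = 1 then z else z / I.Bc) := by
  have key : ∀ {a b c Y : ℕ}, a < b → c < Y →
      a + b * c < b * Y ∧ (a + b * c) % b = a ∧ (a + b * c) / b = c := by
    intro a b c Y ha hc
    refine ⟨?_, ?_, ?_⟩
    · calc a + b * c < b * (c + 1) := by rw [mul_add]; omega
        _ ≤ b * Y := Nat.mul_le_mul_left _ hc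
    · rw [Nat.add_mul_mod_self_left, Nat.mod_eq_of_lt ha]
    · rw [Nat.add_mul_div_left _ _ (by omega), Nat.div_eq_of_lt ha, zero_add]
  obtain ⟨h1, h1', h1''⟩ := key hw hz
  obtain ⟨h2, h2', h2''⟩ := key ht h1
  obtain ⟨h3, h3', h3''⟩ := key hop h2
  obtain ⟨h4, h4', h4''⟩ := key hi h3
  refine ⟨i + I.k * (op + 4 * (t + I.k * (w + I.G * z))),
    by unfold Rs; convert h4 using 1; ring, ?_⟩
  simp only [step, h1', h1'', h2', h2'', h3', h3'', h4', h4'']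

/-! ### Progress towards an optimal solution -/

/-- The clauses that count as satisfied if the variable `O i` is chosen for every slot `i`. -/
def CovBy (O : ℕ → ℕ) (j : ℕ) : Prop :=
  (∃ v < I.n, I.neg j v ∧ ¬ (I.Heavy v ∧ ∃ i < I.k, O i = v)) ∨ ∃ i < I.k, I.pos j (O i)

/-- The number of clauses that count as satisfied if `O i` is chosen for every slot `i`. -/
noncomputable def gain (O : ℕ → ℕ) : ℕ := cnt I.m (I.CovBy O)

/-- The solution `O` is compatible with the state `V`, and every slot is in one of three stages: it
is set to a single variable; or it has few candidates; or all of its candidates are light and are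
contained in a common set `L` of clauses, with `ρ i - 1` clauses missing to `d` of them. -/
structure Inv (V : ℕ → ℕ → Prop) (O ρ : ℕ → ℕ) : Prop where
  lt : ∀ i < I.k, ∀ v, V i v → v < I.n
  mem : ∀ i < I.k, V i (O i)
  stage : ∀ i < I.k, (ρ i = 0 ∧ ∀ v, V i v → v = O i) ∨
    (1 ≤ ρ i ∧ cnt I.n (V i) ≤ I.Bc) ∨
    (2 ≤ ρ i ∧ (∀ v, V i v → ¬ I.Heavy v) ∧ ∃ L : Finset ℕ, L.card + ρ i = I.d + 1 ∧
      (∀ j ∈ L, j < I.m) ∧ ∀ j ∈ L, ∀ v, V i v → I.pos j v)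

variable {I}

/-- Setting the slot `t` to one of its candidates `x` keeps the invariant for the solution in which
`x` takes the place of `O t`. -/
theorem Inv.fix {V V' : ℕ → ℕ → Prop} {O ρ : ℕ → ℕ} (h : I.Inv V O ρ) {t x : ℕ} (ht : t < I.k)
    (hx : V t x) (hV : ∀ i v, V' i v ↔ if i = t then v < I.n ∧ v = x else V i v) :
    I.Inv V' (update O t x) (update ρ t 0) := by
  have hxn := h.lt t ht x hx
  refine ⟨fun i hi v hv => ?_, fun i hi => ?_, fun i hi => ?_⟩
  · rw [hV] at hv
    split_ifs at hv with hit
    · exact hv.1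
    · exact h.lt i hi v hv
  · rw [hV]
    split_ifs with hit
    · simp [hit, hxn]
    · simpa [hit] using h.mem i hi
  · by_cases hit : i = t
    · subst hit
      left
      simp [hV]
    · have hVi : V' i = V i := by ext v; simp [hV, hit]
      simpa [hit, hVi] using h.stage i hi

theorem two_le_G (hd : 1 ≤ I.d) (hκ : 1 ≤ I.κ) : 2 ≤ I.G := by
  unfold G; nlinarith

theorem d_le_Bc (hd : 1 ≤ I.d) (hκ : 1 ≤ I.κ) : I.d ≤ I.Bc :=
  (Nat.lt_pow_self (two_le_G hd hκ)).le

/-- Restricting a slot with many candidates to the variables of a residual clause of its variable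
`O t` enlarges the set of common clauses; once there are `d` of these, fewer than `d` candidates are
left. -/
theorem Inv.restrict (hI : I.Free) (hd : 1 ≤ I.d) (hκ : 1 ≤ I.κ) {V V' : ℕ → ℕ → Prop}
    {O ρ : ℕ → ℕ} (h : I.Inv V O ρ) {t j : ℕ} (ht : t < I.k) (h0 : ρ t ≠ 0)
    (hs : ¬ cnt I.n (V t) ≤ I.Bc) (hj : j < I.m) (hcov : ¬ I.Cov V j) (hpos : I.pos j (O t))
    (hV : ∀ i v, V' i v ↔ if i = t then v < I.n ∧ V t v ∧ I.pos j v else V i v) :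
    I.Inv V' O (update ρ t (ρ t - 1)) := by
  refine ⟨fun i hi v hv => ?_, fun i hi => ?_, fun i hi => ?_⟩
  · rw [hV] at hv
    split_ifs at hv with hit
    · exact hv.1
    · exact h.lt i hi v hv
  · rw [hV]
    split_ifs with hit
    · subst hit
      exact ⟨h.lt i hi _ (h.mem i hi), h.mem i hi, hpos⟩
    · exact h.mem i hi
  · by_cases hit : i = t
    · subst hit
      rcases h.stage i hi with h1 | h1 | ⟨h1, h2, L, h3, h4, h5⟩
      · exact absurd h1.1 h0
      · exact absurd h1.2 hs
      have hjL : j ∉ L := fun hjL => hcov (Or.inr ⟨i, hi, fun v _ hv => h5 j hjL v hv⟩)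
      have hV' : ∀ v, V' i v → V i v ∧ I.pos j v := fun v hv => by
        have := (hV i v).1 hv
        rw [if_pos rfl] at this
        exact this.2
      have hL : ∀ j' ∈ insert j L, ∀ v, V' i v → I.pos j' v := by
        intro j' hj' v hv
        rcases mem_insert.1 hj' with rfl | hj'
        · exact (hV' v hv).2
        · exact h5 j' hj' v (hV' v hv).1
      have hLm : ∀ j' ∈ insert j L, j' < I.m := by
        intro j' hj'
        rcases mem_insert.1 hj' with rfl | hj'
        · exact hj
        · exact h4 j' hj'
      have hcard : (insert j L).card = L.card + 1 := card_insert_of_notMem hjL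
      right
      rw [update_self]
      by_cases h2' : ρ i = 2
      · -- all candidates are contained in `d` common clauses, so there are less than `d` of them
        left
        refine ⟨by omega, ?_⟩
        by_contra! hlt
        classical
        rw [cnt_eq_card] at hlt
        obtain ⟨X, hX, hXc⟩ := exists_subset_card_eq ((d_le_Bc hd hκ).trans hlt.le)
        refine hI X (insert j L) (fun v hv => by simpa using (mem_filter.1 (hX hv)).1) hLm hXc
          (by omega) fun v hv j' hj' => hL j' hj' v (mem_filter.1 (hX hv)).2
      · right
        exact ⟨by omega, fun v hv => h2 v (hV' v hv).1, insert j L, by omega, hLm, hL⟩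
    · have hVi : V' i = V i := by ext v; simp [hV, hit]
      simpa [hit, hVi] using h.stage i hi

/-- Exchanging the part `Rx` of the covered set `A` for a part `Ry` that is at least as large. -/
theorem card_exchange {A A' U Rx Ry : Finset ℕ} (hU : U ⊆ A) (hU' : U ⊆ A') (hRy : Ry ⊆ A')
    (hA : A \ Rx ⊆ A') (hd : Disjoint U Ry) (hle : Rx.card ≤ Ry.card) :
    A.card ≤ A'.card + ((A \ U) ∩ Ry).card ∧ U.card + Ry.card ≤ A'.card := by
  have h0 : U.card + Ry.card ≤ A'.card := by
    rw [← card_union_of_disjoint hd]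
    exact card_le_card (union_subset hU' hRy)
  refine ⟨?_, h0⟩
  have h1 : A.card = (A \ U).card + U.card := (card_sdiff_add_card_eq_card hU).symm
  have h2 : U.card + (Ry ∪ ((A \ U) \ Rx)).card ≤ A'.card := by
    rw [← card_union_of_disjoint]
    · refine card_le_card (union_subset hU' (union_subset hRy fun j hj => hA ?_))
      simp only [mem_sdiff] at hj ⊢
      exact ⟨hj.1.1, hj.2⟩
    · refine disjoint_union_right.2 ⟨hd, ?_⟩
      refine disjoint_left.2 fun j hj hj' => ?_
      simp only [mem_sdiff] at hj'
      exact hj'.1.2 hj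
  have h3 := card_union_add_card_inter Ry ((A \ U) \ Rx)
  have h4 : (Ry ∩ ((A \ U) \ Rx)).card ≤ ((A \ U) ∩ Ry).card := by
    refine card_le_card fun j hj => ?_
    simp only [mem_inter, mem_sdiff] at hj ⊢
    exact ⟨hj.2.1, hj.1⟩
  have h5 : (A \ U).card ≤ ((A \ U) \ Rx).card + Rx.card := by
    have := le_card_sdiff Rx (A \ U)
    omega
  omega

/-- If no slot has few candidates, then the best candidate `y` of an open slot `i` can replace
the variable of the solution in this slot at a small loss, or `y` shares many residual clauses with
the variable of the solution in some open slot. -/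
theorem Inv.progress (hk : 1 ≤ I.k) {V : ℕ → ℕ → Prop} {O ρ : ℕ → ℕ}
    (h : I.Inv V O ρ) (hs : ∀ i < I.k, ρ i ≠ 0 → ¬ cnt I.n (V i) ≤ I.Bc) {i : ℕ} (hi : i < I.k)
    (h0 : ρ i ≠ 0) :
    (V i (I.best V i) ∧ ¬ I.Heavy (O i) ∧ ¬ I.Heavy (I.best V i) ∧
      2 * I.k * I.q * I.gain O ≤ 2 * I.k * I.q * I.gain (update O i (I.best V i)) + I.gain O) ∨
    ∃ t < I.k, ρ t ≠ 0 ∧ I.deg V (I.best V i) < I.κ * I.share V (I.best V i) (O t) := by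
  classical
  -- the best candidate
  obtain ⟨hyn, hyV, hymax⟩ := nthBelow_zero_spec (N := I.n)
    (A := fun v => V i v ∧ ∀ u < I.n, V i u → ¬ I.deg V v < I.deg V u) (by
      obtain ⟨v, hv, hmax⟩ := exists_max_image ((range I.n).filter (V i)) (I.deg V)
        ⟨O i, by simpa using ⟨h.lt i hi _ (h.mem i hi), h.mem i hi⟩⟩
      simp only [mem_filter, mem_range] at hv hmax
      exact ⟨v, hv.1, hv.2, fun u hu huV => (hmax u ⟨hu, huV⟩).not_gt⟩)
  change I.best V i < I.n at hyn
  change V i (I.best V i) at hyV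
  change ∀ u < I.n, V i u → ¬ I.deg V (I.best V i) < I.deg V u at hymax
  set y := I.best V i
  have hlight : ∀ i < I.k, ρ i ≠ 0 → ∀ v, V i v → ¬ I.Heavy v := by
    intro i hi h0
    rcases h.stage i hi with h1 | h1 | h1
    · exact absurd h1.1 h0
    · exact absurd h1.2 (hs i hi h0)
    · exact h1.2.1
  have hT : ∀ v, I.Heavy v → ((∃ i < I.k, V i v) ↔ ∃ i < I.k, O i = v) := by
    intro v hv
    constructor
    · rintro ⟨l, hl, hlv⟩
      refine ⟨l, hl, ?_⟩
      rcases h.stage l hl with h1 | h1 | h1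
      · exact (h1.2 v hlv).symm
      · exact absurd hv (hlight l hl (by omega) v hlv)
      · exact absurd hv (hlight l hl (by omega) v hlv)
    · rintro ⟨l, hl, rfl⟩
      exact ⟨l, hl, h.mem l hl⟩
  have hT' : ∀ v, I.Heavy v → ((∃ l < I.k, O l = v) ↔ ∃ l < I.k, update O i y l = v) := by
    intro v hv
    refine exists_congr fun l => and_congr_right fun hl => ?_
    by_cases hli : l = i
    · subst hli
      rw [update_self]
      constructor
      · rintro rfl
        exact absurd hv (hlight l hl h0 _ (h.mem l hl))
      · rintro rfl
        exact absurd hv (hlight l hl h0 _ hyV)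
    · rw [update_of_ne hli]
  have hcov : ∀ j, I.Cov V j → I.CovBy O j := by
    rintro j (⟨v, hv, h1, h2⟩ | ⟨l, hl, h1⟩)
    · exact Or.inl ⟨v, hv, h1, fun h3 => h2 ⟨h3.1, (hT v h3.1).2 h3.2⟩⟩
    · exact Or.inr ⟨l, hl, h1 _ (h.lt l hl _ (h.mem l hl)) (h.mem l hl)⟩
  have hcov' : ∀ j, I.Cov V j → I.CovBy (update O i y) j := by
    rintro j (⟨v, hv, h1, h2⟩ | ⟨l, hl, h1⟩)
    · exact Or.inl ⟨v, hv, h1, fun h3 => h2 ⟨h3.1, (hT v h3.1).2 ((hT' v h3.1).2 h3.2)⟩⟩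
    · refine Or.inr ⟨l, hl, ?_⟩
      by_cases hli : l = i
      · subst hli
        rw [update_self]
        exact h1 _ hyn hyV
      · rw [update_of_ne hli]
        exact h1 _ (h.lt l hl _ (h.mem l hl)) (h.mem l hl)
  set A := (range I.m).filter (I.CovBy O) with hA
  set A' := (range I.m).filter (I.CovBy (update O i y)) with hA'
  set U := (range I.m).filter (I.Cov V) with hU
  set R : ℕ → Finset ℕ := fun v => (range I.m).filter fun j => ¬ I.Cov V j ∧ I.pos j v with hR
  have hdeg : ∀ v, I.deg V v = (R v).card := fun v => cnt_eq_card _ _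
  obtain ⟨hx1, hx2⟩ := card_exchange (A := A) (A' := A') (U := U) (Rx := R (O i)) (Ry := R y)
    (fun j hj => by
      simp only [hU, hA, mem_filter] at hj ⊢
      exact ⟨hj.1, hcov j hj.2⟩)
    (fun j hj => by
      simp only [hU, hA', mem_filter] at hj ⊢
      exact ⟨hj.1, hcov' j hj.2⟩)
    (fun j hj => by
      simp only [hR, hA', mem_filter] at hj ⊢
      exact ⟨hj.1, Or.inr ⟨i, hi, by rw [update_self]; exact hj.2.2⟩⟩)
    (fun j hj => by
      simp only [hR, hA, hA', mem_filter, mem_sdiff] at hj ⊢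
      refine ⟨hj.1.1, ?_⟩
      by_cases hc : I.Cov V j
      · exact hcov' j hc
      rcases hj.1.2 with ⟨v, hv, h1, h2⟩ | ⟨l, hl, h1⟩
      · exact Or.inl ⟨v, hv, h1, fun h3 => h2 ⟨h3.1, (hT' v h3.1).2 h3.2⟩⟩
      · refine Or.inr ⟨l, hl, ?_⟩
        by_cases hli : l = i
        · subst hli
          exact absurd ⟨hj.1.1, hc, h1⟩ hj.2
        · rwa [update_of_ne hli])
    (disjoint_left.2 fun j hj hj' => by
      simp only [hR, hU, mem_filter] at hj hj'
      exact hj'.2.1 hj.2)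
    (by
      rw [← hdeg, ← hdeg]
      exact not_lt.1 (hymax _ (h.lt i hi _ (h.mem i hi)) (h.mem i hi)))
  have hgA : I.gain O = A.card := cnt_eq_card _ _
  have hgA' : I.gain (update O i y) = A'.card := cnt_eq_card _ _
  have hAU : A.card = (A \ U).card + U.card := (card_sdiff_add_card_eq_card (fun j hj => by
      simp only [hU, hA, mem_filter] at hj ⊢
      exact ⟨hj.1, hcov j hj.2⟩)).symm
  have hlO := hlight i hi h0 _ (h.mem i hi)
  have hly := hlight i hi h0 _ hyV
  set K := 2 * I.k * I.q with hK
  by_cases hc1 : K * ((A \ U) ∩ R y).card ≤ (A \ U).card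
  · left
    refine ⟨hyV, hlO, hly, ?_⟩
    rw [hgA, hgA']
    have := Nat.mul_le_mul_left K hx1
    rw [Nat.mul_add] at this
    omega
  by_cases hc2 : (A \ U).card ≤ (R y).card
  · left
    refine ⟨hyV, hlO, hly, ?_⟩
    rw [hgA, hgA']
    have : A.card ≤ A'.card := by omega
    have := Nat.mul_le_mul_left K this
    omega
  -- the slots of the solution that are still open cover a large part of the clauses of `y`
  right
  have hsub : (A \ U) ∩ R y ⊆ ((range I.k).filter fun l => ρ l ≠ 0).biUnion fun l =>
      (range I.m).filter fun j => ¬ I.Cov V j ∧ I.pos j y ∧ I.pos j (O l) := by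
    intro j hj
    simp only [hA, hU, hR, mem_inter, mem_sdiff, mem_filter, mem_biUnion, mem_range] at hj ⊢
    obtain ⟨⟨⟨hjm, hjA⟩, hjU⟩, -, hjc, hjy⟩ := hj
    rcases hjA with ⟨v, hv, h1, h2⟩ | ⟨l, hl, h1⟩
    · exact absurd (Or.inl ⟨v, hv, h1, fun h3 => h2 ⟨h3.1, (hT v h3.1).1 h3.2⟩⟩) hjc
    · refine ⟨l, ⟨hl, fun hl0 => hjc (Or.inr ⟨l, hl, fun v _ hv => ?_⟩)⟩, hjm, hjc, hjy, h1⟩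
      rcases h.stage l hl with h3 | h3 | h3
      · rw [h3.2 v hv]
        exact h1
      · omega
      · omega
  have hcard : ((A \ U) ∩ R y).card ≤ ∑ l ∈ (range I.k).filter (fun l => ρ l ≠ 0),
      I.share V y (O l) := by
    refine (card_le_card hsub).trans (card_biUnion_le.trans_eq (sum_congr rfl fun l _ => ?_))
    exact (cnt_eq_card _ _).symm
  by_contra! hcon
  have hle : K * I.k * ((A \ U) ∩ R y).card ≤ I.k * (R y).card := by
    have hκ : I.κ = K * I.k := by simp only [κ, hK]; ring
    calc K * I.k * ((A \ U) ∩ R y).card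
        ≤ ∑ l ∈ (range I.k).filter (fun l => ρ l ≠ 0), I.κ * I.share V y (O l) := by
          rw [← mul_sum, hκ]
          exact Nat.mul_le_mul_left _ hcard
      _ ≤ ((range I.k).filter fun l => ρ l ≠ 0).card • I.deg V y :=
          sum_le_card_nsmul _ _ _ fun l hl => by
            simp only [mem_filter, mem_range] at hl
            exact hcon l hl.1 hl.2
      _ ≤ I.k * (R y).card := by
          rw [smul_eq_mul, hdeg]
          refine Nat.mul_le_mul_right _ ((card_filter_le _ _).trans (card_range _).le)
  have : K * ((A \ U) ∩ R y).card ≤ (R y).card := by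
    refine Nat.le_of_mul_le_mul_left ?_ hk
    calc I.k * (K * ((A \ U) ∩ R y).card) = K * I.k * ((A \ U) ∩ R y).card := by ring
      _ ≤ _ := hle
  omega

/-- Some advice leads from a state that is compatible with a solution `O` to a state in which
every slot is set, at a loss of at most a `1 / (2 * k * q)` fraction of the gain for every slot that
was open. -/
theorem exists_advice (hI : I.Free) (hd : 1 ≤ I.d) (hk : 1 ≤ I.k) (hq : 1 ≤ I.q) (N : ℕ) :
    ∀ (V : ℕ → ℕ → Prop) (O ρ : ℕ → ℕ), I.Inv V O ρ → ∑ i ∈ range I.k, ρ i ≤ N →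
    ∃ z < I.Rs ^ (∑ i ∈ range I.k, ρ i) * I.Bc ^ (cnt I.k fun i => ρ i ≠ 0), ∃ O' : ℕ → ℕ,
      (∀ i < I.k, O' i < I.n ∧ ∀ v, ((I.step)^[N] (V, z)).1 i v ↔ v = O' i) ∧
      (∀ i < I.k, (I.Heavy (O i) → O' i = O i) ∧ (¬ I.Heavy (O i) → ¬ I.Heavy (O' i))) ∧
      2 * I.k * I.q * I.gain O ≤
        2 * I.k * I.q * I.gain O' + (cnt I.k fun i => ρ i ≠ 0) * I.gain O := by
  have hκ : 1 ≤ I.κ := by unfold κ; nlinarith [Nat.mul_pos hk hk, Nat.mul_pos (Nat.mul_pos hk hk) hq]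
  have hG := two_le_G hd hκ
  have hBc : 1 ≤ I.Bc := Nat.one_le_pow _ _ (by omega)
  -- a state in which all slots are set
  have hdone : ∀ (V : ℕ → ℕ → Prop) (O ρ : ℕ → ℕ), I.Inv V O ρ → (∀ i < I.k, ρ i = 0) →
      ∀ i < I.k, ∀ v, V i v ↔ v = O i := by
    intro V O ρ h h0 i hi v
    constructor
    · intro hv
      rcases h.stage i hi with h1 | h1 | h1
      · exact h1.2 v hv
      · have := h0 i hi; omega
      · have := h0 i hi; omega
    · rintro rfl
      exact h.mem i hi
  induction N with
  | zero =>
    intro V O ρ h hN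
    have h0 : ∀ i < I.k, ρ i = 0 := by simpa using hN
    have hRs : 1 ≤ I.Rs := Nat.mul_pos hk (Nat.mul_pos (by omega) (Nat.mul_pos hk (by omega)))
    refine ⟨0, by positivity, O, fun i hi => ⟨h.lt i hi _ (h.mem i hi), hdone V O ρ h h0 i hi⟩,
      fun i hi => ⟨fun _ => rfl, id⟩, Nat.le_add_right _ _⟩
  | succ N ih =>
    intro V O ρ h hN
    by_cases h0 : ∀ i < I.k, ρ i = 0
    · -- nothing is left to be done, and the advice `0` changes nothing
      have hfix := hdone V O ρ h h0
      have hsum : ∑ i ∈ range I.k, ρ i = 0 := by simpa using h0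
      have hcnt : (cnt I.k fun i => ρ i ≠ 0) = 0 := cnt_eq_zero.2 fun i hi => not_not.2 (h0 i hi)
      have hbest : I.best V 0 = O 0 := by
        have := nthBelow_zero_spec (N := I.n)
          (A := fun v => V 0 v ∧ ∀ u < I.n, V 0 u → ¬ I.deg V v < I.deg V u)
          ⟨O 0, h.lt 0 hk _ (h.mem 0 hk), h.mem 0 hk, fun u _ hu => by
            rw [(hfix 0 hk u).1 hu]
            exact lt_irrefl _⟩
        exact (hfix 0 hk _).1 this.2.1
      have hstep : I.step (V, 0) = (I.stepV V 0 0 0 0 0, 0) := by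
        simp only [step, Nat.zero_mod, Nat.zero_div, ite_self]
      have hinv : I.Inv (I.stepV V 0 0 0 0 0) O ρ := by
        have := h.fix (t := 0) (x := O 0) hk (h.mem 0 hk) (V' := I.stepV V 0 0 0 0 0) (fun i v => by
          simp only [stepV, choice, hbest, if_true]
          simp)
        rw [update_eq_self] at this
        convert this using 1
        rw [eq_comm, update_eq_self_iff, h0 0 hk]
      obtain ⟨z, hz, O', h1, h2, h3⟩ := ih _ O ρ hinv (by omega)
      rw [hsum, hcnt] at hz ⊢
      have hz0 : z = 0 := by simpa using hz
      subst hz0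
      refine ⟨0, by simp, O', ?_, h2, by rwa [hcnt] at h3⟩
      rw [iterate_succ_apply, hstep]
      exact h1
    push Not at h0
    obtain ⟨i, hi, hi0⟩ := h0
    -- a step that sets the slot `t` to the variable `x`
    have set_step : ∀ (i op t w x : ℕ) (c : ℕ), i < I.k → op < 4 → op ≠ 1 → t < I.k → ρ t ≠ 0 →
        c < I.Bc → V t x → I.choice V op t (I.best V i) c = x →
        (I.Heavy (O t) → x = O t) → (¬ I.Heavy (O t) → ¬ I.Heavy x) →
        2 * I.k * I.q * I.gain O ≤ 2 * I.k * I.q * I.gain (update O t x) + I.gain O →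
        ∃ z < I.Rs ^ (∑ i ∈ range I.k, ρ i) * I.Bc ^ (cnt I.k fun i => ρ i ≠ 0), ∃ O' : ℕ → ℕ,
          (∀ i < I.k, O' i < I.n ∧ ∀ v, ((I.step)^[N + 1] (V, z)).1 i v ↔ v = O' i) ∧
          (∀ i < I.k, (I.Heavy (O i) → O' i = O i) ∧ (¬ I.Heavy (O i) → ¬ I.Heavy (O' i))) ∧
          2 * I.k * I.q * I.gain O ≤
            2 * I.k * I.q * I.gain O' + (cnt I.k fun i => ρ i ≠ 0) * I.gain O := by
      intro i op t w x c hi hop hop1 ht ht0 hc hx hch hh1 hh2 hloss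
      have hinv := h.fix ht hx (V' := I.stepV V i op t 0 c) (fun i v => by
        simp only [stepV, hch, if_neg hop1])
      have hsum : ∑ i ∈ range I.k, update ρ t 0 i + ρ t = ∑ i ∈ range I.k, ρ i := by
        have := sum_sdiff (singleton_subset_iff.2 (mem_range.2 ht)) (f := ρ)
        rw [sum_singleton] at this
        rw [sum_update_of_mem (mem_range.2 ht)]
        omega
      have hcnt : (cnt I.k fun i => update ρ t 0 i ≠ 0) + 1 = cnt I.k fun i => ρ i ≠ 0 := by
        classical
        have hmem : t ∈ (range I.k).filter fun i => ρ i ≠ 0 := mem_filter.2 ⟨mem_range.2 ht, ht0⟩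
        rw [cnt_eq_card, cnt_eq_card, ← card_erase_add_one hmem]
        congr 2
        ext l
        by_cases hl : l = t <;> simp [hl]
      obtain ⟨z, hz, O', h1, h2, h3⟩ := ih _ _ _ hinv (by omega)
      set ℓ := cnt I.k fun i => update ρ t 0 i ≠ 0
      obtain ⟨z', hz', hstep⟩ :=
        I.step_encode V (X := I.Bc * (I.Rs ^ (∑ i ∈ range I.k, update ρ t 0 i) *
        I.Bc ^ ℓ)) hi hop ht (show 0 < I.G by omega)
        (show c + I.Bc * z < _ by
          calc c + I.Bc * z < I.Bc * (z + 1) := by rw [mul_add]; omega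
            _ ≤ _ := Nat.mul_le_mul_left _ hz)
      rw [Nat.add_mul_mod_self_left, Nat.mod_eq_of_lt hc, if_neg hop1,
        Nat.add_mul_div_left _ _ hBc, Nat.div_eq_of_lt hc, zero_add] at hstep
      refine ⟨z', hz'.trans_le ?_, O', ?_, fun l hl => ?_, ?_⟩
      · rw [← hsum, ← hcnt, pow_add, pow_succ]
        have : I.Rs ≤ I.Rs ^ ρ t := Nat.le_self_pow ht0 _
        calc I.Rs * (I.Bc * (I.Rs ^ (∑ i ∈ range I.k, update ρ t 0 i) * I.Bc ^ ℓ))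
            = I.Rs ^ (∑ i ∈ range I.k, update ρ t 0 i) * I.Rs * (I.Bc ^ ℓ * I.Bc) := by ring
          _ ≤ _ := Nat.mul_le_mul_right _ (Nat.mul_le_mul_left _ this)
      · rw [iterate_succ_apply, hstep]
        exact h1
      · have := h2 l hl
        by_cases hlt : l = t
        · subst hlt
          rw [update_self] at this
          constructor
          · intro hO
            rw [this.1 (by rwa [hh1 hO]), hh1 hO]
          · exact fun hO => this.2 (hh2 hO)
        · rwa [update_of_ne hlt] at this
      · have hℓ : ℓ ≤ I.k := cnt_le _ _
        have hk2 : I.k ≤ 2 * I.k * I.q := by nlinarith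
        set K := 2 * I.k * I.q
        rw [← hcnt]
        rcases le_total (I.gain (update O t x)) (I.gain O) with hle | hle
        · nlinarith [Nat.mul_le_mul_left ℓ hle]
        · obtain ⟨e, he⟩ := Nat.exists_eq_add_of_le (hℓ.trans hk2)
          rw [he] at h3 ⊢
          nlinarith [Nat.mul_le_mul_left e hle]
    have hself :
        2 * I.k * I.q * I.gain O ≤ 2 * I.k * I.q * I.gain (update O i (O i)) + I.gain O := by
      rw [update_eq_self]
      exact Nat.le_add_right _ _
    by_cases hs : ∀ i < I.k, ρ i ≠ 0 → ¬ cnt I.n (V i) ≤ I.Bc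
    swap
    · -- a slot with few candidates
      push Not at hs
      obtain ⟨t, ht, ht0, hsm⟩ := hs
      obtain ⟨c, hc, hcx⟩ := exists_nthBelow_eq (A := fun v => V t v ∧
        (3 = 3 ∨ I.deg V (I.best V t) < I.κ * I.share V (I.best V t) v))
        (h.lt t ht _ (h.mem t ht)) ⟨h.mem t ht, Or.inl rfl⟩
      exact set_step t 3 t 0 (O t) c ht (by omega) (by omega) ht ht0
        (hc.trans_le ((cnt_mono fun _ _ hv => hv.1).trans hsm)) (h.mem t ht)
        (by simpa [choice] using hcx) (fun _ => rfl) id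
        (by rw [update_eq_self]; exact Nat.le_add_right _ _)
    rcases h.progress hk hs hi hi0 with ⟨h1, h2, h3, h4⟩ | ⟨t, ht, ht0, hlt⟩
    · exact set_step i 0 i 0 _ 0 hi (by omega) (by omega) hi hi0 hBc h1 (by simp [choice])
        (fun hO => absurd hO h2) (fun _ => h3) h4
    set y := I.best V i
    by_cases hlarge : I.G ≤ I.deg V y
    · -- few candidates share many clauses with `y`
      obtain ⟨c, hc, hcx⟩ := exists_nthBelow_eq (A := fun v => V t v ∧
        (2 = 3 ∨ I.deg V y < I.κ * I.share V y v))
        (h.lt t ht _ (h.mem t ht)) ⟨h.mem t ht, Or.inr hlt⟩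
      refine set_step i 2 t 0 (O t) c hi (by omega) (by omega) ht ht0 (hc.trans_le ?_) (h.mem t ht)
        (by simpa [choice] using hcx) (fun _ => rfl) id
        (by rw [update_eq_self]; exact Nat.le_add_right _ _)
      classical
      rw [cnt_eq_card]
      have hdeg : I.deg V y = ((range I.m).filter fun j => ¬ I.Cov V j ∧ I.pos j y).card :=
        cnt_eq_card _ _
      refine I.card_sharing_le hI hd hκ _ ((range I.m).filter fun j => ¬ I.Cov V j ∧ I.pos j y)
        (fun v hv => by simpa using (mem_filter.1 hv).1)
        (fun j hj => by simpa using (mem_filter.1 hj).1) (hdeg ▸ hlarge) fun v hv => ?_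
      rw [← hdeg]
      refine ((mem_filter.1 hv).2.2.resolve_left (by omega)).trans_eq ?_
      congr 1
      refine cnt_congr fun j hj => ?_
      simp only [mem_filter, mem_range, hj, true_and, and_assoc]
    · -- the solution covers one of the few residual clauses of `y`
      have hpos : 0 < I.share V y (O t) := by
        by_contra! hz
        have h0 : I.share V y (O t) = 0 := by omega
        rw [h0] at hlt
        omega
      obtain ⟨j, hj, hjc, hjy, hjt⟩ : ∃ j < I.m, ¬ I.Cov V j ∧ I.pos j y ∧ I.pos j (O t) := by
        by_contra! hcon
        exact hpos.ne' (cnt_eq_zero.2 fun j hj h => hcon j hj h.1 h.2.1 h.2.2)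
      obtain ⟨w, hw, hwj⟩ :=
        exists_nthBelow_eq (A := fun j => ¬ I.Cov V j ∧ I.pos j y) hj ⟨hjc, hjy⟩
      have hwG : w < I.G := hw.trans (not_le.1 hlarge)
      have hρt : 2 ≤ ρ t := by
        rcases h.stage t ht with h1 | h1 | h1
        · exact absurd h1.1 ht0
        · exact absurd h1.2 (hs t ht ht0)
        · exact h1.1
      have hinv : I.Inv (I.stepV V i 1 t w 0) O (update ρ t (ρ t - 1)) :=
        h.restrict hI hd hκ ht ht0 (hs t ht ht0) hj hjc hjt (fun i v => by
          simp only [stepV, clauseOf, hwj, if_true, y])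
      have hsum : ∑ i ∈ range I.k, update ρ t (ρ t - 1) i + 1 = ∑ i ∈ range I.k, ρ i := by
        have := sum_sdiff (singleton_subset_iff.2 (mem_range.2 ht)) (f := ρ)
        rw [sum_singleton] at this
        rw [sum_update_of_mem (mem_range.2 ht)]
        omega
      have hcnt : (cnt I.k fun i => update ρ t (ρ t - 1) i ≠ 0) = cnt I.k fun i => ρ i ≠ 0 := by
        refine cnt_congr fun l _ => ?_
        by_cases hl : l = t
        · subst hl
          rw [update_self]
          omega
        · rw [update_of_ne hl]
      obtain ⟨z, hz, O', h1, h2, h3⟩ := ih _ _ _ hinv (by omega)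
      rw [hcnt] at hz h3
      obtain ⟨z', hz', hstep⟩ := I.step_encode V hi (show 1 < 4 by omega) ht hwG hz
      have hc : I.stepV V i 1 t w (z % I.Bc) = I.stepV V i 1 t w 0 := rfl
      rw [if_pos rfl, hc] at hstep
      refine ⟨z', hz'.trans_eq ?_, O', ?_, h2, h3⟩
      · rw [← hsum]
        ring
      · rw [iterate_succ_apply, hstep]
        exact h1

end Inst

theorem cnt_succ (N : ℕ) (A : ℕ → Prop) [Decidable (A N)] :
    cnt (N + 1) A = cnt N A + if A N then 1 else 0 := by
  classical
  rw [cnt_eq_card, cnt_eq_card, range_add_one, filter_insert]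
  split_ifs
  · rw [card_insert_of_notMem (by simp)]
  · rfl

theorem cnt_or {N : ℕ} {A B : ℕ → Prop} (h : ∀ i < N, A i → ¬ B i) :
    (cnt N fun i => A i ∨ B i) = cnt N A + cnt N B := by
  classical
  rw [cnt_eq_card, cnt_eq_card, cnt_eq_card, ← card_union_of_disjoint, ← filter_or]
  refine disjoint_left.2 fun v hv hv' => ?_
  simp only [mem_filter, mem_range] at hv hv'
  exact h v hv.1 hv.2 hv'.2

/-- The first `r` numbers below `N` with the property `A` are `r` many, unless there are fewer
numbers with this property. -/
theorem cnt_first {N : ℕ} {A : ℕ → Prop} {r : ℕ} (hr : r ≤ cnt N A) :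
    (cnt N fun v => A v ∧ cnt N (fun u => u < v ∧ A u) < r) = r := by
  classical
  have key : ∀ M, (cnt M fun v => A v ∧ cnt v A < r) = min r (cnt M A) := by
    intro M
    induction M with
    | zero => rw [cnt_eq_zero.2 (by simp), cnt_eq_zero.2 (by simp), min_eq_right (Nat.zero_le r)]
    | succ M ih =>
      rw [cnt_succ, cnt_succ, ih]
      by_cases hA : A M
      · by_cases h : cnt M A < r
        · simp only [hA, h, and_self, if_true]
          omega
        · simp only [hA, h, and_false, if_true, if_false]
          omega
      · simp [hA]
  have hcongr : (cnt N fun v => A v ∧ cnt N (fun u => u < v ∧ A u) < r) =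
      cnt N fun v => A v ∧ cnt v A < r := by
    refine cnt_congr fun v hv => ?_
    have : cnt N (fun u => u < v ∧ A u) = cnt v A := by
      rw [cnt_eq_card, cnt_eq_card]
      congr 1
      ext u
      simp only [mem_filter, mem_range]
      exact ⟨fun h => h.2, fun h => ⟨by omega, h⟩⟩
    rw [this]
  rw [hcongr, key, min_eq_left hr]

namespace Inst
variable (I : Inst)

/-! ### The quality of the solutions -/

/-- The variables chosen in a state in which all slots are set. -/
def Chosen (V : ℕ → ℕ → Prop) (v : ℕ) : Prop := ∃ i < I.k, V i v

/-- The assignment read off a state: the chosen variables, and the first light ones among the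
others until `k` variables have been taken. -/
def Final (V : ℕ → ℕ → Prop) (v : ℕ) : Prop :=
  I.Chosen V v ∨ ((¬ I.Chosen V v ∧ ¬ I.Heavy v) ∧
    cnt I.n (fun u => u < v ∧ ¬ I.Chosen V u ∧ ¬ I.Heavy u) < I.k - cnt I.n (I.Chosen V))

variable {I}

variable (I) in
open scoped Classical in
/-- The sum of `negDeg` over the light variables of an assignment, which bounds the number of
clauses that are violated because their negative literals are neglected. -/
noncomputable def lightLoss (S : ℕ → Prop) : ℕ :=
  ∑ v ∈ (range I.n).filter (fun v => S v ∧ ¬ I.Heavy v), I.negDeg v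

/-- The clauses with `A` that an assignment of weight `k` violates, if each of them contains a
negative literal of a light variable, are counted by the degrees `negDeg` of these variables. -/
theorem cnt_le_numSat_add {A S : ℕ → Prop} (hS : cnt I.n S = I.k)
    (hA : ∀ j < I.m, A j → (∀ v < I.n, I.pos j v → ¬ S v) → (∀ v < I.n, I.neg j v → S v) →
      ∃ v < I.n, I.neg j v ∧ S v ∧ ¬ I.Heavy v) :
    cnt I.m A ≤ I.numSat S + I.lightLoss S := by
  classical
  have hsub : (range I.m).filter A ⊆ ((range I.m).filter fun j => ∃ v < I.n,
      (I.pos j v ∧ S v) ∨ (I.neg j v ∧ ¬ S v)) ∪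
      ((range I.n).filter fun v => S v ∧ ¬ I.Heavy v).biUnion fun v =>
        (range I.m).filter fun j => I.neg j v ∧ I.negCard j < I.k + 1 := by
    intro j hj
    simp only [mem_union, mem_filter, mem_range, mem_biUnion] at hj ⊢
    by_cases hsat : ∃ v < I.n, (I.pos j v ∧ S v) ∨ (I.neg j v ∧ ¬ S v)
    · exact Or.inl ⟨hj.1, hsat⟩
    right
    have h1 : ∀ v < I.n, I.pos j v → ¬ S v := fun v hv hp hs => hsat ⟨v, hv, Or.inl ⟨hp, hs⟩⟩
    have h2 : ∀ v < I.n, I.neg j v → S v := fun v hv hp => by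
      by_contra hs
      exact hsat ⟨v, hv, Or.inr ⟨hp, hs⟩⟩
    obtain ⟨v, hv, hn, hs, hl⟩ := hA j hj.1 hj.2 h1 h2
    refine ⟨v, ⟨hv, hs, hl⟩, hj.1, hn, ?_⟩
    have : I.negCard j ≤ I.k := hS ▸ cnt_mono h2
    omega
  rw [cnt_eq_card]
  refine (card_le_card hsub).trans ((card_union_le _ _).trans ?_)
  refine Nat.add_le_add (cnt_eq_card _ _).ge (card_biUnion_le.trans ?_)
  unfold lightLoss
  convert sum_le_sum fun v _ => (cnt_eq_card I.m fun j => I.neg j v ∧ I.negCard j < I.k + 1).ge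
  rfl

theorem Q_mul_lightLoss_le {S : ℕ → Prop} (hS : cnt I.n S = I.k) :
    I.Q * I.lightLoss S ≤ I.k * I.mixed := by
  classical
  rw [lightLoss, mul_sum]
  refine (sum_le_card_nsmul _ _ I.mixed fun v hv => ?_).trans ?_
  · simp only [mem_filter, Heavy, not_or, not_lt] at hv
    exact hv.2.2.2
  · rw [smul_eq_mul, ← cnt_eq_card]
    exact Nat.mul_le_mul_right _ (hS ▸ cnt_mono fun v _ hv => hv.1)

theorem le_cnt_light (hn : ¬ I.n < I.k + 2 * I.κ) : I.k ≤ cnt I.n fun v => ¬ I.Heavy v := by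
  classical
  have h1 := cnt_heavy_le_of_not hn
  have h2 : cnt I.n (fun v => I.Heavy v ∨ ¬ I.Heavy v) =
      cnt I.n I.Heavy + cnt I.n fun v => ¬ I.Heavy v := cnt_or fun v _ hv => not_not.2 hv
  have h3 : cnt I.n (fun v => I.Heavy v ∨ ¬ I.Heavy v) = I.n := by
    rw [cnt_eq_card, filter_true_of_mem fun v _ => em _, card_range]
  omega

/-- An assignment that chooses only light variables satisfies half of the clauses counted by
`mixed`. -/
theorem exists_mixed_le (hk : 1 ≤ I.k) (hq : 1 ≤ I.q) (hn : ¬ I.n < I.k + 2 * I.κ) :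
    ∃ S, cnt I.n S = I.k ∧ I.mixed ≤ 2 * I.numSat S := by
  classical
  have hl := le_cnt_light hn
  rw [cnt_eq_card] at hl
  obtain ⟨X, hX, hXc⟩ := exists_subset_card_eq hl
  have hS : cnt I.n (fun v => v ∈ X) = I.k := by
    rw [cnt_eq_card, ← hXc]
    congr 1
    ext v
    simp only [mem_filter, mem_range, and_iff_right_iff_imp]
    exact fun hv => by simpa using (mem_filter.1 (hX hv)).1
  refine ⟨fun v => v ∈ X, hS, ?_⟩
  have h1 := cnt_le_numSat_add hS
    (A := fun j => (∃ v < I.n, I.neg j v) ∧ I.negCard j < I.k + 1) (by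
      rintro j _ ⟨⟨v, hv, hjv⟩, _⟩ _ h
      exact ⟨v, hv, hjv, h v hv hjv, (mem_filter.1 (hX (h v hv hjv))).2⟩)
  have h2 := Q_mul_lightLoss_le hS
  change I.mixed ≤ _ at h1
  have h3 : 4 * I.q * I.lightLoss (fun v => v ∈ X) ≤ I.mixed := by
    refine Nat.le_of_mul_le_mul_left ?_ hk
    calc I.k * (4 * I.q * I.lightLoss (fun v => v ∈ X)) = I.Q * I.lightLoss (fun v => v ∈ X) := by
          unfold Q; ring
      _ ≤ _ := h2
  have h4 : 4 * I.lightLoss (fun v => v ∈ X) ≤ 4 * I.q * I.lightLoss (fun v => v ∈ X) :=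
    Nat.mul_le_mul_right _ (by omega)
  omega

/-- The variables of an assignment of weight `k`, the heavy ones first. -/
theorem exists_enumeration {B : ℕ → Prop} (hB : cnt I.n B = I.k) :
    ∃ t₀ ≤ I.k, ∃ O : ℕ → ℕ, (∀ i < I.k, O i < I.n ∧ B (O i) ∧ (I.Heavy (O i) ↔ i < t₀)) ∧
      ∀ v < I.n, B v → ∃ i < I.k, O i = v := by
  classical
  set l₁ := ((range I.n).filter fun v => B v ∧ I.Heavy v).toList with hl₁
  set l₂ := ((range I.n).filter fun v => B v ∧ ¬ I.Heavy v).toList with hl₂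
  have hlen : (l₁ ++ l₂).length = I.k := by
    rw [List.length_append, hl₁, hl₂, length_toList, length_toList, ← hB, cnt_eq_card,
      ← card_filter_add_card_filter_not (s := (range I.n).filter B) I.Heavy, filter_filter,
      filter_filter]
  have h1 : ∀ v, v ∈ l₁ ↔ v < I.n ∧ B v ∧ I.Heavy v := by simp [hl₁]
  have h2 : ∀ v, v ∈ l₂ ↔ v < I.n ∧ B v ∧ ¬ I.Heavy v := by simp [hl₂]
  refine ⟨l₁.length, by rw [← hlen]; simp, fun i => (l₁ ++ l₂).getD i 0, fun i hi => ?_,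
    fun v hv hBv => ?_⟩
  · beta_reduce
    rw [List.getD_eq_getElem _ _ (by omega)]
    by_cases hlt : i < l₁.length
    · rw [List.getElem_append_left hlt]
      obtain ⟨g1, g2, g3⟩ := (h1 _).1 (List.getElem_mem hlt)
      exact ⟨g1, g2, by simp [g3, hlt]⟩
    · rw [List.getElem_append_right (by omega)]
      obtain ⟨g1, g2, g3⟩ := (h2 _).1 (List.getElem_mem (l := l₂) (n := i - l₁.length)
        (by rw [List.length_append] at hlen; omega))
      exact ⟨g1, g2, by simp [g3, hlt]⟩
  · have : v ∈ l₁ ++ l₂ := by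
      rw [List.mem_append, h1, h2]
      tauto
    obtain ⟨i, hi, rfl⟩ := List.getElem_of_mem this
    exact ⟨i, by omega, List.getD_eq_getElem _ _ hi⟩

/-- Some advice yields an assignment that is within a factor of `1 - 1 / q` of a given optimal
one. -/
theorem exists_good_advice (hI : I.Free) (hd : 1 ≤ I.d) (hk : 1 ≤ I.k) (hq : 1 ≤ I.q)
    {B : ℕ → Prop} (hB : cnt I.n B = I.k)
    (hopt : ∀ S, cnt I.n S = I.k → I.numSat S ≤ I.numSat B) :
    ∃ t₀ ≤ I.k, ∀ V₀ : ℕ → ℕ → Prop,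
      (∀ i < I.k, ∀ v, V₀ i v ↔ v < I.n ∧ (I.Heavy v ↔ i < t₀)) →
      ∃ z < I.Rs ^ (I.k * (I.d + 1)) * I.Bc ^ I.k,
        cnt I.n (I.Final ((I.step)^[I.k * (I.d + 1)] (V₀, z)).1) = I.k ∧
        I.q * I.numSat B ≤
          I.q * I.numSat (I.Final ((I.step)^[I.k * (I.d + 1)] (V₀, z)).1) + I.numSat B := by
  classical
  obtain ⟨t₀, ht₀, O, hO, hBO⟩ := exists_enumeration (I := I) hB
  refine ⟨t₀, ht₀, fun V₀ hV₀ => ?_⟩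
  have hκ : 1 ≤ I.κ := by unfold κ; nlinarith [Nat.mul_pos hk hk, Nat.mul_pos (Nat.mul_pos hk hk) hq]
  have hG := two_le_G hd hκ
  have hGB : I.G ≤ I.Bc := Nat.le_self_pow (by omega) _
  have hHB : cnt I.n I.Heavy ≤ I.Bc := by
    refine I.cnt_heavy_le.trans (le_trans ?_ hGB)
    have : I.k ≤ I.κ := by unfold κ; nlinarith [Nat.mul_pos hk hk, Nat.mul_pos hk hq]
    unfold G
    nlinarith
  set ρ : ℕ → ℕ := fun i => if i < t₀ then 1 else I.d + 1 with hρ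
  have hinv : I.Inv V₀ O ρ := by
    refine ⟨fun i hi v hv => ((hV₀ i hi v).1 hv).1, fun i hi => ?_, fun i hi => ?_⟩
    · exact (hV₀ i hi _).2 ⟨(hO i hi).1, (hO i hi).2.2⟩
    · right
      by_cases hlt : i < t₀
      · left
        exact ⟨by simp [hρ, hlt], le_trans (cnt_mono fun v _ hv => (((hV₀ i hi v).1 hv).2.2 hlt)) hHB⟩
      · right
        refine ⟨by simp [hρ, hlt, hd], fun v hv hh => hlt (((hV₀ i hi v).1 hv).2.1 hh), ∅, ?_⟩
        simp [hρ, hlt]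
  have hsum : ∑ i ∈ range I.k, ρ i ≤ I.k * (I.d + 1) := by
    refine (sum_le_card_nsmul _ _ (I.d + 1) fun i _ => ?_).trans (by simp)
    simp only [hρ]
    split_ifs <;> omega
  obtain ⟨z, hz, O', h1, h2, h3⟩ := exists_advice hI hd hk hq _ V₀ O ρ hinv hsum
  set V := ((I.step)^[I.k * (I.d + 1)] (V₀, z)).1
  have hℓ : (cnt I.k fun i => ρ i ≠ 0) ≤ I.k := cnt_le _ _
  have hRs : 1 ≤ I.Rs := Nat.mul_pos hk (Nat.mul_pos (by omega) (Nat.mul_pos hk (by omega)))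
  refine ⟨z, hz.trans_le (Nat.mul_le_mul (Nat.pow_le_pow_right hRs hsum)
    (Nat.pow_le_pow_right (by omega) hℓ)), ?_⟩
  have hch : ∀ v, I.Chosen V v ↔ ∃ i < I.k, O' i = v := fun v =>
    exists_congr fun i => and_congr_right fun hi => by rw [(h1 i hi).2 v, eq_comm]
  -- the weight of the assignment
  have hchk : cnt I.n (I.Chosen V) ≤ I.k := by
    have : (range I.n).filter (I.Chosen V) ⊆ (range I.k).image O' := by
      intro v hv
      obtain ⟨i, hi, rfl⟩ := (hch v).1 (mem_filter.1 hv).2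
      exact mem_image_of_mem _ (mem_range.2 hi)
    rw [cnt_eq_card]
    exact (card_le_card this).trans (card_image_le.trans (card_range _).le)
  have hsplit : cnt I.n (I.Final V) = cnt I.n (I.Chosen V) +
      cnt I.n fun v => (¬ I.Chosen V v ∧ ¬ I.Heavy v) ∧
        cnt I.n (fun u => u < v ∧ ¬ I.Chosen V u ∧ ¬ I.Heavy u) < I.k - cnt I.n (I.Chosen V) := by
    exact cnt_or fun v _ hv hv' => hv'.1.1 hv
  have hw : cnt I.n (I.Final V) = I.k := by
    rw [hsplit]
    by_cases hn : I.n < I.k + 2 * I.κ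
    · -- every variable is heavy, and the solution has been guessed exactly
      have hall : ∀ v, I.Heavy v := fun v => Or.inl hn
      have e1 : cnt I.n (I.Chosen V) = I.k := by
        rw [← hB]
        refine cnt_congr fun v hv => ?_
        rw [hch]
        constructor
        · rintro ⟨i, hi, rfl⟩
          rw [(h2 i hi).1 (hall _)]
          exact (hO i hi).2.1
        · intro hBv
          obtain ⟨i, hi, rfl⟩ := hBO v hv hBv
          exact ⟨i, hi, (h2 i hi).1 (hall _)⟩
      rw [e1, Nat.add_eq_left]
      exact cnt_eq_zero.2 fun v _ hv => hv.1.2 (hall v)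
    · rw [cnt_first, Nat.add_sub_cancel' hchk]
      have hl := le_cnt_light hn
      have : (range I.n).filter (fun v => ¬ I.Heavy v) ⊆ (range I.n).filter (I.Chosen V) ∪
          (range I.n).filter fun v => ¬ I.Chosen V v ∧ ¬ I.Heavy v := by
        intro v hv
        simp only [mem_union, mem_filter] at hv ⊢
        tauto
      have := (card_le_card this).trans (card_union_le _ _)
      rw [← cnt_eq_card, ← cnt_eq_card, ← cnt_eq_card] at this
      omega
  refine ⟨hw, ?_⟩
  -- the gain of the optimal assignment
  have hgO : I.numSat B ≤ I.gain O := by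
    refine cnt_mono fun j _ => ?_
    rintro ⟨v, hv, ⟨hp, hBv⟩ | ⟨hp, hBv⟩⟩
    · obtain ⟨i, hi, rfl⟩ := hBO v hv hBv
      exact Or.inr ⟨i, hi, hp⟩
    · refine Or.inl ⟨v, hv, hp, ?_⟩
      rintro ⟨_, i, hi, rfl⟩
      exact hBv (hO i hi).2.1
  -- the clauses whose negative literals have been neglected
  have hgO' := cnt_le_numSat_add (A := I.CovBy O') hw (by
    rintro j _ (⟨v, hv, g1, g2⟩ | ⟨i, hi, g1⟩) hpos hneg
    · refine ⟨v, hv, g1, hneg v hv g1, fun hh => ?_⟩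
      rcases hneg v hv g1 with h | h
      · exact g2 ⟨hh, (hch v).1 h⟩
      · exact h.1.2 hh
    · exact absurd (Or.inl ((hch _).2 ⟨i, hi, rfl⟩)) (hpos _ (h1 i hi).1 g1))
  change I.gain O' ≤ _ at hgO'
  have hloss : 2 * I.q * I.gain O' ≤ 2 * I.q * I.numSat (I.Final V) + I.numSat B := by
    by_cases hn : I.n < I.k + 2 * I.κ
    · have h0 : I.lightLoss (I.Final V) = 0 :=
        sum_eq_zero fun v hv => absurd (Or.inl hn) (mem_filter.1 hv).2.2
      rw [h0, add_zero] at hgO'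
      have := Nat.mul_le_mul_left (2 * I.q) hgO'
      omega
    · obtain ⟨S, hS, hmix⟩ := exists_mixed_le hk hq hn
      have hmix' := hmix.trans (Nat.mul_le_mul_left 2 (hopt S hS))
      have hQ := Q_mul_lightLoss_le hw
      have h4 : 4 * I.q * I.lightLoss (I.Final V) ≤ 2 * I.numSat B := by
        refine le_trans (Nat.le_of_mul_le_mul_left ?_ hk) hmix'
        calc I.k * (4 * I.q * I.lightLoss (I.Final V)) = I.Q * I.lightLoss (I.Final V) := by
              unfold Q; ring
          _ ≤ _ := hQ
      have := Nat.mul_le_mul_left (2 * I.q) hgO'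
      linarith
  have hadv : 2 * I.q * I.gain O ≤ 2 * I.q * I.gain O' + I.gain O := by
    refine Nat.le_of_mul_le_mul_left ?_ hk
    have := Nat.mul_le_mul_right (I.gain O) hℓ
    linarith
  obtain ⟨p, hp⟩ := Nat.exists_eq_add_of_le hq
  have h5 : (2 * p + 1) * I.numSat B ≤ (2 * p + 1) * I.gain O := Nat.mul_le_mul_left _ hgO
  rw [hp] at hadv hloss ⊢
  linarith

end Inst

/-! ### Logic and counting by terms -/

namespace Tm

/-- A term holds in a state if its value is nonzero. -/
def Holds (e : Tm) (s : State) : Prop := e.val s ≠ 0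

def lt (e f : Tm) : Tm := sub f e
def not (e : Tm) : Tm := ite e (const 0) (const 1)
def and (e f : Tm) : Tm := ite e f (const 0)
def or (e f : Tm) : Tm := ite e (const 1) f
def eq (e f : Tm) : Tm := not (add (sub e f) (sub f e))
def ex (x p : ℕ) (e : Tm) : Tm := sum x p e
def all (x p : ℕ) (e : Tm) : Tm := not (ex x p (not e))
def count (x p : ℕ) (e : Tm) : Tm := sum x p (ite e (const 1) (const 0))

/-- The product of a parameter and a term. The register `99` is bound by such products and used
nowhere else. -/
def mul (p : ℕ) (e : Tm) : Tm := sum 99 p e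

/-- The term for `nthBelow`; `A x` expresses the property of the content of the register `x`. -/
def nth (x y p : ℕ) (A : ℕ → Tm) (c : Tm) : Tm :=
  sum x p (ite (and (A x) (eq (count y p (and (lt (reg y) (reg x)) (A y))) c)) (reg x) (const 0))

variable {e f c : Tm} {s : State}

@[simp] theorem val_reg (x : ℕ) (s : State) : (reg x).val s = s.reg x := rfl
@[simp] theorem val_const (c : ℕ) (s : State) : (const c).val s = c := rfl
@[simp] theorem val_add : (add e f).val s = e.val s + f.val s := rfl
@[simp] theorem val_sub : (sub e f).val s = e.val s - f.val s := rfl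

theorem val_ite [Decidable (c.Holds s)] :
    (ite c e f).val s = if c.Holds s then e.val s else f.val s := by
  rw [val]
  unfold Holds
  congr

theorem holds_ite [Decidable (c.Holds s)] :
    (ite c e f).Holds s ↔ if c.Holds s then e.Holds s else f.Holds s := by
  rw [Holds, val_ite]
  split_ifs <;> rfl

@[simp] theorem holds_lt : (lt e f).Holds s ↔ e.val s < f.val s := by
  simp [Holds, lt, Nat.sub_ne_zero_iff_lt]

@[simp] theorem holds_not : (not e).Holds s ↔ ¬ e.Holds s := by
  classical
  rw [not, holds_ite]
  split_ifs with h <;> simp [h] <;> simp [Holds]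

@[simp] theorem holds_and : (and e f).Holds s ↔ e.Holds s ∧ f.Holds s := by
  classical
  rw [and, holds_ite]
  split_ifs with h <;> simp [h]
  simp [Holds]

@[simp] theorem holds_or : (or e f).Holds s ↔ e.Holds s ∨ f.Holds s := by
  classical
  rw [or, holds_ite]
  split_ifs with h <;> simp [h]
  simp [Holds]

@[simp] theorem holds_eq : (eq e f).Holds s ↔ e.val s = f.val s := by
  rw [eq, holds_not, Holds, val_add, val_sub, val_sub]
  omega

@[simp] theorem holds_ex {x p : ℕ} :
    (ex x p e).Holds s ↔ ∃ i < s.reg p, e.Holds (s.setReg x i) := by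
  simp [Holds, ex, val]

@[simp] theorem holds_all {x p : ℕ} :
    (all x p e).Holds s ↔ ∀ i < s.reg p, e.Holds (s.setReg x i) := by
  simp [all]

@[simp] theorem val_count {x p : ℕ} :
    (count x p e).val s = cnt (s.reg p) fun i => e.Holds (s.setReg x i) := by
  classical
  rw [count, val, cnt_eq_card, card_filter]
  refine sum_congr rfl fun i _ => ?_
  rw [val_ite]
  rfl

theorem val_mul {p v : ℕ} (h : ∀ i, e.val (s.setReg 99 i) = v) : (mul p e).val s = s.reg p * v := by
  simp [mul, val, h]

theorem val_nth {x y p n v : ℕ} {A : ℕ → Tm} {P : ℕ → Prop} (hn : s.reg p = n) (hyx : y ≠ x)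
    (hpx : p ≠ x) (h1 : ∀ i < n, (A x).Holds (s.setReg x i) ↔ P i)
    (h2 : ∀ i < n, ∀ l < n, (A y).Holds ((s.setReg x i).setReg y l) ↔ P l)
    (h3 : ∀ i, c.val (s.setReg x i) = v) : (nth x y p A c).val s = nthBelow n P v := by
  classical
  rw [nth, val, nthBelow, hn]
  refine sum_congr rfl fun i hi => ?_
  rw [mem_range] at hi
  have hcnt : cnt n (fun l => l < i ∧ (A y).Holds ((s.setReg x i).setReg y l)) =
      cnt n fun l => l < i ∧ P l :=
    cnt_congr fun l hl => and_congr_right fun _ => h2 i hi l hl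
  rw [val_ite, holds_and, holds_eq, h1 i hi, h3, val_count]
  simp only [holds_and, holds_lt, val_reg]
  have e1 : (s.setReg x i).reg p = n := by simp [State.setReg, hpx, hn]
  have e2 : ∀ l, ((s.setReg x i).setReg y l).reg y = l := by simp [State.setReg]
  have e3 : ∀ l, ((s.setReg x i).setReg y l).reg x = i := by simp [State.setReg, hyx.symm]
  have e4 : (s.setReg x i).reg x = i := by simp [State.setReg]
  rw [e1, e4]
  simp only [e2, e3, hcnt, val_const]

end Tm

theorem setReg_reg (s : State) (x v y : ℕ) :
    (s.setReg x v).reg y = if y = x then v else s.reg y := by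
  simp [State.setReg, update_apply]

@[simp] theorem setReg_arr (s : State) (x v : ℕ) : (s.setReg x v).arr = s.arr := rfl

/-- A loop that stores values in the cells `J i` of one array, where the value for a cell may depend
on the former content of this cell. -/
theorem Cmd.run_loop_store {x p a N : ℕ} {e f : Tm} {s : State} (J F : ℕ → ℕ) (hN : s.reg p = N)
    (hJ : ∀ i < N, ∀ l < N, J i = J l → i = l)
    (h : ∀ i < N, ∀ σ : State, (∀ y ≠ x, σ.reg y = s.reg y) → σ.reg x = i →
      (∀ a' ≠ a, σ.arr a' = s.arr a') → σ.arr a (J i) = s.arr a (J i) →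
      e.val σ = J i ∧ f.val σ = F i) :
    (∀ i < N, ((Cmd.loop x p (.store a e f)).run s).arr a (J i) = F i) ∧
      ∀ c, (∀ i < N, c ≠ J i) → ((Cmd.loop x p (.store a e f)).run s).arr a c = s.arr a c := by
  have key := iterate_induction (n := s.reg p) (s := s)
    (f := fun i σ => (Cmd.store a e f).run (σ.setReg x i))
    (fun M σ => (∀ y ≠ x, σ.reg y = s.reg y) ∧ (∀ a' ≠ a, σ.arr a' = s.arr a') ∧
      (∀ i < M, σ.arr a (J i) = F i) ∧ ∀ c, (∀ i < M, c ≠ J i) → σ.arr a c = s.arr a c)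
    ⟨fun _ _ => rfl, fun _ _ => rfl, by simp, fun _ _ => rfl⟩ (by
      rintro M hM σ ⟨h1, h2, h3, h4⟩
      rw [hN] at hM
      obtain ⟨g1, g2⟩ := h M hM (σ.setReg x M)
        (fun y hy => by simp [setReg_reg, hy, h1 y hy]) (by simp [setReg_reg]) h2
        (h4 _ fun i hi hc => by have := hJ _ hM _ (by omega) hc; omega)
      have hrun : (Cmd.store a e f).run (σ.setReg x M) = (σ.setReg x M).setArr a (J M) (F M) := by
        rw [Cmd.run, g1, g2]
      rw [hrun]
      refine ⟨fun y hy => ?_, fun a' ha => ?_, fun i hi => ?_, fun c hc => ?_⟩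
      · simpa [State.setArr, State.setReg, hy] using h1 y hy
      · simpa [State.setArr, State.setReg, ha] using h2 a' ha
      · by_cases hiM : i = M
        · subst hiM
          simp [State.setArr, State.setReg]
        · have : J i ≠ J M := fun h => hiM (hJ _ (by omega) _ hM h)
          simpa [State.setArr, State.setReg, this] using h3 i (by omega)
      · have : c ≠ J M := hc M (by omega)
        simpa [State.setArr, State.setReg, this] using h4 c fun i hi => hc i (by omega))
  rw [hN] at key
  have hrun : (Cmd.loop x p (.store a e f)).run s =
      iterate (fun i σ => (Cmd.store a e f).run (σ.setReg x i)) N s := by rw [Cmd.run, hN]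
  rw [hrun]
  exact ⟨key.2.2.1, key.2.2.2⟩

/-! ### The program -/

/-! The registers `0, …, 12` are parameters: they hold `n`, `m`, `k`, `d`, `q`, `κ`, `G`, `Q`, `Bc`, the
number `k * (d + 1)` of steps, `4`, `k + 1`, and the number `Z` of advice strings. The registers
`20, …, 38` hold variables of the program, and those from `50` on are bound by terms. The arrays `0`
and `1` hold the input, `2` the output, `3` the candidates of the slots, `4` the heavy variables, and
`5` the assignment under evaluation. Terms with the names of the notions for `Inst` compute
these. -/

namespace Tm

/-- The value `1` if a term holds, and `0` otherwise. -/
def ind (e : Tm) : Tm := ite e (const 1) (const 0)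

/-- The cell of a matrix with rows of length `n`. -/
def cell (j v : ℕ) : Tm := add (mul 0 (reg j)) (reg v)
def pos (j v : ℕ) : Tm := arr 0 (cell j v)
def neg (j v : ℕ) : Tm := arr 1 (cell j v)
def slot (i v : ℕ) : Tm := arr 3 (cell i v)
def heavy (v : ℕ) : Tm := arr 4 (reg v)

def negCard (j : ℕ) : Tm := count 50 0 (neg j 50)
def mixed : Tm := count 52 1 (and (ex 50 0 (neg 52 50)) (lt (negCard 52) (add (reg 2) (const 1))))
def negDeg (v : ℕ) : Tm :=
  count 52 1 (and (neg 52 v) (lt (negCard 52) (add (reg 2) (const 1))))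
/-- Whether a variable is heavy; the register `37` holds the number `mixed`. -/
def isHeavy (v : ℕ) : Tm :=
  or (lt (reg 0) (add (reg 2) (add (reg 5) (reg 5)))) (lt (reg 37) (mul 7 (negDeg v)))

def cov (j : ℕ) : Tm :=
  or (ex 50 0 (and (neg j 50) (not (and (heavy 50) (ex 51 2 (slot 51 50))))))
    (ex 51 2 (all 50 0 (or (not (slot 51 50)) (pos j 50))))
def deg (v : ℕ) : Tm := count 52 1 (and (not (cov 52)) (pos 52 v))
def share (y v : ℕ) : Tm := count 52 1 (and (not (cov 52)) (and (pos 52 y) (pos 52 v)))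
def best (i : ℕ) : Tm :=
  nth 53 54 0 (fun v => and (slot i v)
    (all 55 0 (or (not (slot i 55)) (not (lt (deg v) (deg 55))))))
    (const 0)
def clauseOf (y w : ℕ) : Tm := nth 53 54 1 (fun j => and (not (cov j)) (pos j y)) (reg w)
def choice (op t y c : ℕ) : Tm :=
  ite (eq (reg op) (const 0)) (reg y) <|
    nth 53 54 0 (fun v => and (slot t v)
      (or (eq (reg op) (const 3)) (lt (deg y) (mul 5 (share y v))))) (reg c)

def chosen (v : ℕ) : Tm := ex 51 2 (slot 51 v)
def final (v : ℕ) : Tm :=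
  or (chosen v) (and (and (not (chosen v)) (not (heavy v)))
    (lt (count 53 0 (and (lt (reg 53) (reg v)) (and (not (chosen 53)) (not (heavy 53)))))
      (sub (reg 2) (count 53 0 (chosen 53)))))

/-- The number of clauses satisfied by the assignment in the array `5`. -/
def numSat : Tm :=
  count 52 1 (ex 50 0 (or (and (pos 52 50) (arr 5 (reg 50)))
    (and (neg 52 50) (not (arr 5 (reg 50))))))

end Tm

namespace Cmd

open Tm

/-- The quotient of the advice in the register `20` by a parameter. -/
def quot (p : ℕ) : Tm :=
  count 50 12 (lt (mul p (add (reg 50) (const 1))) (add (reg 20) (const 1)))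

/-- Move the last digit of the advice in base `p` to the register `x`. -/
def digit (x p : ℕ) : Cmd :=
  .seq (.assign 29 (quot p)) <| .seq (.assign x (sub (reg 20) (mul p (reg 29))))
    (.assign 20 (reg 29))

/-- One step of the branching. -/
def step : Cmd :=
  .seq (digit 21 2) <| .seq (digit 22 10) <| .seq (digit 23 2) <| .seq (digit 24 6) <|
  .seq (.assign 29 (quot 8)) <| .seq (.assign 25 (sub (reg 20) (mul 8 (reg 29)))) <|
  .seq (.assign 20 (ite (eq (reg 22) (const 1)) (reg 20) (reg 29))) <|
  .seq (.assign 26 (best 21)) <| .seq (.assign 27 (clauseOf 26 24)) <|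
  .seq (.assign 28 (choice 22 23 26 25)) <|
  .loop 30 0 (.store 3 (cell 23 30)
    (ind (ite (eq (reg 22) (const 1)) (and (slot 23 30) (pos 27 30)) (eq (reg 30) (reg 28)))))

/-- Fill the slots: the first ones with the heavy, the other ones with the light variables. -/
def init : Cmd :=
  .seq (.assign 20 (reg 32)) <| .seq (digit 35 11) <|
  .loop 36 2 (.loop 30 0 (.store 3 (cell 36 30)
    (ind (ite (heavy 30) (lt (reg 36) (reg 35)) (not (lt (reg 36) (reg 35)))))))

/-- Evaluate the assignment that has been found, and keep it in the array `2` if it is the best one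
of weight `k` so far; the register `33` holds the number of satisfied clauses plus one. -/
def update : Cmd :=
  .seq (.loop 30 0 (.store 5 (reg 30) (ind (final 30)))) <|
  .seq (.assign 38 (add numSat (const 1))) <|
  .seq (.assign 34 (and (eq (count 50 0 (arr 5 (reg 50))) (reg 2)) (lt (reg 33) (reg 38)))) <|
  .seq (.loop 30 0 (.store 2 (reg 30) (ite (reg 34) (arr 5 (reg 30)) (arr 2 (reg 30))))) <|
  .assign 33 (ite (reg 34) (reg 38) (reg 33))

/-- The search through all advice. -/
def main : Cmd :=
  .seq (.assign 37 mixed) <| .seq (.loop 30 0 (.store 4 (reg 30) (ind (isHeavy 30)))) <|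
  .loop 32 12 (.seq init (.seq (.loop 31 9 step) update))

/-- The content of a term times `G`. -/
def timesG (e : Tm) : Tm :=
  mul 3 (mul 2 (mul 2 (mul 4 (add (add (add e e) (add e e)) (add (add e e) (add e e))))))

/-- Compute the parameters from `n`, `m`, `k`, `d` and `q`. -/
def prelude : Cmd :=
  .seq (.assign 5 (mul 2 (mul 2 (mul 4 (const 2))))) <|
  .seq (.assign 6 (timesG (const 1))) <|
  .seq (.assign 7 (mul 2 (mul 4 (const 4)))) <|
  .seq (.assign 9 (mul 2 (add (reg 3) (const 1)))) <|
  .seq (.assign 10 (const 4)) <| .seq (.assign 11 (add (reg 2) (const 1))) <|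
  .seq (.assign 8 (const 1)) <| .seq (.loop 98 3 (.assign 8 (timesG (reg 8)))) <|
  .seq (.assign 12 (timesG (const 1))) <|
  .loop 97 2 (.seq (.loop 98 3 (.assign 12 (timesG (timesG (timesG (reg 12))))))
    (.assign 12 (timesG (timesG (reg 12)))))

end Cmd

/-! ### What the program computes -/

/-- The number of advice strings. -/
def Inst.Z (I : Inst) : ℕ := I.G ^ (1 + I.k * (3 * I.d + 2))

/-- The parameter registers and the input arrays hold the instance `I`. -/
structure Env (I : Inst) (s : State) : Prop where
  n : s.reg 0 = I.n
  m : s.reg 1 = I.m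
  k : s.reg 2 = I.k
  κ : s.reg 5 = I.κ
  G : s.reg 6 = I.G
  Q : s.reg 7 = I.Q
  Bc : s.reg 8 = I.Bc
  N : s.reg 9 = I.k * (I.d + 1)
  four : s.reg 10 = 4
  succ_k : s.reg 11 = I.k + 1
  Z : s.reg 12 = I.Z
  pos : ∀ j v, s.arr 0 (j * I.n + v) ≠ 0 ↔ I.pos j v
  neg : ∀ j v, s.arr 1 (j * I.n + v) ≠ 0 ↔ I.neg j v

/-- In addition, the array `4` marks the heavy variables. -/
structure HEnv (I : Inst) (s : State) : Prop extends Env I s where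
  heavy : ∀ v < I.n, s.arr 4 v ≠ 0 ↔ I.Heavy v

/-- The state of the branching that is stored in the array `3`. -/
def slots (I : Inst) (s : State) (i v : ℕ) : Prop := i < I.k ∧ v < I.n ∧ s.arr 3 (i * I.n + v) ≠ 0

variable {I : Inst} {s s' : State}

theorem Env.congr (h : Env I s) (hr : ∀ y < 13, s'.reg y = s.reg y) (h0 : s'.arr 0 = s.arr 0)
    (h1 : s'.arr 1 = s.arr 1) : Env I s' := by
  obtain ⟨n, m, k, κ, G, Q, Bc, N, four, succ_k, Z, pos, neg⟩ := h
  constructor <;> first | (rw [hr _ (by omega)]; assumption) | (simpa only [h0, h1])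

theorem HEnv.congr (h : HEnv I s) (hr : ∀ y < 13, s'.reg y = s.reg y) (h0 : s'.arr 0 = s.arr 0)
    (h1 : s'.arr 1 = s.arr 1) (h4 : s'.arr 4 = s.arr 4) : HEnv I s' :=
  ⟨h.toEnv.congr hr h0 h1, by rw [h4]; exact h.heavy⟩

theorem Env.setReg (h : Env I s) {x v : ℕ} (hx : 13 ≤ x) : Env I (s.setReg x v) :=
  h.congr (fun y hy => by rw [setReg_reg, if_neg (by omega)]) rfl rfl

theorem HEnv.setReg (h : HEnv I s) {x v : ℕ} (hx : 13 ≤ x) : HEnv I (s.setReg x v) :=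
  h.congr (fun y hy => by rw [setReg_reg, if_neg (by omega)]) rfl rfl rfl

theorem HEnv.run (h : HEnv I s) {c : Cmd} (hc : c.WF 13 100) (h0 : c.stores 0 = false)
    (h1 : c.stores 1 = false) (h4 : c.stores 4 = false) : HEnv I (c.run s) :=
  h.congr (fun _ hy => Cmd.run_reg (Cmd.sets_eq_false_of_lt hc hy) s) (Cmd.run_arr h0 s)
    (Cmd.run_arr h1 s) (Cmd.run_arr h4 s)

@[simp] theorem slots_setReg (x v : ℕ) : slots I (s.setReg x v) = slots I s := rfl

namespace Tm

theorem val_cell (h : Env I s) {j v : ℕ} (hj : j ≠ 99) :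
    (cell j v).val s = s.reg j * I.n + s.reg v := by
  rw [cell, val_add, val_mul (v := s.reg j) fun i => by simp [setReg_reg, hj], h.n, mul_comm]
  rfl

theorem holds_pos (h : Env I s) {j v : ℕ} (hj : j ≠ 99) :
    (pos j v).Holds s ↔ I.pos (s.reg j) (s.reg v) := by
  rw [Holds, pos, val, val_cell h hj, h.pos]

theorem holds_neg (h : Env I s) {j v : ℕ} (hj : j ≠ 99) :
    (neg j v).Holds s ↔ I.neg (s.reg j) (s.reg v) := by
  rw [Holds, neg, val, val_cell h hj, h.neg]

theorem holds_slot (h : Env I s) {i v : ℕ} (hi : i ≠ 99) (hik : s.reg i < I.k)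
    (hv : s.reg v < I.n) : (slot i v).Holds s ↔ slots I s (s.reg i) (s.reg v) := by
  simp only [Holds, slot, val, val_cell h hi, slots, hik, hv, true_and]

theorem holds_heavy (h : HEnv I s) {v : ℕ} (hv : s.reg v < I.n) :
    (heavy v).Holds s ↔ I.Heavy (s.reg v) := by
  rw [Holds, heavy, val, val_reg, h.heavy _ hv]

theorem val_negCard (h : Env I s) {j : ℕ} (hj : j ∉ [50, 99]) :
    (negCard j).val s = I.negCard (s.reg j) := by
  simp only [List.mem_cons, List.not_mem_nil, or_false, not_or] at hj
  rw [negCard, val_count, h.n, Inst.negCard]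
  refine cnt_congr fun v _ => ?_
  rw [holds_neg (h.setReg (by omega)) hj.2]
  simp [setReg_reg, hj.1]

theorem val_mixed (h : Env I s) : mixed.val s = I.mixed := by
  rw [mixed, val_count, h.m, Inst.mixed]
  refine cnt_congr fun j _ => ?_
  have h' : Env I (s.setReg 52 j) := h.setReg (by omega)
  rw [holds_and, holds_ex, holds_lt, val_negCard h' (by decide), h'.n]
  simp only [holds_neg (h'.setReg (x := 50) (by omega)) (show 52 ≠ 99 by omega),
    setReg_reg, val_add,
    val_reg, val_const, h.k]
  simp

theorem val_negDeg (h : Env I s) {v : ℕ} (hv : v ≠ 52) :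
    (negDeg v).val s = I.negDeg (s.reg v) := by
  rw [negDeg, val_count, h.m, Inst.negDeg]
  refine cnt_congr fun j _ => ?_
  have h' : Env I (s.setReg 52 j) := h.setReg (by omega)
  rw [holds_and, holds_lt, val_negCard h' (by decide), holds_neg h' (by omega)]
  simp [setReg_reg, h.k, hv]

theorem holds_isHeavy (h : Env I s) (hm : s.reg 37 = I.mixed) {v : ℕ} (hv : v ∉ [52, 99]) :
    (isHeavy v).Holds s ↔ I.Heavy (s.reg v) := by
  simp only [List.mem_cons, List.not_mem_nil, or_false, not_or] at hv
  rw [isHeavy, holds_or, holds_lt, holds_lt, val_mul (v := I.negDeg (s.reg v)) fun i => by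
    rw [val_negDeg (h.setReg (by omega)) hv.1]
    simp [setReg_reg, hv.2]]
  simp only [val_add, val_reg, h.n, h.k, h.κ, h.Q, hm, Inst.Heavy, two_mul]

theorem holds_cov (h : HEnv I s) {j : ℕ} (hj : j ∉ [50, 51, 99]) :
    (cov j).Holds s ↔ I.Cov (slots I s) (s.reg j) := by
  simp only [List.mem_cons, List.not_mem_nil, or_false, not_or] at hj
  rw [cov, holds_or, holds_ex, holds_ex, h.n, h.k, Inst.Cov]
  refine or_congr (exists_congr fun v => and_congr_right fun hv => ?_)
    (exists_congr fun i => and_congr_right fun hi => ?_)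
  · have h' : HEnv I (s.setReg 50 v) := h.setReg (by omega)
    rw [holds_and, holds_not, holds_and, holds_neg h'.toEnv hj.2.2,
      holds_heavy h' (by simpa [setReg_reg]),
      holds_ex, h'.k]
    have : (∃ i < I.k, (slot 51 50).Holds ((s.setReg 50 v).setReg 51 i)) ↔
        ∃ i < I.k, slots I s i v := by
      refine exists_congr fun i => and_congr_right fun hi => ?_
      rw [holds_slot (h'.toEnv.setReg (by omega)) (by omega) (by simpa [setReg_reg])
        (by simpa [setReg_reg])]
      simp [setReg_reg]
    rw [this]
    simp [setReg_reg, hj.1]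
  · have h' : HEnv I (s.setReg 51 i) := h.setReg (by omega)
    rw [holds_all, h'.n]
    refine forall_congr' fun v => imp_congr_right fun hv => ?_
    have h'' : HEnv I ((s.setReg 51 i).setReg 50 v) := h'.setReg (by omega)
    rw [holds_or, holds_not, holds_pos h''.toEnv hj.2.2, holds_slot h''.toEnv (by omega)
      (by simpa [setReg_reg]) (by simpa [setReg_reg])]
    simp [setReg_reg, hj.1, hj.2.1, imp_iff_not_or]

theorem val_deg (h : HEnv I s) {v : ℕ} (hv : v ≠ 52) :
    (deg v).val s = I.deg (slots I s) (s.reg v) := by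
  rw [deg, val_count, h.m, Inst.deg]
  refine cnt_congr fun j _ => ?_
  have h' : HEnv I (s.setReg 52 j) := h.setReg (by omega)
  rw [holds_and, holds_not, holds_cov h' (by decide), holds_pos h'.toEnv (by omega)]
  simp [setReg_reg, hv]

theorem val_share (h : HEnv I s) {y v : ℕ} (hy : y ≠ 52) (hv : v ≠ 52) :
    (share y v).val s = I.share (slots I s) (s.reg y) (s.reg v) := by
  rw [share, val_count, h.m, Inst.share]
  refine cnt_congr fun j _ => ?_
  have h' : HEnv I (s.setReg 52 j) := h.setReg (by omega)
  rw [holds_and, holds_not, holds_and, holds_cov h' (by decide), holds_pos h'.toEnv (by omega),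
    holds_pos h'.toEnv (by omega)]
  simp [setReg_reg, hv, hy]

theorem val_best (h : HEnv I s) {i : ℕ} (hi : i < 50) (hik : s.reg i < I.k) :
    (best i).val s = I.best (slots I s) (s.reg i) := by
  have key : ∀ (x : ℕ) (σ : State), HEnv I σ → x ∉ [52, 55] → 13 ≤ x → σ.reg i = s.reg i →
      slots I σ = slots I s → σ.reg x < I.n →
      ((and (slot i x) (all 55 0 (or (not (slot i 55)) (not (lt (deg x) (deg 55)))))).Holds σ ↔
        slots I s (s.reg i) (σ.reg x) ∧ ∀ u < I.n, slots I s (s.reg i) u →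
          ¬ I.deg (slots I s) (σ.reg x) < I.deg (slots I s) u) := by
    intro x σ hσ hx hx' hσi hσs hxn
    simp only [List.mem_cons, List.not_mem_nil, or_false, not_or] at hx
    rw [holds_and, holds_slot hσ.toEnv (by omega) (by rwa [hσi]) hxn, hσi, hσs, holds_all, hσ.n]
    refine and_congr_right fun _ => forall_congr' fun u => imp_congr_right fun hu => ?_
    have h' : HEnv I (σ.setReg 55 u) := hσ.setReg (by omega)
    have e1 : i ≠ 55 := by omega
    rw [holds_or, holds_not, holds_not, holds_lt, val_deg h' hx.1, val_deg h' (by omega),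
      holds_slot h'.toEnv (by omega) (by simpa [setReg_reg, e1, hσi]) (by simpa [setReg_reg])]
    simp [setReg_reg, hx.2, e1, hσi, hσs, imp_iff_not_or]
  have e1 : i ≠ 53 := by omega
  have e2 : i ≠ 54 := by omega
  refine val_nth h.n (by omega) (by omega) (fun v hv => ?_) (fun v hv l hl => ?_) fun _ => rfl
  · rw [key 53 _ (h.setReg (by omega)) (by decide) (by omega) (by simp [setReg_reg, e1]) rfl
      (by simpa [setReg_reg])]
    simp [setReg_reg]
  · rw [key 54 _ ((h.setReg (by omega)).setReg (by omega)) (by decide) (by omega)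
      (by simp [setReg_reg, e1, e2]) rfl (by simpa [setReg_reg])]
    simp [setReg_reg]

theorem val_clauseOf (h : HEnv I s) {y w : ℕ} (hy : y < 50) (hw : w < 50) :
    (clauseOf y w).val s = I.clauseOf (slots I s) (s.reg y) (s.reg w) := by
  have e1 : y ≠ 53 := by omega
  have e2 : y ≠ 54 := by omega
  have e3 : w ≠ 53 := by omega
  refine val_nth h.m (by omega) (by omega) (fun v hv => ?_) (fun v hv l hl => ?_)
    fun i => by simp [setReg_reg, e3]
  · have h' : HEnv I (s.setReg 53 v) := h.setReg (by omega)
    rw [holds_and, holds_not, holds_cov h' (by decide), holds_pos h'.toEnv (by omega)]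
    simp [setReg_reg, e1]
  · have h' : HEnv I ((s.setReg 53 v).setReg 54 l) := (h.setReg (by omega)).setReg (by omega)
    rw [holds_and, holds_not, holds_cov h' (by decide), holds_pos h'.toEnv (by omega)]
    simp [setReg_reg, e1, e2]

theorem val_choice (h : HEnv I s) {op t y c : ℕ} (hop : op < 50) (ht : t < 50) (hy : y < 50)
    (hc : c < 50) (htk : s.reg t < I.k) : (choice op t y c).val s =
      I.choice (slots I s) (s.reg op) (s.reg t) (s.reg y) (s.reg c) := by
  have key : ∀ (x : ℕ) (σ : State), HEnv I σ → x ∉ [52, 99] → σ.reg t = s.reg t →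
      σ.reg op = s.reg op → σ.reg y = s.reg y → slots I σ = slots I s → σ.reg x < I.n →
      ((and (slot t x) (or (eq (reg op) (const 3)) (lt (deg y) (mul 5 (share y x))))).Holds σ ↔
        slots I s (s.reg t) (σ.reg x) ∧ (s.reg op = 3 ∨ I.deg (slots I s) (s.reg y) <
          I.κ * I.share (slots I s) (s.reg y) (σ.reg x))) := by
    intro x σ hσ hx hσt hσo hσy hσs hxn
    simp only [List.mem_cons, List.not_mem_nil, or_false, not_or] at hx
    have e1 : y ≠ 99 := by omega
    rw [holds_and, holds_slot hσ.toEnv (by omega) (by rwa [hσt]) hxn, hσt, hσs, holds_or, holds_eq,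
      holds_lt, val_deg hσ (by omega), val_mul (v := I.share (slots I s) (s.reg y) (σ.reg x))
        fun i => by
          rw [val_share (hσ.setReg (by omega)) (by omega) hx.1]
          simp [setReg_reg, hx.2, e1, hσy, hσs], hσ.κ]
    simp [hσo, hσs, hσy]
  have e1 : t ≠ 53 := by omega
  have e2 : t ≠ 54 := by omega
  have e3 : op ≠ 53 := by omega
  have e4 : op ≠ 54 := by omega
  have e5 : y ≠ 53 := by omega
  have e6 : y ≠ 54 := by omega
  have e7 : c ≠ 53 := by omega
  classical
  rw [choice, val_ite, Inst.choice]
  refine if_congr (by simp) rfl (val_nth h.n (by omega) (by omega) (fun v hv => ?_)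
    (fun v hv l hl => ?_) fun i => by simp [setReg_reg, e7])
  · rw [key 53 _ (h.setReg (by omega)) (by decide) (by simp [setReg_reg, e1])
      (by simp [setReg_reg, e3]) (by simp [setReg_reg, e5]) rfl (by simpa [setReg_reg])]
    simp [setReg_reg]
  · rw [key 54 _ ((h.setReg (by omega)).setReg (by omega)) (by decide)
      (by simp [setReg_reg, e1, e2]) (by simp [setReg_reg, e3, e4]) (by simp [setReg_reg, e5, e6])
      rfl (by simpa [setReg_reg])]
    simp [setReg_reg]

theorem holds_chosen (h : Env I s) {v : ℕ} (hv : v ≠ 51) (hvn : s.reg v < I.n) :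
    (chosen v).Holds s ↔ I.Chosen (slots I s) (s.reg v) := by
  rw [chosen, holds_ex, h.k, Inst.Chosen]
  refine exists_congr fun i => and_congr_right fun hi => ?_
  rw [holds_slot (h.setReg (by omega)) (by omega) (by simpa [setReg_reg])
    (by simpa [setReg_reg, hv])]
  simp [setReg_reg, hv]

theorem holds_final (h : HEnv I s) {v : ℕ} (hv : v < 50) (hvn : s.reg v < I.n) :
    (final v).Holds s ↔ I.Final (slots I s) (s.reg v) := by
  have e1 : v ≠ 53 := by omega
  have e2 : ∀ u < I.n, (chosen 53).Holds (s.setReg 53 u) ↔ I.Chosen (slots I s) u := fun u hu => by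
    rw [holds_chosen (h.toEnv.setReg (by omega)) (by omega) (by simpa [setReg_reg])]
    simp [setReg_reg]
  have e3 : ∀ u < I.n, (heavy 53).Holds (s.setReg 53 u) ↔ I.Heavy u := fun u hu => by
    rw [holds_heavy (h.setReg (by omega)) (by simpa [setReg_reg])]
    simp [setReg_reg]
  rw [final, holds_or, holds_and, holds_and, holds_not, holds_not, holds_lt, val_count, val_sub,
    val_count, holds_chosen h.toEnv (by omega) hvn, holds_heavy h hvn, val_reg, h.n, h.k,
    cnt_congr (B := I.Chosen (slots I s)) e2, Inst.Final,
    cnt_congr (B := fun u => u < s.reg v ∧ ¬ I.Chosen (slots I s) u ∧ ¬ I.Heavy u) fun u hu => by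
      rw [holds_and, holds_and, holds_not, holds_not, holds_lt, e2 u hu, e3 u hu]
      simp [setReg_reg, e1]]

theorem val_numSat (h : Env I s) :
    numSat.val s = I.numSat fun v => s.arr 5 v ≠ 0 := by
  rw [numSat, val_count, h.m, Inst.numSat]
  refine cnt_congr fun j _ => ?_
  have h' : Env I (s.setReg 52 j) := h.setReg (by omega)
  rw [holds_ex, h'.n]
  refine exists_congr fun v => and_congr_right fun hv => ?_
  have h'' : Env I ((s.setReg 52 j).setReg 50 v) := h'.setReg (by omega)
  rw [holds_or, holds_and, holds_and, holds_not, holds_pos h'' (by omega), holds_neg h'' (by omega)]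
  simp [setReg_reg, Holds, val]

end Tm

/-! ### One step of the branching, executed -/

theorem cnt_lt {N r : ℕ} (h : r ≤ N) : (cnt N fun i => i < r) = r := by
  classical
  rw [cnt_eq_card]
  have : (range N).filter (fun i => i < r) = range r := by
    ext i
    simp only [mem_filter, mem_range]
    omega
  rw [this, card_range]

theorem cell_inj {n i j u v : ℕ} (hu : u < n) (hv : v < n) (h : i * n + u = j * n + v) :
    i = j ∧ u = v := by
  have h1 : (i * n + u) / n = i := by
    rw [mul_comm, Nat.mul_add_div (by omega), Nat.div_eq_of_lt hu, add_zero]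
  have h2 : (j * n + v) / n = j := by
    rw [mul_comm, Nat.mul_add_div (by omega), Nat.div_eq_of_lt hv, add_zero]
  have : i = j := by rw [← h1, h, h2]
  subst this
  exact ⟨rfl, by omega⟩

theorem Tm.val_quot (h : Env I s) {p b : ℕ} (hp : p < 50) (hb : s.reg p = b) (hb1 : 1 ≤ b)
    (hz : s.reg 20 < I.Z) : (Cmd.quot p).val s = s.reg 20 / b := by
  rw [Cmd.quot, val_count, h.Z]
  have hle : s.reg 20 / b ≤ s.reg 20 := Nat.div_le_self _ _
  have hp1 : p ≠ 50 := by omega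
  have hp2 : p ≠ 99 := by omega
  rw [← cnt_lt (hle.trans hz.le)]
  refine cnt_congr fun u _ => ?_
  rw [holds_lt, val_mul (v := u + 1) fun i => by simp [setReg_reg]]
  simp only [setReg_reg, hp1, if_false, hb, val_add, val_reg, val_const]
  rw [Nat.lt_iff_add_one_le (m := u), Nat.le_div_iff_mul_le hb1, mul_comm]
  simp

namespace Cmd

theorem run_seq (c d : Cmd) (s : State) : (seq c d).run s = d.run (c.run s) := rfl
theorem run_assign (x : ℕ) (e : Tm) (s : State) : (assign x e).run s = s.setReg x (e.val s) := rfl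

theorem run_digit (h : Env I s) {x p b : ℕ} (hx29 : x ≠ 29)
    (hp : p < 13) (hb : s.reg p = b) (hb1 : 1 ≤ b) (hz : s.reg 20 < I.Z) :
    (digit x p).run s =
      ((s.setReg 29 (s.reg 20 / b)).setReg x (s.reg 20 % b)).setReg 20 (s.reg 20 / b) := by
  have e1 : p ≠ 29 := by omega
  have hmul : (Tm.mul p (.reg 29)).val (s.setReg 29 (s.reg 20 / b)) = b * (s.reg 20 / b) := by
    rw [Tm.val_mul (v := s.reg 20 / b) fun i => by simp [setReg_reg]]
    simp [setReg_reg, e1, hb]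
  simp only [digit, run_seq, run_assign, Tm.val_quot h (by omega) hb hb1 hz, Tm.val_sub, Tm.val_reg,
    hmul]
  have : s.reg 20 - b * (s.reg 20 / b) = s.reg 20 % b := by
    have := Nat.div_add_mod (s.reg 20) b
    omega
  simp [setReg_reg, hx29.symm, this]

open scoped Classical in
/-- A loop that stores the truth values of a term in the cells `J i` of one array. -/
theorem run_loop_ind {x p a N : ℕ} {e f : Tm} (J : ℕ → ℕ) (P : ℕ → Prop) (hN : s.reg p = N)
    (hJ : ∀ i < N, ∀ l < N, J i = J l → i = l)
    (h : ∀ i < N, ∀ σ : State, (∀ y ≠ x, σ.reg y = s.reg y) → σ.reg x = i →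
      (∀ a' ≠ a, σ.arr a' = s.arr a') → σ.arr a (J i) = s.arr a (J i) →
      e.val σ = J i ∧ (f.Holds σ ↔ P i)) :
    (∀ i < N, ((loop x p (.store a e (.ind f))).run s).arr a (J i) = if P i then 1 else 0) ∧
      ∀ c, (∀ i < N, c ≠ J i) → ((loop x p (.store a e (.ind f))).run s).arr a c = s.arr a c := by
  refine run_loop_store J (fun i => if P i then 1 else 0) hN hJ fun i hi σ h1 h2 h3 h4 => ?_
  obtain ⟨g1, g2⟩ := h i hi σ h1 h2 h3 h4
  refine ⟨g1, ?_⟩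
  rw [Tm.ind, Tm.val_ite]
  simp only [g2, Tm.val_const]

end Cmd

theorem Inst.step_snd_le (p : (ℕ → ℕ → Prop) × ℕ) : (I.step p).2 ≤ p.2 := by
  have h1 : p.2 / I.k / 4 / I.k / I.G ≤ p.2 :=
    (Nat.div_le_self _ _).trans ((Nat.div_le_self _ _).trans ((Nat.div_le_self _ _).trans
      (Nat.div_le_self _ _)))
  simp only [Inst.step]
  split_ifs
  · exact h1
  · exact (Nat.div_le_self _ _).trans h1

/-- The positivity of the parameters. -/
structure Inst.Pos (I : Inst) : Prop where
  k : 1 ≤ I.k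
  d : 1 ≤ I.d
  q : 1 ≤ I.q

theorem Inst.Pos.κ (h : I.Pos) : 1 ≤ I.κ := by
  unfold Inst.κ
  nlinarith [Nat.mul_pos h.k h.k, Nat.mul_pos (Nat.mul_pos h.k h.k) h.q]

theorem Inst.Pos.G (h : I.Pos) : 1 ≤ I.G := by
  have := Inst.two_le_G h.d h.κ
  omega

theorem Inst.Pos.Bc (h : I.Pos) : 1 ≤ I.Bc := Nat.one_le_pow _ _ h.G

namespace Cmd

theorem run_step (hI : I.Pos) (h : HEnv I s) (hz : s.reg 20 < I.Z) :
    slots I (step.run s) = (I.step (slots I s, s.reg 20)).1 ∧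
      (step.run s).reg 20 = (I.step (slots I s, s.reg 20)).2 := by
  classical
  set z := s.reg 20 with hzdef
  have d1 : z / I.k ≤ z := Nat.div_le_self _ _
  have d2 : z / I.k / 4 ≤ z := (Nat.div_le_self _ _).trans d1
  have d3 : z / I.k / 4 / I.k ≤ z := (Nat.div_le_self _ _).trans d2
  have d4 : z / I.k / 4 / I.k / I.G ≤ z := (Nat.div_le_self _ _).trans d3
  obtain ⟨s₁, hs₁⟩ : ∃ σ, σ = (digit 21 2).run s := ⟨_, rfl⟩
  have e₁ := hs₁.trans (run_digit h.toEnv (by omega) (by omega) h.k hI.k hz)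
  have h₁ : HEnv I s₁ := by rw [e₁]; exact ((h.setReg (by omega)).setReg (by omega)).setReg (by omega)
  have z₁ : s₁.reg 20 = z / I.k := by simp [e₁, setReg_reg, ← hzdef]
  obtain ⟨s₂, hs₂⟩ : ∃ σ, σ = (digit 22 10).run s₁ := ⟨_, rfl⟩
  have e₂ := hs₂.trans (run_digit h₁.toEnv (by omega) (by omega) h₁.four
    (by omega) (by omega))
  have h₂ : HEnv I s₂ := by rw [e₂]; exact ((h₁.setReg (by omega)).setReg (by omega)).setReg (by omega)
  have z₂ : s₂.reg 20 = z / I.k / 4 := by simp [e₂, setReg_reg, z₁]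
  obtain ⟨s₃, hs₃⟩ : ∃ σ, σ = (digit 23 2).run s₂ := ⟨_, rfl⟩
  have e₃ := hs₃.trans (run_digit h₂.toEnv (by omega) (by omega) h₂.k
    hI.k (by omega))
  have h₃ : HEnv I s₃ := by rw [e₃]; exact ((h₂.setReg (by omega)).setReg (by omega)).setReg (by omega)
  have z₃ : s₃.reg 20 = z / I.k / 4 / I.k := by simp [e₃, setReg_reg, z₂]
  obtain ⟨s₄, hs₄⟩ : ∃ σ, σ = (digit 24 6).run s₃ := ⟨_, rfl⟩
  have e₄ := hs₄.trans (run_digit h₃.toEnv (by omega) (by omega) h₃.G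
    hI.G (by omega))
  have h₄ : HEnv I s₄ := by rw [e₄]; exact ((h₃.setReg (by omega)).setReg (by omega)).setReg (by omega)
  have z₄ : s₄.reg 20 = z / I.k / 4 / I.k / I.G := by simp [e₄, setReg_reg, z₃]
  -- the remaining assignments
  have hq : (quot 8).val s₄ = s₄.reg 20 / I.Bc :=
    Tm.val_quot h₄.toEnv (by omega) h₄.Bc hI.Bc (by omega)
  obtain ⟨s₅, hs₅⟩ : ∃ σ, σ = ((s₄.setReg 29 (s₄.reg 20 / I.Bc)).setReg 25
    (s₄.reg 20 % I.Bc)).setReg 20 (if s₄.reg 22 = 1 then s₄.reg 20 else s₄.reg 20 / I.Bc) :=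
    ⟨_, rfl⟩
  have h₅ : HEnv I s₅ := by
    rw [hs₅]; exact ((h₄.setReg (by omega)).setReg (by omega)).setReg (by omega)
  have hsl : slots I s₅ = slots I s := by rw [hs₅, e₄, e₃, e₂, e₁]; rfl
  have r21 : s₅.reg 21 = z % I.k := by
    simp [hs₅, e₄, e₃, e₂, e₁, setReg_reg, ← hzdef]
  have r22 : s₄.reg 22 = z / I.k % 4 := by
    simp [e₄, e₃, e₂, setReg_reg, z₁]
  have r22' : s₅.reg 22 = z / I.k % 4 := by
    simp [hs₅, setReg_reg, r22]
  have r23 : s₅.reg 23 = z / I.k / 4 % I.k := by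
    simp [hs₅, e₄, e₃, setReg_reg, z₂]
  have r24 : s₅.reg 24 = z / I.k / 4 / I.k % I.G := by
    simp [hs₅, e₄, setReg_reg, z₃]
  have r25 : s₅.reg 25 = z / I.k / 4 / I.k / I.G % I.Bc := by
    simp [hs₅, setReg_reg, z₄]
  have r20 : s₅.reg 20 = (I.step (slots I s, z)).2 := by
    simp [hs₅, setReg_reg, r22, z₄, Inst.step]
  have hmod : ∀ a, a % I.k < I.k := fun a => Nat.mod_lt _ hI.k
  obtain ⟨s₆, hs₆⟩ : ∃ σ, σ = s₅.setReg 26 (I.best (slots I s) (z % I.k)) := ⟨_, rfl⟩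
  have h₆ : HEnv I s₆ := by rw [hs₆]; exact h₅.setReg (by omega)
  have hsl₆ : slots I s₆ = slots I s := by rw [hs₆, ← hsl]; rfl
  set y := I.best (slots I s) (z % I.k) with hy
  set w := z / I.k / 4 / I.k % I.G with hw
  obtain ⟨s₇, hs₇⟩ : ∃ σ, σ = s₆.setReg 27 (I.clauseOf (slots I s) y w) := ⟨_, rfl⟩
  have h₇ : HEnv I s₇ := by rw [hs₇]; exact h₆.setReg (by omega)
  have hsl₇ : slots I s₇ = slots I s := by rw [hs₇, ← hsl₆]; rfl
  set op := z / I.k % 4 with hop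
  set t := z / I.k / 4 % I.k with ht
  set c := z / I.k / 4 / I.k / I.G % I.Bc with hc
  obtain ⟨s₈, hs₈⟩ : ∃ σ, σ = s₇.setReg 28 (I.choice (slots I s) op t y c) := ⟨_, rfl⟩
  have h₈ : HEnv I s₈ := by rw [hs₈]; exact h₇.setReg (by omega)
  have hsl₈ : slots I s₈ = slots I s := by rw [hs₈, ← hsl₇]; rfl
  have hrun : step.run s = (loop 30 0 (.store 3 (.cell 23 30)
      (.ind (.ite (.eq (.reg 22) (.const 1)) (.and (.slot 23 30) (.pos 27 30))
        (.eq (.reg 30) (.reg 28)))))).run s₈ := by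
    have v5 : ∀ σ, σ = s₄.setReg 29 (s₄.reg 20 / I.Bc) →
        (Tm.sub (.reg 20) (.mul 8 (.reg 29))).val σ = s₄.reg 20 % I.Bc := by
      rintro σ rfl
      rw [Tm.val_sub, Tm.val_mul (v := s₄.reg 20 / I.Bc) fun i => by simp [setReg_reg]]
      have := Nat.div_add_mod (s₄.reg 20) I.Bc
      simp only [setReg_reg, h₄.Bc, Tm.val_reg]
      norm_num
      omega
    have v6 : (Tm.best 21).val s₅ = y := by
      rw [Tm.val_best h₅ (by omega) (by rw [r21]; exact hmod _), r21, hsl]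
    have v7 : (Tm.clauseOf 26 24).val s₆ = I.clauseOf (slots I s) y w := by
      rw [Tm.val_clauseOf h₆ (by omega) (by omega), hsl₆]
      simp [hs₆, setReg_reg, r24]
    have v8 : (Tm.choice 22 23 26 25).val s₇ = I.choice (slots I s) op t y c := by
      have t23 : s₇.reg 23 = t := by simp [hs₇, hs₆, setReg_reg, r23]
      rw [Tm.val_choice h₇ (by omega) (by omega) (by omega) (by omega) (by rw [t23]; exact hmod _),
        hsl₇, t23]
      simp [hs₇, hs₆, setReg_reg, r22', r25]
    simp only [step, run_seq, ← hs₁, ← hs₂, ← hs₃, ← hs₄, run_assign, hq, v5 _ rfl]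
    have v20 : (Tm.ite (.eq (.reg 22) (.const 1)) (.reg 20) (.reg 29)).val
        ((s₄.setReg 29 (s₄.reg 20 / I.Bc)).setReg 25 (s₄.reg 20 % I.Bc)) =
        if s₄.reg 22 = 1 then s₄.reg 20 else s₄.reg 20 / I.Bc := by
      rw [Tm.val_ite]
      simp [setReg_reg]
    rw [v20, ← hs₅, v6, ← hs₆, v7, ← hs₇, v8, ← hs₈]
  have p22 : s₈.reg 22 = op := by simp [hs₈, hs₇, hs₆, setReg_reg, r22']
  have p23 : s₈.reg 23 = t := by simp [hs₈, hs₇, hs₆, setReg_reg, r23]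
  have p27 : s₈.reg 27 = I.clauseOf (slots I s) y w := by simp [hs₈, hs₇, setReg_reg]
  have p28 : s₈.reg 28 = I.choice (slots I s) op t y c := by simp [hs₈, setReg_reg]
  obtain ⟨g1, g2⟩ := run_loop_ind (x := 30) (p := 0) (a := 3) (e := .cell 23 30)
    (f := .ite (.eq (.reg 22) (.const 1)) (.and (.slot 23 30) (.pos 27 30))
      (.eq (.reg 30) (.reg 28)))
    (s := s₈) (fun v => t * I.n + v)
    (fun v => if op = 1 then slots I s t v ∧ I.pos (I.clauseOf (slots I s) y w) v
      else v = I.choice (slots I s) op t y c) h₈.n (fun i _ l _ h => by simpa using h)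
    (fun v hv σ a1 a2 a3 a4 => by
      have hσ : Env I σ := h₈.toEnv.congr (fun y hy => a1 y (by omega)) (a3 0 (by omega))
        (a3 1 (by omega))
      have b22 := (a1 22 (by omega)).trans p22
      have b23 := (a1 23 (by omega)).trans p23
      have b27 := (a1 27 (by omega)).trans p27
      have b28 := (a1 28 (by omega)).trans p28
      refine ⟨by rw [Tm.val_cell hσ (by omega), b23, a2], ?_⟩
      have hslot : (Tm.slot 23 30).Holds σ ↔ slots I s t v := by
        rw [Tm.holds_slot hσ (by omega) (by rw [b23]; exact hmod _) (by rw [a2]; exact hv), b23, a2,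
          ← hsl₈]
        unfold slots
        rw [a4]
      rw [Tm.holds_ite, Tm.holds_and, hslot, Tm.holds_pos hσ (by omega), Tm.holds_eq, Tm.holds_eq]
      simp only [Tm.val_reg, Tm.val_const, b22, b27, b28, a2])
  rw [hrun]
  constructor
  · ext i v
    rw [Inst.step]
    simp only [Inst.stepV, ← hop, ← ht, ← hw, ← hc, ← hy]
    by_cases hv : v < I.n
    swap
    · split_ifs <;> simp [slots, hv]
    by_cases hit : i = t
    · subst hit
      rw [if_pos rfl, slots, g1 v hv]
      have htk : t < I.k := hmod _
      simp [hv, htk]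
    · rw [if_neg hit, slots, g2 _ fun v' hv' heq => hit (cell_inj hv hv' heq).1, ← hsl₈]
      rfl
  · rw [run_reg (by rfl)]
    simp [hs₈, hs₇, hs₆, setReg_reg, r20]

end Cmd

/-! ### The search, executed -/

theorem Inst.numSat_congr {S T : ℕ → Prop} (h : ∀ v < I.n, (S v ↔ T v)) :
    I.numSat S = I.numSat T :=
  cnt_congr fun _ _ => exists_congr fun v => and_congr_right fun hv => by rw [h v hv]

/-- The initial state of the branching, with `t` slots for heavy variables. -/
def Inst.initV (I : Inst) (t i v : ℕ) : Prop := i < I.k ∧ v < I.n ∧ (I.Heavy v ↔ i < t)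

/-- The assignment that is found with the advice `z`. -/
noncomputable def Inst.found (I : Inst) (z : ℕ) : ℕ → Prop :=
  I.Final ((I.step)^[I.k * (I.d + 1)] (I.initV (z % (I.k + 1)), z / (I.k + 1))).1

namespace Cmd

theorem run_init (h : HEnv I s) (hz : s.reg 32 < I.Z) :
    HEnv I (init.run s) ∧ (init.run s).reg 20 = s.reg 32 / (I.k + 1) ∧
      slots I (init.run s) = I.initV (s.reg 32 % (I.k + 1)) := by
  classical
  set z := s.reg 32 with hzdef
  have h' : HEnv I (s.setReg 20 z) := h.setReg (by omega)
  obtain ⟨s₁, hs₁⟩ : ∃ σ, σ = (digit 35 11).run (s.setReg 20 z) := ⟨_, rfl⟩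
  have e₁ := hs₁.trans (run_digit h'.toEnv (by omega) (by omega) h'.succ_k
    (by omega) (by simpa [setReg_reg]))
  have h₁ : HEnv I s₁ := by rw [e₁]; exact ((h'.setReg (by omega)).setReg (by omega)).setReg (by omega)
  have r20 : s₁.reg 20 = z / (I.k + 1) := by simp [e₁, setReg_reg]
  have r35 : s₁.reg 35 = z % (I.k + 1) := by simp [e₁, setReg_reg]
  set t := z % (I.k + 1)
  have hrun : init.run s = (loop 36 2 (loop 30 0 (.store 3 (.cell 36 30)
    (.ind (.ite (.heavy 30) (.lt (.reg 36) (.reg 35)) (.not (.lt (.reg 36) (.reg 35)))))))).run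
      s₁ := by
    simp only [init, run_seq, run_assign, Tm.val_reg, ← hzdef, ← hs₁]
  rw [hrun]
  refine ⟨h₁.run (by rfl) (by rfl) (by rfl) (by rfl), (run_reg (by rfl) _).trans r20, ?_⟩
  rw [run, h₁.k]
  have key := iterate_induction (n := I.k) (s := s₁)
    (f := fun i σ => (loop 30 0 (.store 3 (.cell 36 30)
      (.ind (.ite (.heavy 30) (.lt (.reg 36) (.reg 35)) (.not (.lt (.reg 36) (.reg 35))))))).run
        (σ.setReg 36 i))
    (fun M σ => HEnv I σ ∧ σ.reg 35 = t ∧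
      ∀ i < M, ∀ v < I.n, σ.arr 3 (i * I.n + v) ≠ 0 ↔ (I.Heavy v ↔ i < t))
    ⟨h₁, r35, by simp⟩ (by
      rintro M hM σ ⟨q1, q2, q3⟩
      have q1' : HEnv I (σ.setReg 36 M) := q1.setReg (by omega)
      obtain ⟨g1, g2⟩ := run_loop_ind (x := 30) (p := 0) (a := 3) (e := .cell 36 30)
        (f := .ite (.heavy 30) (.lt (.reg 36) (.reg 35)) (.not (.lt (.reg 36) (.reg 35))))
        (s := σ.setReg 36 M) (fun v => M * I.n + v) (fun v => I.Heavy v ↔ M < t) q1'.n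
        (fun i _ l _ h => by simpa using h)
        (fun v hv τ a1 a2 a3 a4 => by
          have hτ : HEnv I τ := q1'.congr (fun y hy => a1 y (by omega)) (a3 0 (by omega))
            (a3 1 (by omega)) (a3 4 (by omega))
          have b36 : τ.reg 36 = M := (a1 36 (by omega)).trans (by simp [setReg_reg])
          have b35 : τ.reg 35 = t := (a1 35 (by omega)).trans (by simp [setReg_reg, q2])
          refine ⟨by rw [Tm.val_cell hτ.toEnv (by omega), b36, a2], ?_⟩
          rw [Tm.holds_ite, Tm.holds_not, Tm.holds_lt, Tm.holds_heavy hτ (by rwa [a2])]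
          simp only [Tm.val_reg, b36, b35, a2]
          split_ifs with hh <;> simp [hh])
      refine ⟨q1'.run (by rfl) (by rfl) (by rfl) (by rfl),
        (run_reg (by rfl) _).trans (by simp [setReg_reg, q2]), fun i hi v hv => ?_⟩
      by_cases hiM : i = M
      · subst hiM
        rw [g1 v hv]
        simp
      · rw [g2 _ fun v' hv' heq => hiM (cell_inj hv hv' heq).1]
        exact q3 i (by omega) v hv)
  ext i v
  rw [slots, Inst.initV]
  refine and_congr_right fun hi => and_congr_right fun hv => key.2.2 i hi v hv

theorem run_steps (hI : I.Pos) (h : HEnv I s) (hz : s.reg 20 < I.Z) :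
    HEnv I ((loop 31 9 step).run s) ∧ slots I ((loop 31 9 step).run s) =
      ((I.step)^[I.k * (I.d + 1)] (slots I s, s.reg 20)).1 := by
  refine ⟨h.run (by rfl) (by rfl) (by rfl) (by rfl), ?_⟩
  rw [run, h.N]
  have key := iterate_induction (n := I.k * (I.d + 1)) (s := s)
    (f := fun i σ => step.run (σ.setReg 31 i))
    (fun M σ => HEnv I σ ∧ σ.reg 20 < I.Z ∧
      (slots I σ, σ.reg 20) = (I.step)^[M] (slots I s, s.reg 20))
    ⟨h, hz, rfl⟩ (by
      rintro M hM σ ⟨q1, q2, q3⟩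
      have q1' : HEnv I (σ.setReg 31 M) := q1.setReg (by omega)
      have e20 : (σ.setReg 31 M).reg 20 = σ.reg 20 := by simp [setReg_reg]
      obtain ⟨g1, g2⟩ := run_step hI q1' (by rwa [e20])
      rw [e20, slots_setReg, q3] at g1 g2
      refine ⟨q1'.run (by rfl) (by rfl) (by rfl) (by rfl), ?_, ?_⟩
      · rw [g2]
        refine lt_of_le_of_lt (I.step_snd_le _) ?_
        rwa [← q3]
      · rw [iterate_succ_apply', g1, g2])
  exact congrArg Prod.fst key.2.2

open scoped Classical in
theorem run_update (h : HEnv I s) :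
    (cnt I.n (I.Final (slots I s)) = I.k ∧ s.reg 33 < I.numSat (I.Final (slots I s)) + 1 →
      (update.run s).reg 33 = I.numSat (I.Final (slots I s)) + 1 ∧
      ∀ v < I.n, (update.run s).arr 2 v = if I.Final (slots I s) v then 1 else 0) ∧
    (¬ (cnt I.n (I.Final (slots I s)) = I.k ∧ s.reg 33 < I.numSat (I.Final (slots I s)) + 1) →
      (update.run s).reg 33 = s.reg 33 ∧ ∀ v < I.n, (update.run s).arr 2 v = s.arr 2 v) := by
  set S := I.Final (slots I s)
  obtain ⟨s₁, hs₁⟩ : ∃ σ, σ = (loop 30 0 (.store 5 (.reg 30) (.ind (.final 30)))).run s := ⟨_, rfl⟩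
  obtain ⟨g1, -⟩ := run_loop_ind (x := 30) (p := 0) (a := 5) (e := .reg 30) (f := .final 30)
    (s := s) (fun v => v) S h.n (fun i _ l _ h => h)
    (fun v hv τ a1 a2 a3 a4 => by
      have hτ : HEnv I τ := h.congr (fun y hy => a1 y (by omega)) (a3 0 (by omega))
        (a3 1 (by omega)) (a3 4 (by omega))
      have hsl : slots I τ = slots I s := by
        unfold slots
        rw [a3 3 (by omega)]
      refine ⟨a2, ?_⟩
      rw [Tm.holds_final hτ (by omega) (by rwa [a2]), a2, hsl])
  rw [← hs₁] at g1
  have h₁ : HEnv I s₁ := by rw [hs₁]; exact h.run (by rfl) (by rfl) (by rfl) (by rfl)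
  have r33 : s₁.reg 33 = s.reg 33 := by rw [hs₁]; exact run_reg (by rfl) _
  have a2 : s₁.arr 2 = s.arr 2 := by rw [hs₁]; exact run_arr (by rfl) _
  have hS : ∀ v < I.n, s₁.arr 5 v ≠ 0 ↔ S v := fun v hv => by rw [g1 v hv]; simp
  have hnum : Tm.numSat.val s₁ = I.numSat S := by
    rw [Tm.val_numSat h₁.toEnv]
    exact Inst.numSat_congr hS
  obtain ⟨s₂, hs₂⟩ : ∃ σ, σ = s₁.setReg 38 (I.numSat S + 1) := ⟨_, rfl⟩
  have h₂ : HEnv I s₂ := by rw [hs₂]; exact h₁.setReg (by omega)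
  obtain ⟨s₃, hs₃⟩ : ∃ σ, σ = s₂.setReg 34 ((Tm.and (.eq (.count 50 0 (.arr 5 (.reg 50))) (.reg 2))
    (.lt (.reg 33) (.reg 38))).val s₂) := ⟨_, rfl⟩
  have h₃ : HEnv I s₃ := by rw [hs₃]; exact h₂.setReg (by omega)
  have hb : s₃.reg 34 ≠ 0 ↔ cnt I.n S = I.k ∧ s.reg 33 < I.numSat S + 1 := by
    have : s₃.reg 34 = ((Tm.and (.eq (.count 50 0 (.arr 5 (.reg 50))) (.reg 2))
      (.lt (.reg 33) (.reg 38))).val s₂) := by rw [hs₃]; simp [setReg_reg]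
    rw [this]
    refine Tm.holds_and.trans ?_
    rw [Tm.holds_eq, Tm.holds_lt, Tm.val_count, h₂.n, Tm.val_reg, h₂.k,
      cnt_congr (B := S) fun v hv => by
        rw [← hS v hv]
        simp [Tm.Holds, Tm.val, setReg_reg, hs₂]]
    simp [hs₂, setReg_reg, r33]
  obtain ⟨s₄, hs₄⟩ : ∃ σ, σ = (loop 30 0 (.store 2 (.reg 30)
    (.ite (.reg 34) (.arr 5 (.reg 30)) (.arr 2 (.reg 30))))).run s₃ := ⟨_, rfl⟩
  obtain ⟨g2, -⟩ := run_loop_store (x := 30) (p := 0) (a := 2) (e := .reg 30)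
    (f := .ite (.reg 34) (.arr 5 (.reg 30)) (.arr 2 (.reg 30))) (s := s₃) (fun v => v)
    (fun v => if s₃.reg 34 ≠ 0 then s₁.arr 5 v else s.arr 2 v) h₃.n (fun i _ l _ h => h)
    (fun v hv τ a1 a3 a4 a5 => by
      refine ⟨a3, ?_⟩
      have e5 : τ.arr 5 = s₁.arr 5 := by rw [a4 5 (by omega), hs₃, hs₂]; rfl
      have e2 : τ.arr 2 v = s.arr 2 v := by rw [a5, hs₃, hs₂, ← a2]; rfl
      rw [Tm.val_ite]
      refine if_congr (by rw [Tm.Holds, Tm.val_reg, a1 34 (by omega)]) ?_ ?_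
      · rw [Tm.val, Tm.val_reg, a3, e5]
      · rw [Tm.val, Tm.val_reg, a3, e2])
  rw [← hs₄] at g2
  have hrun : update.run s = s₄.setReg 33 (if s₃.reg 34 ≠ 0 then I.numSat S + 1 else s.reg 33) := by
    have e38 : (Tm.add .numSat (.const 1)).val s₁ = I.numSat S + 1 := by
      rw [Tm.val_add, hnum, Tm.val_const]
    have f34 : s₄.reg 34 = s₃.reg 34 := by rw [hs₄]; exact run_reg (by rfl) _
    have f38 : s₄.reg 38 = I.numSat S + 1 := by
      rw [hs₄, run_reg (by rfl), hs₃, hs₂]; simp [setReg_reg]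
    have f33 : s₄.reg 33 = s.reg 33 := by
      rw [hs₄, run_reg (by rfl), hs₃, hs₂]; simp [setReg_reg, r33]
    simp only [update, run_seq, run_assign, ← hs₁, e38, ← hs₂, ← hs₃, ← hs₄]
    rw [Tm.val_ite]
    simp only [Tm.Holds, Tm.val_reg, f34, f38, f33]
  constructor
  · intro hc
    rw [hrun]
    have h34 := hb.2 hc
    refine ⟨by simp [setReg_reg, h34], fun v hv => ?_⟩
    rw [setReg_arr, g2 v hv, if_pos h34, g1 v hv]
  · intro hc
    rw [hrun]
    have h34 : s₃.reg 34 = 0 := by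
      by_contra h0
      exact hc (hb.1 h0)
    refine ⟨by simp [setReg_reg, h34], fun v hv => ?_⟩
    rw [setReg_arr, g2 v hv, if_neg (by simpa using h34)]

/-- The search through all advice ends with the best assignment of weight `k` that is found. -/
theorem run_main (hI : I.Pos) (h : Env I s) (h33 : s.reg 33 = 0) :
    ((main.run s).reg 33 = 0 ∨ (cnt I.n (fun v => (main.run s).arr 2 v = 1) = I.k ∧
      I.numSat (fun v => (main.run s).arr 2 v = 1) + 1 = (main.run s).reg 33)) ∧
    ∀ z < I.Z, cnt I.n (I.found z) = I.k → I.numSat (I.found z) < (main.run s).reg 33 := by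
  classical
  obtain ⟨s₁, hs₁⟩ : ∃ σ, σ = s.setReg 37 I.mixed := ⟨_, rfl⟩
  have h₁ : Env I s₁ := by rw [hs₁]; exact h.setReg (by omega)
  obtain ⟨s₂, hs₂⟩ : ∃ σ, σ = (loop 30 0 (.store 4 (.reg 30) (.ind (.isHeavy 30)))).run s₁ :=
    ⟨_, rfl⟩
  obtain ⟨g1, -⟩ := run_loop_ind (x := 30) (p := 0) (a := 4) (e := .reg 30) (f := .isHeavy 30)
    (s := s₁) (fun v => v) I.Heavy h₁.n (fun i _ l _ h => h)
    (fun v hv τ a1 a2 a3 a4 => by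
      have hτ : Env I τ := h₁.congr (fun y hy => a1 y (by omega)) (a3 0 (by omega))
        (a3 1 (by omega))
      refine ⟨a2, ?_⟩
      rw [Tm.holds_isHeavy hτ (by rw [a1 37 (by omega), hs₁]; simp [setReg_reg]) (by decide), a2])
  rw [← hs₂] at g1
  have h₂ : HEnv I s₂ := by
    refine ⟨h₁.congr (fun y hy => ?_) ?_ ?_, fun v hv => ?_⟩
    · rw [hs₂]; exact run_reg (sets_eq_false_of_lt (b := 13) (r₀ := 100) (by rfl) hy) _
    · rw [hs₂]; exact run_arr (by rfl) _
    · rw [hs₂]; exact run_arr (by rfl) _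
    · rw [g1 v hv]; simp
  have r33 : s₂.reg 33 = 0 := by rw [hs₂, run_reg (by rfl), hs₁]; simp [setReg_reg, h33]
  have hrun : main.run s = (loop 32 12 (.seq init (.seq (.loop 31 9 step) update))).run s₂ := by
    simp only [main, run_seq, run_assign, Tm.val_mixed h, ← hs₁, ← hs₂]
  rw [hrun, run, h₂.Z]
  have key := iterate_induction (n := I.Z) (s := s₂)
    (f := fun i σ => (seq init (seq (loop 31 9 step) update)).run (σ.setReg 32 i))
    (fun M σ => HEnv I σ ∧
      (σ.reg 33 = 0 ∨ (cnt I.n (fun v => σ.arr 2 v = 1) = I.k ∧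
        I.numSat (fun v => σ.arr 2 v = 1) + 1 = σ.reg 33)) ∧
      ∀ z < M, cnt I.n (I.found z) = I.k → I.numSat (I.found z) < σ.reg 33)
    ⟨h₂, Or.inl r33, by simp⟩ (by
      rintro M hM σ ⟨q1, q2, q3⟩
      have q1' : HEnv I (σ.setReg 32 M) := q1.setReg (by omega)
      have e32 : (σ.setReg 32 M).reg 32 = M := by simp [setReg_reg]
      obtain ⟨i1, i2, i3⟩ := run_init q1' (by rwa [e32])
      rw [e32] at i2 i3
      obtain ⟨j1, j2⟩ := run_steps hI i1 (by
        rw [i2]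
        exact (Nat.div_le_self _ _).trans_lt hM)
      rw [i2, i3] at j2
      simp only [run_seq]
      obtain ⟨τ, hτ⟩ : ∃ τ, τ = (loop 31 9 step).run (init.run (σ.setReg 32 M)) := ⟨_, rfl⟩
      have f33 : τ.reg 33 = σ.reg 33 := by
        rw [hτ, run_reg (by rfl), run_reg (by rfl)]; simp [setReg_reg]
      have f2 : τ.arr 2 = σ.arr 2 := by
        rw [hτ, run_arr (by rfl), run_arr (by rfl)]; rfl
      rw [← hτ] at j1 j2 ⊢
      obtain ⟨k1, k2⟩ := run_update j1
      have hfound : I.Final (slots I τ) = I.found M := by rw [j2]; rfl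
      rw [hfound, f33] at k1 k2
      refine ⟨j1.run (by rfl) (by rfl) (by rfl) (by rfl), ?_⟩
      by_cases hc : cnt I.n (I.found M) = I.k ∧ σ.reg 33 < I.numSat (I.found M) + 1
      · obtain ⟨l1, l2⟩ := k1 hc
        have heq : ∀ v < I.n, (update.run τ).arr 2 v = 1 ↔ I.found M v := fun v hv => by
          rw [l2 v hv]; simp
        rw [l1, cnt_congr heq, Inst.numSat_congr heq]
        refine ⟨Or.inr ⟨hc.1, rfl⟩, fun z hz hz' => ?_⟩
        rcases Nat.lt_succ_iff_lt_or_eq.1 hz with hz | rfl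
        · have := q3 z hz hz'
          omega
        · omega
      · obtain ⟨l1, l2⟩ := k2 hc
        have heq : ∀ v < I.n, (update.run τ).arr 2 v = 1 ↔ σ.arr 2 v = 1 := fun v hv => by
          rw [l2 v hv, f2]
        rw [l1, cnt_congr heq, Inst.numSat_congr heq]
        refine ⟨q2, fun z hz hz' => ?_⟩
        rcases Nat.lt_succ_iff_lt_or_eq.1 hz with hz | rfl
        · exact q3 z hz hz'
        · by_contra hlt
          exact hc ⟨hz', by omega⟩)
  exact key.2

end Cmd

/-! ### The parameters and the range of the advice -/

/-- A term has the value `v` in every state that differs from `s` at most in the register `99` and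
in the arrays. -/
def Tm.HasVal (e : Tm) (s : State) (v : ℕ) : Prop :=
  ∀ s' : State, (∀ y ≠ 99, s'.reg y = s.reg y) → e.val s' = v

namespace Tm.HasVal

variable {e f : Tm} {u v : ℕ}

theorem const (c : ℕ) : (Tm.const c).HasVal s c := fun _ _ => rfl

theorem reg {x : ℕ} (hx : x ≠ 99) (h : s.reg x = v) : (Tm.reg x).HasVal s v :=
  fun _ hs => (hs x hx).trans h

theorem add (he : e.HasVal s u) (hf : f.HasVal s v) : (Tm.add e f).HasVal s (u + v) :=
  fun s' hs => by rw [val_add, he s' hs, hf s' hs]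

theorem mul {p : ℕ} (hp : p ≠ 99) (hu : s.reg p = u) (he : e.HasVal s v) :
    (Tm.mul p e).HasVal s (u * v) := fun s' hs => by
  rw [val_mul fun i => he (s'.setReg 99 i) fun y hy => by simp [setReg_reg, hy, hs y hy],
    hs p hp, hu]

theorem val (h : e.HasVal s v) : e.val s = v := h s fun _ _ => rfl

end Tm.HasVal

/-- The registers `0, …, 4` hold the numbers that define the instance `I`. -/
structure Params (I : Inst) (s : State) : Prop where
  n : s.reg 0 = I.n
  m : s.reg 1 = I.m
  k : s.reg 2 = I.k
  d : s.reg 3 = I.d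
  q : s.reg 4 = I.q

theorem Params.congr (h : Params I s) {s' : State} (hr : ∀ y < 5, s'.reg y = s.reg y) :
    Params I s' := by
  obtain ⟨n, m, k, d, q⟩ := h
  constructor <;> (rw [hr _ (by omega)]; assumption)

theorem Tm.HasVal.timesG {e : Tm} {v : ℕ} (h : Params I s) (he : e.HasVal s v) :
    (Cmd.timesG e).HasVal s (I.G * v) := by
  have h2 := he.add he
  have h4 := h2.add h2
  have h8 := h4.add h4
  have hv : I.G * v = I.d * (I.k * (I.k * (I.q * (v + v + (v + v) + (v + v + (v + v)))))) := by
    simp only [Inst.G, Inst.κ]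
    ring
  rw [hv]
  exact (((h8.mul (by decide) h.q).mul (by decide) h.k).mul (by decide) h.k).mul (by decide) h.d

namespace Cmd

/-- A loop that replaces the register `y` by terms whose value is `a` times its content. -/
theorem run_loop_mul {x p y a N : ℕ} {e : Tm} (hN : s.reg p = N) (hxy : x ≠ y)
    (he : ∀ σ v, (∀ z, z ≠ x → z ≠ y → σ.reg z = s.reg z) → σ.reg y = v → e.val σ = a * v) :
    (∀ z, z ≠ x → z ≠ y → ((loop x p (.assign y e)).run s).reg z = s.reg z) ∧
      ((loop x p (.assign y e)).run s).reg y = a ^ N * s.reg y := by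
  rw [run, hN]
  refine iterate_induction (fun M (σ : State) => (∀ z, z ≠ x → z ≠ y → σ.reg z = s.reg z) ∧
    σ.reg y = a ^ M * s.reg y) ⟨fun _ _ _ => rfl, by simp⟩ ?_
  rintro M - σ ⟨h1, h2⟩
  rw [run_assign]
  refine ⟨fun z hzx hzy => by simp [setReg_reg, hzx, hzy, h1 z hzx hzy], ?_⟩
  rw [setReg_reg, if_pos rfl, he (σ.setReg x M) (a ^ M * s.reg y)
    (fun z hzx hzy => by simp [setReg_reg, hzx, h1 z hzx hzy])
    (by simp [setReg_reg, hxy.symm, h2])]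
  ring

theorem run_prelude (h : Params I s)
    (hpos : ∀ j v, s.arr 0 (j * I.n + v) ≠ 0 ↔ I.pos j v)
    (hneg : ∀ j v, s.arr 1 (j * I.n + v) ≠ 0 ↔ I.neg j v) : Env I (prelude.run s) := by
  have five {c : Cmd} (hc : c.WF 5 100) (σ : State) : ∀ y < 5, (c.run σ).reg y = σ.reg y :=
    fun y hy => run_reg (sets_eq_false_of_lt hc hy) σ
  -- the parameters that are computed without loops
  obtain ⟨s₁, hs₁⟩ : ∃ σ, σ = ((((((s.setReg 5 I.κ).setReg 6 I.G).setReg 7 I.Q).setReg 9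
    (I.k * (I.d + 1))).setReg 10 4).setReg 11 (I.k + 1)).setReg 8 1 := ⟨_, rfl⟩
  have h₁ : Params I s₁ := h.congr fun y hy => by
    rw [hs₁]; simp only [setReg_reg]; repeat rw [if_neg (by omega)]
  have hκ : ∀ σ, Params I σ → (Tm.mul 2 (.mul 2 (.mul 4 (.const 2)))).val σ = I.κ := fun σ hσ => by
    rw [((((Tm.HasVal.const 2).mul (by decide) hσ.q).mul (by decide) hσ.k).mul
      (by decide) hσ.k).val]
    simp only [Inst.κ]; ring
  have hG : ∀ σ, Params I σ → (timesG (.const 1)).val σ = I.G := fun σ hσ => by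
    rw [((Tm.HasVal.const 1).timesG hσ).val, mul_one]
  have hQ : ∀ σ, Params I σ → (Tm.mul 2 (.mul 4 (.const 4))).val σ = I.Q := fun σ hσ => by
    rw [(((Tm.HasVal.const 4).mul (by decide) hσ.q).mul (by decide) hσ.k).val]
    simp only [Inst.Q]; ring
  have hN : ∀ σ, Params I σ → (Tm.mul 2 (.add (.reg 3) (.const 1))).val σ = I.k * (I.d + 1) :=
    fun σ hσ => (((Tm.HasVal.reg (by decide) hσ.d).add (.const 1)).mul (by decide) hσ.k).val
  have upd : ∀ {σ : State} {x v : ℕ}, 5 ≤ x → Params I σ → Params I (σ.setReg x v) :=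
    fun hx hσ => hσ.congr fun y hy => by rw [setReg_reg, if_neg (by omega)]
  obtain ⟨s₂, hs₂⟩ : ∃ σ, σ = (loop 98 3 (.assign 8 (timesG (.reg 8)))).run s₁ := ⟨_, rfl⟩
  obtain ⟨s₃, hs₃⟩ : ∃ σ, σ = s₂.setReg 12 I.G := ⟨_, rfl⟩
  have h₂ : Params I s₂ := by rw [hs₂]; exact h₁.congr (five (by rfl) _)
  have h₃ : Params I s₃ := by rw [hs₃]; exact upd (by omega) h₂
  have hrun : prelude.run s = (loop 97 2 (.seq (loop 98 3 (.assign 12 (timesG (timesG (timesG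
      (.reg 12)))))) (.assign 12 (timesG (timesG (.reg 12)))))).run s₃ := by
    have p1 := upd (x := 5) (v := I.κ) (by omega) h
    have p2 := upd (x := 6) (v := I.G) (by omega) p1
    have p3 := upd (x := 7) (v := I.Q) (by omega) p2
    have p4 := upd (x := 9) (v := I.k * (I.d + 1)) (by omega) p3
    have p5 := upd (x := 10) (v := 4) (by omega) p4
    simp only [prelude, run_seq, run_assign, hκ s h, hG _ p1, hQ _ p2, hN _ p3, Tm.val_const,
      Tm.val_add, Tm.val_reg, p5.k, ← hs₁, ← hs₂, hG _ h₂, ← hs₃]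
  obtain ⟨b1, b2⟩ := run_loop_mul (s := s₁) (x := 98) (p := 3) (y := 8) (a := I.G) (N := I.d)
    (e := timesG (.reg 8)) h₁.d (by omega) (fun σ v hσ hv =>
      ((Tm.HasVal.reg (by decide) hv).timesG
        (h₁.congr fun y hy => hσ y (by omega) (by omega))).val)
  rw [← hs₂] at b1 b2
  rw [show s₁.reg 8 = 1 by simp [hs₁, setReg_reg], mul_one] at b2
  have hloop : (∀ z, z ≠ 97 → z ≠ 98 → z ≠ 12 → (prelude.run s).reg z = s₃.reg z) ∧
      (prelude.run s).reg 12 = (I.G ^ (3 * I.d + 2)) ^ I.k * I.G := by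
    rw [hrun, run, h₃.k]
    refine iterate_induction (fun M (σ : State) => (∀ z, z ≠ 97 → z ≠ 98 → z ≠ 12 →
      σ.reg z = s₃.reg z) ∧ σ.reg 12 = (I.G ^ (3 * I.d + 2)) ^ M * I.G)
      ⟨fun _ _ _ _ => rfl, by simp [hs₃, setReg_reg]⟩ ?_
    rintro M - σ ⟨g1, g2⟩
    have hσ : Params I (σ.setReg 97 M) := upd (by omega) (h₃.congr fun y hy =>
      g1 y (by omega) (by omega) (by omega))
    obtain ⟨c1, c2⟩ := run_loop_mul (s := σ.setReg 97 M) (x := 98) (p := 3) (y := 12)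
      (a := I.G * (I.G * I.G)) (N := I.d) (e := timesG (timesG (timesG (.reg 12)))) hσ.d (by omega)
      (fun τ v hτ hv => by
        have hτ' : Params I τ := hσ.congr fun y hy => hτ y (by omega) (by omega)
        rw [((((Tm.HasVal.reg (by decide) hv).timesG hτ').timesG hτ').timesG hτ').val]
        ring)
    rw [run_seq, run_assign]
    set τ := (loop 98 3 (.assign 12 (timesG (timesG (timesG (.reg 12)))))).run (σ.setReg 97 M)
    have hτ : Params I τ := hσ.congr fun y hy => c1 y (by omega) (by omega)
    refine ⟨fun z h97 h98 h12 => ?_, ?_⟩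
    · rw [setReg_reg, if_neg h12, c1 z h98 h12, setReg_reg, if_neg h97, g1 z h97 h98 h12]
    · rw [setReg_reg, if_pos rfl, (((Tm.HasVal.reg (by decide) c2).timesG hτ).timesG hτ).val,
        setReg_reg, if_neg (by decide), g2]
      ring
  have r : ∀ y, y ≠ 8 → y < 12 → (prelude.run s).reg y = s₁.reg y := fun y h8 h12 => by
    rw [hloop.1 y (by omega) (by omega) (by omega), hs₃, setReg_reg, if_neg (by omega),
      b1 y (by omega) h8]
  constructor
  · rw [r _ (by decide) (by decide), h₁.n]
  · rw [r _ (by decide) (by decide), h₁.m]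
  · rw [r _ (by decide) (by decide), h₁.k]
  · rw [r _ (by decide) (by decide), hs₁]; simp [setReg_reg]
  · rw [r _ (by decide) (by decide), hs₁]; simp [setReg_reg]
  · rw [r _ (by decide) (by decide), hs₁]; simp [setReg_reg]
  · rw [hloop.1 8 (by decide) (by decide) (by decide), hs₃, setReg_reg, if_neg (by decide), b2]
    rfl
  · rw [r _ (by decide) (by decide), hs₁]; simp [setReg_reg]
  · rw [r _ (by decide) (by decide), hs₁]; simp [setReg_reg]
  · rw [r _ (by decide) (by decide), hs₁]; simp [setReg_reg]
  · rw [hloop.2, Inst.Z]; ring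
  · rwa [run_arr (by rfl)]
  · rwa [run_arr (by rfl)]

end Cmd

namespace Inst

/-- The advice strings below `Z` contain those for a number `t ≤ k` of heavy slots followed by the
decisions of all steps. -/
theorem advice_lt_Z (hI : I.Pos) {t z : ℕ} (ht : t ≤ I.k)
    (hz : z < I.Rs ^ (I.k * (I.d + 1)) * I.Bc ^ I.k) : t + (I.k + 1) * z < I.Z := by
  have hk := hI.k
  have hd := hI.d
  have hq := hI.q
  have hkk : I.k * I.k ≤ I.k * I.k * (I.d * I.q) := Nat.le_mul_of_pos_right _ (Nat.mul_pos hd hq)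
  have hG : I.G = 8 * (I.k * I.k * (I.d * I.q)) := by simp only [G, κ]; ring
  have hkG : I.k + 1 ≤ I.G := by nlinarith
  have hR : I.Rs ≤ I.G ^ 2 := by
    have : I.Rs = 4 * (I.k * I.k) * I.G := by simp only [Rs]; ring
    rw [this, sq]
    exact Nat.mul_le_mul_right _ (by omega)
  calc t + (I.k + 1) * z < (I.k + 1) * (z + 1) := by rw [mul_add]; omega
    _ ≤ I.G * ((I.G ^ 2) ^ (I.k * (I.d + 1)) * I.Bc ^ I.k) :=
      Nat.mul_le_mul hkG (hz.trans_le (Nat.mul_le_mul_right _ (Nat.pow_le_pow_left hR _)))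
    _ = I.Z := by
      simp only [Z, Bc]
      rw [← pow_mul, ← pow_mul, ← pow_add, ← pow_succ']
      congr 1
      ring

/-- Some advice string leads to a solution of the desired quality. -/
theorem exists_found (hI : I.Pos) (hF : I.Free) {B : ℕ → Prop} (hB : cnt I.n B = I.k)
    (hopt : ∀ S, cnt I.n S = I.k → I.numSat S ≤ I.numSat B) :
    ∃ z < I.Z, cnt I.n (I.found z) = I.k ∧
      I.q * I.numSat B ≤ I.q * I.numSat (I.found z) + I.numSat B := by
  obtain ⟨t, ht, h⟩ := I.exists_good_advice hF hI.d hI.k hI.q hB hopt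
  obtain ⟨z, hz, h1, h2⟩ := h (I.initV t) fun i hi v => by simp [initV, hi]
  have e1 : (t + (I.k + 1) * z) % (I.k + 1) = t := by
    rw [Nat.add_mul_mod_self_left, Nat.mod_eq_of_lt (by omega)]
  have e2 : (t + (I.k + 1) * z) / (I.k + 1) = z := by
    rw [Nat.add_mul_div_left _ _ (by omega), Nat.div_eq_of_lt (by omega), zero_add]
  refine ⟨t + (I.k + 1) * z, advice_lt_Z hI ht hz, ?_⟩
  rw [found, e1, e2]
  exact ⟨h1, h2⟩

end Inst

/-! ### The machine -/

namespace RAM.Prog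

/-- Replace the contents `a` and `b` of the registers `4` and `5` by the rounded up quotient `b / a`
and by `0`. -/
def quotient : Prog :=
  .seq (.const 100 0) <| .seq (.const 101 1) <|
  .seq (.loop 5 (.seq (.sub 5 5 4) (.add 100 100 101))) <|
  .seq (.const 102 0) (.add 4 100 102)

theorem exec_quotient_loop (ω : ℕ → Bool) {a : ℕ} (q : ℕ) : ∀ (b : ℕ) (s : State), s.reg 4 = a →
    s.reg 5 = b → s.reg 101 = 1 → b ≤ q * a → q * a < b + a →
    Exec ω (.loop 5 (.seq (.sub 5 5 4) (.add 100 100 101))) s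
      ((s.setReg 5 0).setReg 100 (s.reg 100 + q)) (3 * q + 1) := by
  induction q with
  | zero =>
    intro b s h4 h5 h101 h1 h2
    have hb : b = 0 := by omega
    convert Exec.loop_false (ω := ω) (p := .seq (.sub 5 5 4) (.add 100 100 101)) (h5.trans hb)
      using 1
    have e1 : update s.reg 5 0 = s.reg := by rw [← hb, ← h5, update_eq_self]
    simp only [State.setReg, e1, add_zero, update_eq_self]
  | succ q ih =>
    intro b s h4 h5 h101 h1 h2
    rw [add_mul, one_mul] at h1 h2
    have key := ih (b - a) ((s.setReg 5 (b - a)).setReg 100 (s.reg 100 + 1))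
      (by simp [setReg_reg, h4]) (by simp [setReg_reg]) (by simp [setReg_reg, h101])
      (by omega) (by
        rcases le_total a b with h | h
        · omega
        · have : q = 0 := by
            by_contra hq
            have := Nat.le_mul_of_pos_left a (Nat.pos_of_ne_zero hq)
            omega
          subst this
          omega)
    have hfin : (((s.setReg 5 (b - a)).setReg 100 (s.reg 100 + 1)).setReg 5 0).setReg 100
        (((s.setReg 5 (b - a)).setReg 100 (s.reg 100 + 1)).reg 100 + q) =
        (s.setReg 5 0).setReg 100 (s.reg 100 + (q + 1)) := by
      simp only [State.setReg, State.mk.injEq, and_true]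
      funext y
      simp only [update_apply]
      split_ifs <;> omega
    rw [hfin] at key
    rw [show 3 * (q + 1) + 1 = (1 + 1) + (3 * q + 1) + 1 by omega]
    refine .loop_true (by omega) (.seq (.sub ..) ?_) key
    convert Exec.add 100 100 101 (s.setReg 5 (b - a)) using 1
    · rw [h4, h5]
    · simp [setReg_reg, h101]

theorem exec_quotient (ω : ℕ → Bool) {a b q : ℕ} (s : State) (h4 : s.reg 4 = a) (h5 : s.reg 5 = b)
    (h1 : b ≤ q * a) (h2 : q * a < b + a) :
    ∃ s', Exec ω quotient s s' (3 * q + 5) ∧ Cmd.Agree 100 s' ((s.setReg 4 q).setReg 5 0) := by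
  have key := exec_quotient_loop ω q b ((s.setReg 100 0).setReg 101 1) (by simp [setReg_reg, h4])
    (by simp [setReg_reg, h5]) (by simp [setReg_reg]) h1 h2
  rw [show 3 * q + 5 = 1 + (1 + ((3 * q + 1) + (1 + 1))) by omega]
  refine ⟨_, .seq (.const ..) (.seq (.const ..) (.seq key (.seq (.const ..) (.add ..)))), ?_,
    rfl, rfl⟩
  intro y hy
  have h100 : y ≠ 100 := by omega
  have h101 : y ≠ 101 := by omega
  have h102 : y ≠ 102 := by omega
  by_cases h4 : y = 4 <;> by_cases h5 : y = 5 <;> simp_all [setReg_reg]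

/-- The deterministic program that solves the problem. -/
def solver : Prog := .seq quotient (.seq (Cmd.prelude.compile 100) (Cmd.main.compile 100))

end RAM.Prog

namespace Inst

theorem G_le_Z (hI : I.Pos) {N : ℕ} (hN : N ≤ 1 + I.k * (3 * I.d + 2)) : I.G ^ N ≤ I.Z :=
  Nat.pow_le_pow_right hI.G hN

end Inst

theorem Env.reg_le (hI : I.Pos) (h : Env I s) (h' : Params I s) :
    ∀ p < 13, s.reg p ≤ I.n + I.m + I.Z := by
  have hk := hI.k
  have hd := hI.d
  have hq := hI.q
  have hZ : I.G ≤ I.Z := by simpa using Inst.G_le_Z hI (N := 1) (by omega)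
  have hBc : I.Bc ≤ I.Z := Inst.G_le_Z hI (by nlinarith)
  have hG : I.G = 8 * (I.k * I.k * (I.d * I.q)) := by simp only [Inst.G, Inst.κ]; ring
  have hkd := Nat.le_mul_of_pos_right I.k hd
  have hkk := Nat.mul_pos hk hk
  have hdq := Nat.mul_pos hd hq
  have g0 : 8 ≤ I.G := by nlinarith
  have g1 : I.k ≤ I.k * I.k * (I.d * I.q) := by nlinarith
  have g2 : I.d ≤ I.k * I.k * (I.d * I.q) := by
    nlinarith [Nat.le_mul_of_pos_right I.d hq, Nat.le_mul_of_pos_left (I.d * I.q) hkk]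
  have g3 : I.k * I.d ≤ I.k * I.k * (I.d * I.q) := by
    calc I.k * I.d ≤ (I.k * I.d) * (I.k * I.q) := Nat.le_mul_of_pos_right _ (Nat.mul_pos hk hq)
      _ = _ := by ring
  have g4 : I.k * I.q ≤ I.k * I.k * (I.d * I.q) := by
    calc I.k * I.q ≤ (I.k * I.q) * (I.k * I.d) := Nat.le_mul_of_pos_right _ (Nat.mul_pos hk hd)
      _ = _ := by ring
  have g8 : I.q ≤ I.k * I.q := Nat.le_mul_of_pos_left _ hk
  have g5 : I.κ ≤ I.G := Nat.le_mul_of_pos_left _ (by omega)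
  have g6 : I.Q ≤ I.G := by
    rw [hG, Inst.Q, mul_assoc]
    omega
  have g7 : I.k * (I.d + 1) ≤ I.G := by rw [hG, mul_add]; omega
  intro p hp
  interval_cases p
  · rw [h.n]; omega
  · rw [h.m]; omega
  · rw [h.k]; omega
  · rw [h'.d]; omega
  · rw [h'.q]; omega
  · rw [h.κ]; omega
  · rw [h.G]; omega
  · rw [h.Q]; omega
  · rw [h.Bc]; omega
  · rw [h.N]; omega
  · rw [h.four]; omega
  · rw [h.succ_k]; omega
  · rw [h.Z]; omega

namespace RAM.Prog

/-- The running time of the solver is polynomial in the number of advice strings and the size of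
the input. -/
theorem exists_cost_le : ∃ D, ∀ M, 3 * M + 5 + (Cmd.prelude.cost M + Cmd.main.cost M) ≤
    D * (M + 1) ^ D := by
  obtain ⟨D₁, h₁⟩ := Cmd.prelude.exists_cost_le
  obtain ⟨D₂, h₂⟩ := Cmd.main.exists_cost_le
  refine ⟨D₁ + D₂ + 5, fun M => ?_⟩
  have e1 := h₁ M
  have e2 := h₂ M
  have p1 := Nat.mul_le_mul_left D₁
    (Nat.pow_le_pow_right (Nat.succ_pos M) (show D₁ ≤ D₁ + D₂ + 5 by omega))
  have p2 := Nat.mul_le_mul_left D₂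
    (Nat.pow_le_pow_right (Nat.succ_pos M) (show D₂ ≤ D₁ + D₂ + 5 by omega))
  have p3 := Nat.pow_le_pow_right (Nat.succ_pos M) (show 1 ≤ D₁ + D₂ + 5 by omega)
  simp only [Nat.succ_eq_add_one, pow_one] at p1 p2 p3
  rw [add_mul, add_mul]
  omega

theorem exec_solver (ω : ℕ → Bool) (hI : I.Pos) (hF : I.Free) {a b : ℕ} (h0 : s.reg 0 = I.n)
    (h1 : s.reg 1 = I.m) (h2 : s.reg 2 = I.k) (h3 : s.reg 3 = I.d) (h4 : s.reg 4 = a)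
    (h5 : s.reg 5 = b) (hq₁ : b ≤ I.q * a) (hq₂ : I.q * a < b + a) (h33 : s.reg 33 = 0)
    (hpos : ∀ j v, s.arr 0 (j * I.n + v) ≠ 0 ↔ I.pos j v)
    (hneg : ∀ j v, s.arr 1 (j * I.n + v) ≠ 0 ↔ I.neg j v) {B : ℕ → Prop} (hB : cnt I.n B = I.k)
    (hopt : ∀ S, cnt I.n S = I.k → I.numSat S ≤ I.numSat B) :
    ∃ s' t, Exec ω solver s s' t ∧
      t ≤ 3 * (I.n + I.m + I.Z) + 5 +
        (Cmd.prelude.cost (I.n + I.m + I.Z) + Cmd.main.cost (I.n + I.m + I.Z)) ∧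
      cnt I.n (fun v => s'.arr 2 v = 1) = I.k ∧
      I.q * I.numSat B ≤ I.q * I.numSat (fun v => s'.arr 2 v = 1) + I.numSat B := by
  obtain ⟨s₁, hex₁, hs₁⟩ := exec_quotient ω s h4 h5 hq₁ hq₂
  set σ := (s.setReg 4 I.q).setReg 5 0
  have hσ : Params I σ := by constructor <;> simp [σ, setReg_reg, *]
  have hE := Cmd.run_prelude hσ hpos hneg
  have hP : Params I (Cmd.prelude.run σ) := hσ.congr fun y hy =>
    Cmd.run_reg (Cmd.sets_eq_false_of_lt (r₀ := 100) (b := 5) (by rfl) hy) _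
  have hle := hE.reg_le hI hP
  set M := I.n + I.m + I.Z
  obtain ⟨s₂, t₂, hex₂, hs₂, -, ht₂⟩ := Cmd.exec_compile ω (b := 5) (r₀ := 100) M (by omega)
    Cmd.prelude (by rfl) 100 le_rfl s₁ σ hs₁ fun p hp => by
      rw [hs₁.reg p (by omega), ← Cmd.run_reg (c := Cmd.prelude)
        (Cmd.sets_eq_false_of_lt (r₀ := 100) (b := 5) (by rfl) hp) σ]
      exact hle p (by omega)
  obtain ⟨s₃, t₃, hex₃, hs₃, -, ht₃⟩ := Cmd.exec_compile ω (b := 13) (r₀ := 100) M (by omega)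
    Cmd.main (by rfl) 100 le_rfl s₂ _ hs₂ fun p hp => by
      rw [hs₂.reg p (by omega)]
      exact hle p hp
  have hq : I.q ≤ M := by
    have := hle 4 (by omega)
    rwa [hP.q] at this
  obtain ⟨hout, hbest⟩ := Cmd.run_main hI hE (by
    rw [Cmd.run_reg (by rfl)]
    simp [σ, setReg_reg, h33])
  obtain ⟨z, hz, hz₁, hz₂⟩ := Inst.exists_found hI hF hB hopt
  have hlt := hbest z hz hz₁
  refine ⟨s₃, _, .seq hex₁ (.seq hex₂ hex₃), by omega, ?_⟩
  rw [hs₃.arr]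
  rcases hout with h | ⟨g1, g2⟩
  · omega
  · refine ⟨g1, hz₂.trans ?_⟩
    have := Nat.mul_le_mul_left I.q (show I.numSat (I.found z) ≤
      I.numSat (fun v => (Cmd.main.run (Cmd.prelude.run σ)).arr 2 v = 1) by omega)
    omega

end RAM.Prog

/-- The number of advice strings in terms of `X = d k / ε`. -/
theorem Inst.Z_le (hI : I.Pos) {X ε : ℝ} (hε : 0 < ε) (hε1 : ε ≤ 1) (hX : X = I.d * I.k / ε)
    (hq : I.q * ε < 1 + ε) : (I.Z : ℝ) ≤ 2 ^ 24 * X ^ (60 * (I.d * I.k)) := by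
  have hk := hI.k
  have hd := hI.d
  have hdk : 1 ≤ I.d * I.k := Nat.mul_pos hd hk
  have hk' : (1 : ℝ) ≤ I.k := by exact_mod_cast hk
  have hd' : (1 : ℝ) ≤ I.d := by exact_mod_cast hd
  have hq' : (1 : ℝ) ≤ I.q := by exact_mod_cast hI.q
  have hdk' : (1 : ℝ) ≤ I.d * I.k := by exact_mod_cast hdk
  have hXε : X * ε = I.d * I.k := by rw [hX]; field_simp
  have hdkX : (I.d * I.k : ℝ) ≤ X := by nlinarith
  have hZ : (I.Z : ℝ) ≤ (I.G : ℝ) ^ (6 * (I.d * I.k)) := by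
    rw [Inst.Z, Nat.cast_pow]
    exact pow_le_pow_right₀ (by exact_mod_cast hI.G) (by nlinarith)
  have hG : (I.G : ℝ) = 8 * I.d * I.k ^ 2 * I.q := by
    simp only [Inst.G, Inst.κ]
    push_cast
    ring
  rcases le_or_gt 2 X with h2 | h2
  · have hqX : I.d * I.k * (I.q : ℝ) ≤ 2 * X := by
      have : I.q * ε ≤ 2 := by linarith
      calc I.d * I.k * (I.q : ℝ) = X * (I.q * ε) := by rw [← hXε]; ring
        _ ≤ X * 2 := mul_le_mul_of_nonneg_left this (by linarith)
        _ = 2 * X := by ring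
    have hGX : (I.G : ℝ) ≤ X ^ 10 := by
      have hkX : (I.k : ℝ) ≤ X := by nlinarith
      calc (I.G : ℝ) = 8 * I.k * (I.d * I.k * I.q) := by rw [hG]; ring
        _ ≤ 8 * X * (2 * X) := by gcongr
        _ = 2 ^ 4 * X ^ 2 := by ring
        _ ≤ X ^ 4 * X ^ 2 := by gcongr
        _ = X ^ 6 := by ring
        _ ≤ X ^ 10 := pow_le_pow_right₀ (by linarith) (by norm_num)
    calc (I.Z : ℝ) ≤ (X ^ 10) ^ (6 * (I.d * I.k)) :=
          hZ.trans (pow_le_pow_left₀ (by positivity) hGX _)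
      _ = X ^ (60 * (I.d * I.k)) := by rw [← pow_mul]; congr 1; ring
      _ ≤ 2 ^ 24 * X ^ (60 * (I.d * I.k)) := le_mul_of_one_le_left (by positivity) (by norm_num)
  · -- here `d = k = 1` and `q ≤ 2`
    have h1 : I.d * I.k < 2 := by exact_mod_cast hdkX.trans_lt h2
    have hk1 : I.k = 1 := by nlinarith
    have hd1 : I.d = 1 := by nlinarith
    have hX1 : X * ε = 1 := by rw [hXε, hk1, hd1]; norm_num
    have hq3 : (I.q : ℝ) < 3 := by nlinarith
    have hq2 : (I.q : ℝ) ≤ 2 := by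
      have : I.q < 3 := by exact_mod_cast hq3
      exact_mod_cast (show I.q ≤ 2 by omega)
    have hG16 : (I.G : ℝ) ≤ 16 := by rw [hG, hk1, hd1]; push_cast; linarith
    calc (I.Z : ℝ) ≤ 16 ^ (6 * (I.d * I.k)) := hZ.trans (pow_le_pow_left₀ (by positivity) hG16 _)
      _ = 2 ^ 24 := by rw [hk1, hd1]; norm_num
      _ ≤ 2 ^ 24 * X ^ (60 * (I.d * I.k)) :=
        le_mul_of_one_le_right (by norm_num) (one_le_pow₀ (by linarith))

/-! ### Formulas as instances -/

theorem cnt_eq_card_fin (N : ℕ) (A : ℕ → Prop) [DecidablePred A] :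
    cnt N A = (univ.filter fun i : Fin N => A i).card := by
  rw [cnt_eq_card, card_filter, card_filter,
    ← Fin.sum_univ_eq_sum_range (fun i => if A i then 1 else 0)]

namespace CNFFormula

variable {n m : ℕ} (Φ : CNFFormula n m) (k d : ℕ) (ε : ℚ)

/-- The instance that the machine reads off its input, with `q` the rounded up value of `1 / ε`. -/
def inst : Inst where
  n := n
  m := m
  k := k
  d := d
  q := (ε.den + ε.num.toNat - 1) / ε.num.toNat
  pos j v := (input Φ k d ε).arr 0 (j * n + v) ≠ 0
  neg j v := (input Φ k d ε).arr 1 (j * n + v) ≠ 0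

theorem inst_pos (j : Fin m) (i : Fin n) : (Φ.inst k d ε).pos j i ↔ (i, true) ∈ Φ j := by
  simp only [inst, input]
  rw [ne_eq, ite_eq_right_iff]
  simp only [one_ne_zero, imp_false, not_not, true_and, zero_ne_one, false_and, or_false]
  constructor
  · rintro ⟨i', j', h, h'⟩
    obtain ⟨hj, hi⟩ := cell_inj i.2 i'.2 h
    rwa [Fin.ext hj, Fin.ext hi]
  · exact fun h => ⟨i, j, rfl, h⟩

theorem inst_neg (j : Fin m) (i : Fin n) : (Φ.inst k d ε).neg j i ↔ (i, false) ∈ Φ j := by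
  simp only [inst, input]
  rw [ne_eq, ite_eq_right_iff]
  simp only [one_ne_zero, imp_false, not_not, true_and, false_and, false_or]
  constructor
  · rintro ⟨i', j', h, h'⟩
    obtain ⟨hj, hi⟩ := cell_inj i.2 i'.2 h
    rwa [Fin.ext hj, Fin.ext hi]
  · exact fun h => ⟨i, j, rfl, h⟩

variable {d}

theorem BicliqueFree.inst {Φ : CNFFormula n m} (h : Φ.BicliqueFree d) : (Φ.inst k d ε).Free := by
  intro X Y hX hY hXd hYd hall
  let f : Fin d → Fin n := fun a => ⟨X.orderEmbOfFin hXd a, hX _ (X.orderEmbOfFin_mem hXd a)⟩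
  let g : Fin d → Fin m := fun a => ⟨Y.orderEmbOfFin hYd a, hY _ (Y.orderEmbOfFin_mem hYd a)⟩
  have hf : Injective f := fun a b hab => (X.orderEmbOfFin hXd).injective (congrArg Fin.val hab)
  have hg : Injective g := fun a b hab => (Y.orderEmbOfFin hYd).injective (congrArg Fin.val hab)
  have hadj : ∀ a b, (f a, true) ∈ Φ (g b) := fun a b => (Φ.inst_pos k d ε (g b) (f a)).1
    (hall _ (X.orderEmbOfFin_mem hXd a) _ (Y.orderEmbOfFin_mem hYd b))
  refine h ⟨⟨⟨Sum.map f g, ?_⟩, hf.sumMap hg⟩⟩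
  rintro (a | a) (b | b) hab
  · simp at hab
  · exact (SimpleGraph.fromRel_adj ..).2 ⟨by simp, Or.inl ⟨f a, g b, true, rfl, rfl, hadj a b⟩⟩
  · exact (SimpleGraph.fromRel_adj ..).2 ⟨by simp, Or.inr ⟨f b, g a, true, rfl, rfl, hadj b a⟩⟩
  · simp at hab

theorem cnt_eq_weight {S : ℕ → Prop} {β : Fin n → Bool} (h : ∀ i : Fin n, S i ↔ β i = true) :
    cnt n S = weight β := by
  classical
  rw [cnt_eq_card_fin, weight]
  simp only [h]

theorem inst_numSat {S : ℕ → Prop} {β : Fin n → Bool} (h : ∀ i : Fin n, S i ↔ β i = true) :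
    (Φ.inst k d ε).numSat S = Φ.numSat β := by
  classical
  refine (cnt_eq_card_fin m _).trans (congrArg card ?_)
  ext j
  rw [mem_filter, mem_filter]
  refine and_congr_right fun _ => ?_
  constructor
  · rintro ⟨v, hv, ⟨h1, h2⟩ | ⟨h1, h2⟩⟩
    · exact ⟨(⟨v, hv⟩, true), (Φ.inst_pos k d ε j ⟨v, hv⟩).1 h1, (h ⟨v, hv⟩).1 h2⟩
    · refine ⟨(⟨v, hv⟩, false), (Φ.inst_neg k d ε j ⟨v, hv⟩).1 h1, ?_⟩
      simpa using fun h' => h2 ((h ⟨v, hv⟩).2 h')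
  · rintro ⟨⟨i, b⟩, h1, h2⟩
    refine ⟨i, i.2, ?_⟩
    cases b
    · exact Or.inr ⟨(Φ.inst_neg k d ε j i).2 h1, fun h' => by simp [(h i).1 h'] at h2⟩
    · exact Or.inl ⟨(Φ.inst_pos k d ε j i).2 h1, (h i).2 h2⟩

theorem exists_optimal {k : ℕ} (hk : k ≤ n) : ∃ β : Fin n → Bool, weight β = k ∧
    ∀ β' : Fin n → Bool, weight β' = k → Φ.numSat β' ≤ Φ.numSat β := by
  obtain ⟨T, hT⟩ := exists_subset_card_eq (s := (univ : Finset (Fin n))) (n := k) (by simpa)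
  obtain ⟨β, hβ, hmax⟩ := exists_max_image (univ.filter fun β : Fin n → Bool => weight β = k)
    Φ.numSat ⟨fun i => decide (i ∈ T), mem_filter.2 ⟨mem_univ _, by simp [weight, hT]⟩⟩
  simp only [mem_filter, mem_univ, true_and] at hβ hmax
  exact ⟨β, hβ, hmax⟩

end CNFFormula

theorem isProbabilityMeasure_coinMeasure : MeasureTheory.IsProbabilityMeasure coinMeasure := by
  unfold coinMeasure
  infer_instance

theorem mainTheorem7 :
    ∃ (P : RAM.Prog) (C : ℕ),
      ∀ (n m k d : ℕ) (ε : ℚ) (Φ : CNFFormula n m),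
        1 ≤ k → k ≤ n → 1 ≤ d → 0 < ε → ε ≤ 1 → Φ.BicliqueFree d →
          (∀ ω : ℕ → Bool, ∃ (s : RAM.State) (t : ℕ),
            RAM.Exec ω P (RAM.input Φ k d ε) s t ∧
              (t : ℝ) ≤ C * ((d : ℝ) * k / ε) ^ (C * (d * k)) * ((n : ℝ) + m) ^ C) ∧
          1 - 1 / Real.exp 1 ≤
            RAM.coinMeasure.real {ω | ∃ (s : RAM.State) (t : ℕ),
              RAM.Exec ω P (RAM.input Φ k d ε) s t ∧
                Φ.IsApproxSolution k ε (RAM.output n s)} := by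
  obtain ⟨D, hD⟩ := RAM.Prog.exists_cost_le
  obtain ⟨C, hCD, hC⟩ : ∃ C : ℕ, 60 * D ≤ C ∧ D * (3 * 2 ^ 24) ^ D ≤ C :=
    ⟨60 * D + D * (3 * 2 ^ 24) ^ D, by omega, by omega⟩
  refine ⟨RAM.Prog.solver, C, fun n m k d ε Φ hk hkn hd hε hε1 hfree => ?_⟩
  set I := Φ.inst k d ε with hIdef
  set a := ε.num.toNat with ha
  set b := ε.den with hb
  have ha1 : 1 ≤ a := by
    have := Rat.num_pos.2 hε
    omega
  have hb1 : 1 ≤ b := ε.den_pos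
  have haε : (a : ℚ) = ε * b := by
    have h1 : ((ε.num.toNat : ℤ) : ℚ) = ε.num := by rw [Int.toNat_of_nonneg (Rat.num_pos.2 hε).le]
    rw [ha, hb, Rat.mul_den_eq_num, ← h1]
    norm_cast
  have hIq : I.q = (b + a - 1) / a := rfl
  have hq₁ : b ≤ I.q * a := by
    have := Nat.lt_div_mul_add (a := b + a - 1) (b := a) ha1
    rw [hIq]
    omega
  have hq₂ : I.q * a < b + a := by
    have := Nat.div_mul_le_self (b + a - 1) a
    rw [hIq]
    omega
  have hq : 1 ≤ I.q := Nat.one_le_iff_ne_zero.2 fun h => by rw [h] at hq₁; omega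
  have hb0 : (0 : ℚ) < b := by exact_mod_cast hb1
  have hqε : 1 ≤ (I.q : ℚ) * ε := by
    have h1 : (b : ℚ) ≤ I.q * a := by exact_mod_cast hq₁
    rw [haε] at h1
    nlinarith
  have hqε' : (I.q : ℚ) * ε < 1 + ε := by
    have h1 : (I.q * a : ℚ) < b + a := by exact_mod_cast hq₂
    rw [haε] at h1
    nlinarith
  have hI : I.Pos := ⟨hk, hd, hq⟩
  obtain ⟨β, hβ, hmax⟩ := Φ.exists_optimal hkn
  obtain ⟨B, hβS⟩ : ∃ B : ℕ → Prop, ∀ i : Fin n, B i ↔ β i = true :=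
    ⟨fun v => ∃ h : v < n, β ⟨v, h⟩ = true, fun i => ⟨fun ⟨_, h⟩ => h, fun h => ⟨i.2, h⟩⟩⟩
  -- what the program does, whatever the outcome of the coin tosses
  have key : ∀ ω, ∃ s t, RAM.Exec ω RAM.Prog.solver (RAM.input Φ k d ε) s t ∧
      (t : ℝ) ≤ C * ((d : ℝ) * k / ε) ^ (C * (d * k)) * ((n : ℝ) + m) ^ C ∧
      Φ.IsApproxSolution k ε (RAM.output n s) := by
    classical
    intro ω
    obtain ⟨s, t, hex, ht, hcnt, happ⟩ := RAM.Prog.exec_solver (I := I) (s := RAM.input Φ k d ε)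
      (a := a) (b := b) ω hI (hfree.inst k ε) rfl rfl rfl rfl rfl rfl hq₁ hq₂ rfl
      (fun _ _ => Iff.rfl) (fun _ _ => Iff.rfl) (B := B)
      ((CNFFormula.cnt_eq_weight hβS).trans hβ) (fun S hS => by
        have hS' : ∀ i : Fin n, S i ↔ (fun i : Fin n => decide (S i)) i = true := fun i => by simp
        rw [hIdef, Φ.inst_numSat k ε hβS, Φ.inst_numSat k ε hS']
        exact hmax _ ((CNFFormula.cnt_eq_weight hS').symm.trans hS))
    have hout : ∀ i : Fin n, s.arr 2 i = 1 ↔ RAM.output n s i = true := fun i => by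
      simp [RAM.output]
    rw [hIdef, Φ.inst_numSat k ε hβS, Φ.inst_numSat k ε hout, ← hIdef] at happ
    refine ⟨s, t, hex, ?_, (CNFFormula.cnt_eq_weight hout).symm.trans hcnt, fun β' hβ' => ?_⟩
    · set X : ℝ := (d : ℝ) * k / ε with hX
      have hεR : (0 : ℝ) < (ε : ℝ) := by exact_mod_cast hε
      have hεR1 : (ε : ℝ) ≤ 1 := by exact_mod_cast hε1
      have hZ : (I.Z : ℝ) ≤ 2 ^ 24 * X ^ (60 * (d * k)) :=
        Inst.Z_le hI hεR hεR1 hX (by exact_mod_cast hqε')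
      have hX1 : 1 ≤ X := by
        rw [hX, le_div_iff₀ hεR]
        have : (1 : ℝ) ≤ d * k := by exact_mod_cast Nat.mul_pos hd hk
        linarith
      have hN : (1 : ℝ) ≤ (n : ℝ) + m := by exact_mod_cast (show 1 ≤ n + m by omega)
      have hZ1 : (1 : ℝ) ≤ I.Z := by exact_mod_cast Nat.one_le_pow _ _ hI.G
      have ht' : (t : ℝ) ≤ D * ((n : ℝ) + m + I.Z + 1) ^ D := by
        exact_mod_cast ht.trans (hD _)
      have hM : (n : ℝ) + m + I.Z + 1 ≤ 3 * 2 ^ 24 * X ^ (60 * (d * k)) * (n + m) := by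
        calc (n : ℝ) + m + I.Z + 1 ≤ 3 * I.Z * (n + m) := by nlinarith
          _ ≤ 3 * (2 ^ 24 * X ^ (60 * (d * k))) * (n + m) := by gcongr
          _ = _ := by ring
      calc (t : ℝ) ≤ D * (3 * 2 ^ 24 * X ^ (60 * (d * k)) * (n + m)) ^ D := ht'.trans (by gcongr)
        _ = ((D * (3 * 2 ^ 24) ^ D : ℕ) : ℝ) * X ^ (60 * D * (d * k)) * (n + m) ^ D := by
          push_cast
          rw [mul_pow, mul_pow, ← pow_mul]
          ring_nf
        _ ≤ C * X ^ (C * (d * k)) * ((n : ℝ) + m) ^ C := by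
          have h1 : ((D * (3 * 2 ^ 24) ^ D : ℕ) : ℝ) ≤ C := by exact_mod_cast hC
          have h2 : X ^ (60 * D * (d * k)) ≤ X ^ (C * (d * k)) :=
            pow_le_pow_right₀ hX1 (Nat.mul_le_mul_right _ hCD)
          have h3 : ((n : ℝ) + m) ^ D ≤ ((n : ℝ) + m) ^ C := pow_le_pow_right₀ hN (by omega)
          gcongr
    · have h1 : (I.q : ℚ) * Φ.numSat β ≤ I.q * Φ.numSat (RAM.output n s) + Φ.numSat β := by
        exact_mod_cast happ
      have h2 : (Φ.numSat β' : ℚ) ≤ Φ.numSat β := by exact_mod_cast hmax β' hβ'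
      have h3 : (0 : ℚ) ≤ Φ.numSat β := Nat.cast_nonneg _
      have hq0 : (0 : ℚ) < I.q := by exact_mod_cast hq
      refine (mul_le_mul_of_nonneg_left h2 (by linarith)).trans (le_of_mul_le_mul_left ?_ hq0)
      nlinarith [mul_le_mul_of_nonneg_right hqε h3]
  refine ⟨fun ω => ?_, ?_⟩
  · obtain ⟨s, t, h1, h2, -⟩ := key ω
    exact ⟨s, t, h1, h2⟩
  · rw [Set.eq_univ_of_forall (s := {ω | _}) fun ω => ?_]
    · have := isProbabilityMeasure_coinMeasure
      rw [MeasureTheory.probReal_univ, sub_le_self_iff]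
      positivity
    · obtain ⟨s, t, h1, -, h3⟩ := key ω
      exact ⟨s, t, h1, h3⟩
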